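/- Let $T>0$, $r\in\mathbb R$, $M,\beta,\gamma>0$, and let $\mu:[0,T]\to\mathbb R^d$ and $\sigma,R:[0,T]\to\mathbb R^{d\times d}$ be deterministic and continuous, with $\sigma_t$ symmetric positive definite and $R_t$ a positive definite correlation matrix (unit diagonal) for all $t$. On a filtered probability space let $W=(W^1,\dots,W^d)$ be a $d$-dimensional Brownian motion with instantaneous correlation $\mathrm d\langle W^j,W^l\rangle_t=R_t^{jl}\,\mathrm dt$. Let $\mathcal U$ be the set of adapted processes $u=(u^1,\dots,u^d)$ on $[0,T]$ whose paths are left-continuous with right limits and which satisfy $|u^i|\le M$ for all $i$. For $u\in\mathcal U$ the wealth process $X^u$ solves $$\mathrm dX^u_s=\Big[rX^u_s+\sum_{i=1}^d u^i_s(\mu^i_s-r)\Big]\mathrm ds+\sum_{i,j=1}^d u^i_s\sigma^{ij}_s\,\mathrm dW^j_s ,$$ and, for the target function $\mathcal T(y)=\frac1\beta\left(1-e^{-\gamma y}\right)$ and no risk penalty ($F\equiv0$), $$J(t,x,u)=\mathbb E_{t,x}\big[\mathcal T\big(X^u_T-xe^{r(T-t)}\big)\big],$$ where $\mathbb E_{t,x}$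 means that the wealth process is started at time $t$ with $X^u_t=x$. A control $\hat u\in\mathcal U$ is called optimal if it is a Nash equilibrium, that is, if $$\liminf_{h\downarrow0}\frac{J(t,x,\hat u)-J(t,x,u_h)}{h}\ge0\qquad\text{for all } t\in[0,T),\ x\in\mathbb R,\ u\in\mathcal U,$$ where $u_h$ equals $u$ on $[t,t+h)$ and $\hat u$ on $[t+h,T]$. For $t\in(0,T]$ consider the $d$-dimensional linear system in $\hat u_t\in\mathbb R^d$ whose $k$-th row ($k=1,\dots,d$) is $$\hat u^k_t=\frac{(\mu^k_t-r)\,e^{r(T-t)}-\gamma\sum_{i=1,\,i\ne k}^d\hat u^i_t\,\sigma_t^{i\cdot}R_t\,\sigma_t^{\cdot k}\,e^{2r(T-t)}}{\gamma\,\sigma_t^{k\cdot}R_t\,\sigma_t^{\cdot k}\,e^{2r(T-t)}},$$ where $\sigma_t^{i\cdot}$ and $\sigma_t^{\cdot k}$ denote the $i$-th row and the $k$-th column of $\sigma_t$. Then: 1. For each $t\in(0,T]$ the system has exactly one solution. 2. Every deterministic $\hat u\in\mathcal U$ that solves the system for each $t\in(0,T]$ is optimal. 3. If a deterministic $\hat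 u\in\mathcal U$ is optimal, then $\hat u_t$ solves the system at each $t\in(0,T]$ with $|\hat u^k_t|<M$ for all $k$. 4. If $M$ is so large that for every $t\in(0,T]$ all components of the solution of the system are bounded by $M$ in absolute value, then a deterministic optimal $\hat u$ exists, and every deterministic optimal $\hat u$ solves the system for each $t\in(0,T]$ (so it is unique on $(0,T]$). -/

import Mathlib

open MeasureTheory ProbabilityTheory Filter Topology Set
open scoped Matrix

/-- Deterministic data of the Black-Scholes market with `d` risky assets on `[0, T]`: short rate `r`,
drift `μ`, volatility matrix `σ` and instantaneous correlation matrix `R` of the driving Brownian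
motions. (`Matrix.PosDef` over `ℝ` includes symmetry.) -/
structure BSMarket (d : ℕ) where
  T : ℝ
  T_pos : 0 < T
  r : ℝ
  μ : ℝ → Fin d → ℝ
  μ_cont : ContinuousOn μ (Icc 0 T)
  σ : ℝ → Matrix (Fin d) (Fin d) ℝ
  σ_cont : ContinuousOn σ (Icc 0 T)
  σ_posDef : ∀ t ∈ Icc 0 T, (σ t).PosDef
  R : ℝ → Matrix (Fin d) (Fin d) ℝ
  R_cont : ContinuousOn R (Icc 0 T)
  R_posDef : ∀ t ∈ Icc 0 T, (R t).PosDef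
  R_diag : ∀ t ∈ Icc 0 T, ∀ i, R t i i = 1

/-- `W = (W^1, …, W^d)` is, on `[0, T]`, a `d`-dimensional `ℱ`-Brownian motion with instantaneous
correlation matrix `R`, that is `d⟨W^j, W^l⟩_t = R_t^{jl} dt`: it starts at `0`, has continuous paths,
is adapted, and for `s ≤ t` the increment `W_t - W_s` is independent of `ℱ_s` and centred Gaussian
with covariance matrix `∫_s^t R_τ dτ` (expressed through its linear forms). Each `W^j` is a standard
Brownian motion if `R` has unit diagonal, and `R_t^{jl} = Corr(W_t^j, W_t^l)` if `R` is constant. -/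
structure IsCorrelatedBM {Ω : Type*} {mΩ : MeasurableSpace Ω} (P : Measure Ω)
    (ℱ : Filtration ℝ mΩ) (T : ℝ) {d : ℕ} (R : ℝ → Matrix (Fin d) (Fin d) ℝ)
    (W : ℝ → Ω → Fin d → ℝ) : Prop where
  adapted : ∀ t ∈ Icc 0 T, Measurable[ℱ t] (W t)
  zero : ∀ᵐ ω ∂P, W 0 ω = 0
  cont : ∀ᵐ ω ∂P, ContinuousOn (fun t => W t ω) (Icc 0 T)
  indep : ∀ s t, 0 ≤ s → s ≤ t → t ≤ T →
    Indep (MeasurableSpace.comap (fun ω => W t ω - W s ω) inferInstance) (ℱ s) P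
  gauss : ∀ s t, 0 ≤ s → s ≤ t → t ≤ T → ∀ a : Fin d → ℝ,
    P.map (fun ω => a ⬝ᵥ (W t ω - W s ω)) =
      gaussianReal 0 (∫ τ in s..t, a ⬝ᵥ (R τ *ᵥ a)).toNNReal

/-- The control space: `ℱ`-adapted processes with left-continuous paths that have right limits,
each component being bounded by `M`, on `[0, T]`. -/
structure IsControl {Ω : Type*} {mΩ : MeasurableSpace Ω} (ℱ : Filtration ℝ mΩ) (T M : ℝ) {d : ℕ}
    (u : ℝ → Ω → Fin d → ℝ) : Prop where
  adapted : ∀ t ∈ Icc 0 T, Measurable[ℱ t] (u t)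
  leftCont : ∀ ω, ∀ t ∈ Ioc 0 T, ContinuousWithinAt (fun s => u s ω) (Iic t) t
  rightLim : ∀ ω, ∀ t ∈ Ico 0 T, ∃ l, Tendsto (fun s => u s ω) (𝓝[>] t) (𝓝 l)
  bdd : ∀ ω, ∀ t ∈ Icc 0 T, ∀ i, |u t ω i| ≤ M

/-- A deterministic function of time, viewed as a control process. -/
def detControl (Ω : Type*) {d : ℕ} (u : ℝ → Fin d → ℝ) : ℝ → Ω → Fin d → ℝ := fun t _ => u t

/-- The left-point Riemann sum `∑_k ⟨H_{τ_k}, W_{τ_{k+1}} - W_{τ_k}⟩` over the equidistant partition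
`τ_k = a + k (b - a) / n` of `[a, b]`. -/
noncomputable def itoSum {Ω : Type*} {d : ℕ} (H W : ℝ → Ω → Fin d → ℝ) (a b : ℝ) (n : ℕ) (ω : Ω) :
    ℝ :=
  ∑ k ∈ Finset.range n, H (a + k * (b - a) / n) ω ⬝ᵥ
    (W (a + (k + 1) * (b - a) / n) ω - W (a + k * (b - a) / n) ω)

/-- `I` is (a version of) the stochastic integral `∑_j ∫_a^b H^j dW^j`: the limit in probability of
the left-point Riemann sums. -/
def IsItoIntegral {Ω : Type*} {mΩ : MeasurableSpace Ω} (P : Measure Ω) {d : ℕ}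
    (H W : ℝ → Ω → Fin d → ℝ) (a b : ℝ) (I : Ω → ℝ) : Prop :=
  TendstoInMeasure P (fun n : ℕ => itoSum H W a b n) atTop I

/-- `X` is the wealth process on `[t, T]` under the control `u` with wealth `x` at time `t`: a
continuous adapted (up to null sets) solution of
`dX_s = [r X_s + ∑_i u^i_s (μ^i_s - r)] ds + ∑_{i,j} u^i_s σ^{ij}_s dW^j_s`, `X_t = x`. -/
structure IsWealth {Ω : Type*} {mΩ : MeasurableSpace Ω} (P : Measure Ω) (ℱ : Filtration ℝ mΩ) {d : ℕ}
    (m : BSMarket d) (W : ℝ → Ω → Fin d → ℝ) (u : ℝ → Ω → Fin d → ℝ) (t x : ℝ)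
    (X : ℝ → Ω → ℝ) : Prop where
  adapted : ∀ s ∈ Icc t m.T, AEStronglyMeasurable[ℱ s] (X s) P
  cont : ∀ᵐ ω ∂P, ContinuousOn (fun s => X s ω) (Icc t m.T)
  init : ∀ᵐ ω ∂P, X t ω = x
  sde : ∀ s ∈ Icc t m.T,
    IsItoIntegral P (fun τ ω => u τ ω ᵥ* m.σ τ) W t s
      (fun ω => X s ω - x - ∫ τ in t..s, (m.r * X τ ω + ∑ i, u τ ω i * (m.μ τ i - m.r)))

/-- The wealth process on `[t, T]` under `u` started from `x` at time `t` (a version of it: the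
equation determines it up to null sets). -/
noncomputable def wealth {Ω : Type*} {mΩ : MeasurableSpace Ω} (P : Measure Ω) (ℱ : Filtration ℝ mΩ)
    {d : ℕ} (m : BSMarket d) (W : ℝ → Ω → Fin d → ℝ) (u : ℝ → Ω → Fin d → ℝ) (t x : ℝ) :
    ℝ → Ω → ℝ :=
  Classical.epsilon (fun X => IsWealth P ℱ m W u t x X)

/-- The gain `X_T^u - x e^{r (T - t)}`, in money of time `T`, for wealth `x` at time `t`. -/
noncomputable def gain {Ω : Type*} {mΩ : MeasurableSpace Ω} (P : Measure Ω) (ℱ : Filtration ℝ mΩ)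
    {d : ℕ} (m : BSMarket d) (W : ℝ → Ω → Fin d → ℝ) (u : ℝ → Ω → Fin d → ℝ) (t x : ℝ) (ω : Ω) : ℝ :=
  wealth P ℱ m W u t x m.T ω - x * Real.exp (m.r * (m.T - t))

/-- The value functional
`J(t, x, u) = E_{t,x}[𝒯(X_T^u - x e^{r(T-t)})] - lam_t F(ρ_{t,x}(X_T^u - x e^{r(T-t)}))`
with target function `𝒯`, risk aversion `lam`, penalty `F`, and law-invariant risk functional `ρ`
(a function of the law). -/
noncomputable def valueJ {Ω : Type*} {mΩ : MeasurableSpace Ω} (P : Measure Ω) (ℱ : Filtration ℝ mΩ)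
    {d : ℕ} (m : BSMarket d) (W : ℝ → Ω → Fin d → ℝ) (𝒯 lam F : ℝ → ℝ) (ρ : Measure ℝ → ℝ)
    (t x : ℝ) (u : ℝ → Ω → Fin d → ℝ) : ℝ :=
  (∫ ω, 𝒯 (gain P ℱ m W u t x ω) ∂P) - lam t * F (ρ (P.map (gain P ℱ m W u t x)))

/-- The control that follows `u` on `[t, t + h)` and `v` at all other times. -/
noncomputable def deviate {Ω : Type*} {d : ℕ} (v u : ℝ → Ω → Fin d → ℝ) (t h : ℝ) :
    ℝ → Ω → Fin d → ℝ :=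
  fun s ω => if t ≤ s ∧ s < t + h then u s ω else v s ω

/-- `v` is a Nash equilibrium control law (an optimal control): it is a control, and
`liminf_{h ↓ 0} (J(t, x, v) - J(t, x, u_h)) / h ≥ 0` for every `t ∈ [0, T)`, every `x`, and every
control `u`, where `u_h` follows `u` on `[t, t + h)` and `v` from `t + h` on. The lower limit is taken
in the extended reals. -/
def IsNashEquilibrium {Ω : Type*} {mΩ : MeasurableSpace Ω} (P : Measure Ω) (ℱ : Filtration ℝ mΩ)
    {d : ℕ} (m : BSMarket d) (M : ℝ) (W : ℝ → Ω → Fin d → ℝ) (𝒯 lam F : ℝ → ℝ)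
    (ρ : Measure ℝ → ℝ) (v : ℝ → Ω → Fin d → ℝ) : Prop :=
  IsControl ℱ m.T M v ∧
  ∀ t ∈ Ico 0 m.T, ∀ x : ℝ, ∀ u : ℝ → Ω → Fin d → ℝ, IsControl ℱ m.T M u →
    0 ≤ liminf (fun h : ℝ =>
      (((valueJ P ℱ m W 𝒯 lam F ρ t x v -
        valueJ P ℱ m W 𝒯 lam F ρ t x (deviate v u t h)) / h : ℝ) : EReal)) (𝓝[>] 0)

/-- The exponential target function `x ↦ (1 - e^{-γ x}) / β`. -/
noncomputable def expTarget (β γ : ℝ) (x : ℝ) : ℝ := 1 / β * (1 - Real.exp (-γ * x))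

/-- The `d`-dimensional linear system at time `t`, solved row by row for the diagonal unknown;
`(σ_t R_t σ_t) i k = σ_t^{i·} R_t σ_t^{·k}`. -/
def SolvesSystem {d : ℕ} (m : BSMarket d) (γ t : ℝ) (w : Fin d → ℝ) : Prop :=
  ∀ k, w k =
    ((m.μ t k - m.r) * Real.exp (m.r * (m.T - t)) -
        γ * ∑ i ∈ Finset.univ.erase k,
          w i * (m.σ t * m.R t * m.σ t) i k * Real.exp (2 * m.r * (m.T - t))) /
      (γ * (m.σ t * m.R t * m.σ t) k k * Real.exp (2 * m.r * (m.T - t)))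

/-!
Discounting removes the dependence on the wealth: for every admissible control `u`, the gain is
`X_T - x e^{r (T - t)} = ∫_t^T e^{r (T - s)} (u_s · (μ_s - r) ds + u_s σ_s dW_s)` (`isItoLimit_gain`).
The quadratic function `lossRate m γ s w = -γ c w·(μ_s - r) + γ² c² / 2 w·(σ_s R_s σ_s) w`, with
`c = e^{r (T - s)}`, is the drift of the logarithm of `exp (-γ gain)` after removal of an exponential
martingale, that is `E[exp (-γ gain - ∫_t^T lossRate_s (u_s) ds)] = 1` (`integral_exp_gain`).

The system is the first-order condition of this strictly convex function, so its unique solution is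
the global minimizer of the loss rate (`lossRate_of_solvesSystem`). If a deterministic `v` minimizes
the loss rate at each time, then for any other control `u`
`E[exp (-γ gain_u)] ≥ exp (∫ lossRate_s (v_s) ds) = E[exp (-γ gain_v)]`, so no deviation from `v` is
profitable (`isNashEquilibrium_of_solvesSystem`). Conversely, for deterministic controls
`E[exp (-γ gain)] = exp (∫ lossRate)`, and a deviation to a constant `w` on `[t, t + h)` changes the
value at the rate `lossRate w - lossRate v` taken at the right limit of `v` at `t`. Nonnegativity of
these rates and left continuity of `v` show that `v_t` minimizes the loss rate over the cube
`[-M, M]^d` at each `t > 0` (`lossRate_le_of_isNashEquilibrium`). At an interior point of the cube,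
or if the cube contains the global minimizer, this gives the system.

The stochastic calculus behind `integral_exp_gain` is built from the definition of the integral as a
limit of left-point Riemann sums. These sums are integrals of simple processes, for which the
isometry is an induction (`SimpleInt.isometry`); for bounded adapted integrands that are
left-continuous off a countable set of times the sums therefore converge in `L²`
(`exists_isItoLimit`), and the integral is additive in the interval (`IsItoLimit.add`). The
exponential martingale along a grid (`lintegral_exp_itoSum`) yields fourth moment bounds, hence a
continuous version of the integral (`exists_ito_process`) and, by variation of constants, a solution
of the wealth equation (`exists_isWealth`). It also yields `integral_exp_gain` in the limit, since
the Riemann sums have uniformly bounded exponential moments.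
-/

/-! ### Equidistant partitions and left-point sampling -/

/-- The largest point `≤ s` of the equidistant grid `a + k (b - a) / n`, `k ∈ ℤ`. For `n = 0` it is
`a`. -/
noncomputable def gridFloor (a b : ℝ) (n : ℕ) (s : ℝ) : ℝ :=
  a + (⌊(s - a) / (b - a) * n⌋ : ℝ) * (b - a) / n

theorem gridFloor_le {a b s : ℝ} (hab : a < b) (hs : a ≤ s) (n : ℕ) : gridFloor a b n s ≤ s := by
  unfold gridFloor
  rcases Nat.eq_zero_or_pos n with rfl | hn
  · simpa using hs
  have hn' : (0 : ℝ) < n := by exact_mod_cast hn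
  have hb : 0 < b - a := by linarith
  have h := Int.floor_le ((s - a) / (b - a) * n)
  have h2 : (⌊(s - a) / (b - a) * n⌋ : ℝ) * (b - a) / n ≤ ((s - a) / (b - a) * n) * (b - a) / n := by
    gcongr
  have h3 : ((s - a) / (b - a) * n) * (b - a) / n = s - a := by field_simp
  linarith

theorem le_gridFloor {a b s : ℝ} (hab : a < b) (hs : a ≤ s) (n : ℕ) : a ≤ gridFloor a b n s := by
  unfold gridFloor
  have hb : 0 < b - a := by linarith
  have h : (0 : ℝ) ≤ (⌊(s - a) / (b - a) * n⌋ : ℝ) := by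
    have : (0 : ℤ) ≤ ⌊(s - a) / (b - a) * n⌋ := by
      apply Int.floor_nonneg.2
      have : 0 ≤ s - a := by linarith
      positivity
    exact_mod_cast this
  have : 0 ≤ (⌊(s - a) / (b - a) * n⌋ : ℝ) * (b - a) / n := by positivity
  linarith

theorem sub_gridFloor_lt {a b s : ℝ} (hab : a < b) {n : ℕ} (hn : n ≠ 0) :
    s - gridFloor a b n s < (b - a) / n := by
  unfold gridFloor
  have hn' : (0 : ℝ) < n := by exact_mod_cast Nat.pos_of_ne_zero hn
  have hb : 0 < b - a := by linarith
  have h := Int.lt_floor_add_one ((s - a) / (b - a) * n)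
  have h2 : ((s - a) / (b - a) * n) * (b - a) / n <
      ((⌊(s - a) / (b - a) * n⌋ : ℝ) + 1) * (b - a) / n := by
    gcongr
  have h3 : ((s - a) / (b - a) * n) * (b - a) / n = s - a := by field_simp
  have h4 : ((⌊(s - a) / (b - a) * n⌋ : ℝ) + 1) * (b - a) / n =
    (⌊(s - a) / (b - a) * n⌋ : ℝ) * (b - a) / n + (b - a) / n := by ring
  linarith

theorem gridFloor_mem_Icc {a b s : ℝ} (hab : a < b) (hs : s ∈ Icc a b) (n : ℕ) :
    gridFloor a b n s ∈ Icc a b :=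
  ⟨le_gridFloor hab hs.1 n, (gridFloor_le hab hs.1 n).trans hs.2⟩

theorem gridFloor_eq {a b s : ℝ} (hab : a < b) {n : ℕ} (hn : n ≠ 0) (k : ℕ)
    (hs : s ∈ Ico (a + k * (b - a) / n) (a + (k + 1) * (b - a) / n)) :
    gridFloor a b n s = a + k * (b - a) / n := by
  have hn' : (0 : ℝ) < n := by exact_mod_cast Nat.pos_of_ne_zero hn
  have hb : 0 < b - a := by linarith
  have : ⌊(s - a) / (b - a) * n⌋ = (k : ℤ) := by
    rw [Int.floor_eq_iff]
    obtain ⟨h1, h2⟩ := hs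
    constructor
    · have : (k : ℝ) * (b - a) / n ≤ s - a := by linarith
      rw [div_le_iff₀ hn'] at this
      rw [div_mul_eq_mul_div, le_div_iff₀ hb]
      simpa using this
    · have : s - a < (k + 1 : ℝ) * (b - a) / n := by linarith
      rw [lt_div_iff₀ hn'] at this
      rw [div_mul_eq_mul_div, div_lt_iff₀ hb]
      simpa using this
  unfold gridFloor
  rw [this]
  simp

/-- Points of `[a, b)` lie in one of the cells. -/
theorem exists_grid_cell {a b s : ℝ} (hab : a < b) {n : ℕ} (hn : n ≠ 0) (hs : s ∈ Ico a b) :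
    ∃ k < n, s ∈ Ico (a + k * (b - a) / n) (a + (k + 1) * (b - a) / n) := by
  have hn' : (0 : ℝ) < n := by exact_mod_cast Nat.pos_of_ne_zero hn
  have hb : 0 < b - a := by linarith
  have h0 : 0 ≤ (s - a) / (b - a) * n := by
    have : 0 ≤ s - a := by linarith [hs.1]
    positivity
  refine ⟨⌊(s - a) / (b - a) * n⌋₊, ?_, ?_, ?_⟩
  · rw [Nat.floor_lt h0]
    have : (s - a) / (b - a) < 1 := by rw [div_lt_one hb]; linarith [hs.2]
    nlinarith
  · have h := Nat.floor_le h0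
    have h2 : (⌊(s - a) / (b - a) * n⌋₊ : ℝ) * (b - a) / n ≤
      ((s - a) / (b - a) * n) * (b - a) / n := by gcongr
    have h3 : ((s - a) / (b - a) * n) * (b - a) / n = s - a := by field_simp
    linarith
  · have h := Nat.lt_floor_add_one ((s - a) / (b - a) * n)
    have h2 : ((s - a) / (b - a) * n) * (b - a) / n <
      ((⌊(s - a) / (b - a) * n⌋₊ : ℝ) + 1) * (b - a) / n := by gcongr
    have h3 : ((s - a) / (b - a) * n) * (b - a) / n = s - a := by field_simp
    linarith

theorem gridPt_mono {a b : ℝ} (hab : a ≤ b) (n : ℕ) : Monotone (fun k : ℕ => a + k * (b - a) / n) := by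
  intro i j hij
  have : (i : ℝ) ≤ j := by exact_mod_cast hij
  have hb : 0 ≤ b - a := by linarith
  dsimp only
  gcongr

theorem gridPt_mem_Icc {a b : ℝ} (hab : a ≤ b) {n k : ℕ} (hk : k ≤ n) :
    a + k * (b - a) / n ∈ Icc a b := by
  have hb : 0 ≤ b - a := by linarith
  constructor
  · have : 0 ≤ (k : ℝ) * (b - a) / n := by positivity
    linarith
  · have hk' : (k : ℝ) ≤ n := by exact_mod_cast hk
    have : (k : ℝ) * (b - a) / n ≤ b - a := by
      rcases Nat.eq_zero_or_pos n with rfl | hn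
      · simpa using hb
      have hn' : (0 : ℝ) < n := by exact_mod_cast hn
      rw [div_le_iff₀ hn']
      nlinarith
    linarith

/-- The step function that samples `f` at the left end points of the cells. -/
theorem sum_indicator_grid {E : Type*} [AddCommMonoid E] {a b : ℝ} (hab : a ≤ b) {n : ℕ}
    (hn : n ≠ 0) (f : ℝ → E) (s : ℝ) :
    ∑ k ∈ Finset.range n, (Ico (a + k * (b - a) / n) (a + (k + 1) * (b - a) / n)).indicator
      (fun _ => f (a + k * (b - a) / n)) s =
    (Ico a b).indicator (fun s => f (gridFloor a b n s)) s := by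
  rcases hab.eq_or_lt with rfl | hab
  · simp
  by_cases hs : s ∈ Ico a b
  · rw [indicator_of_mem hs]
    obtain ⟨k, hk, hsk⟩ := exists_grid_cell hab hn hs
    rw [Finset.sum_eq_single_of_mem k (Finset.mem_range.2 hk)]
    · rw [indicator_of_mem hsk, gridFloor_eq hab hn k hsk]
    · intro j _ hjk
      rw [indicator_of_notMem]
      intro hsj
      have h1 := gridFloor_eq hab hn k hsk
      have h2 := gridFloor_eq hab hn j hsj
      rw [h1] at h2
      have hn' : (0 : ℝ) < n := by exact_mod_cast Nat.pos_of_ne_zero hn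
      have hb : b - a ≠ 0 := by linarith
      have h3 : (k : ℝ) * (b - a) / n = j * (b - a) / n := by linarith
      rw [div_left_inj' hn'.ne', mul_left_inj' hb] at h3
      exact hjk (by exact_mod_cast h3.symm)
  · rw [indicator_of_notMem hs]
    refine Finset.sum_eq_zero fun k hk => indicator_of_notMem (fun hsk => hs ?_) _
    have hk' := Finset.mem_range.1 hk
    refine ⟨(gridPt_mem_Icc hab.le hk'.le).1.trans hsk.1, hsk.2.trans_le ?_⟩
    have := (gridPt_mem_Icc hab.le (n := n) (k := k + 1) hk').2
    push_cast at this
    exact this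

theorem measurable_comp_gridFloor {E : Type*} [MeasurableSpace E] (a b : ℝ) (n : ℕ) (f : ℝ → E) :
    Measurable (fun s => f (gridFloor a b n s)) := by
  have h : Measurable (fun s : ℝ => ⌊(s - a) / (b - a) * n⌋) :=
    Int.measurable_floor.comp (by fun_prop)
  exact (measurable_from_top (f := fun k : ℤ => f (a + (k : ℝ) * (b - a) / n))).comp h

theorem tendsto_gridFloor {a b s : ℝ} (hab : a < b) (hs : a ≤ s) :
    Tendsto (fun n => gridFloor a b n s) atTop (𝓝[≤] s) := by
  refine tendsto_nhdsWithin_iff.2 ⟨?_, Eventually.of_forall fun n => gridFloor_le hab hs n⟩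
  have h1 : Tendsto (fun n : ℕ => s - (b - a) / n) atTop (𝓝 (s - 0)) :=
    tendsto_const_nhds.sub (tendsto_const_div_atTop_nhds_zero_nat _)
  rw [sub_zero] at h1
  refine tendsto_of_tendsto_of_tendsto_of_le_of_le' h1 tendsto_const_nhds ?_
    (Eventually.of_forall fun n => gridFloor_le hab hs n)
  filter_upwards [eventually_ne_atTop 0] with n hn
  linarith [sub_gridFloor_lt (s := s) hab hn]

theorem tendsto_comp_gridFloor {E : Type*} [TopologicalSpace E] {a b s : ℝ} (hab : a < b)
    (hs : a ≤ s) {f : ℝ → E} (hf : ContinuousWithinAt f (Iic s) s) :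
    Tendsto (fun n => f (gridFloor a b n s)) atTop (𝓝 (f s)) :=
  hf.tendsto.comp (tendsto_gridFloor hab hs)

/-- A function which is left-continuous off a countable set is measurable, being a limit of step
functions. -/
theorem aestronglyMeasurable_of_leftCont {E : Type*} [TopologicalSpace E]
    [TopologicalSpace.PseudoMetrizableSpace E] [MeasurableSpace E] [BorelSpace E]
    [SecondCountableTopology E]
    {a b : ℝ} {f : ℝ → E} {D : Set ℝ}
    (hD : D.Countable) (hf : ∀ s ∈ Ioc a b, s ∉ D → ContinuousWithinAt f (Iic s) s) :
    AEStronglyMeasurable f (volume.restrict (Ioc a b)) := by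
  rcases lt_or_ge a b with hab | hab
  · refine aestronglyMeasurable_of_tendsto_ae atTop (f := fun n s => f (gridFloor a b n s))
      (fun n => (measurable_comp_gridFloor a b n f).aestronglyMeasurable) ?_
    have : ∀ᵐ s ∂(volume.restrict (Ioc a b)), s ∉ D :=
      ae_restrict_of_ae (hD.ae_notMem _)
    filter_upwards [this, ae_restrict_mem measurableSet_Ioc] with s hsD hs
    exact tendsto_comp_gridFloor hab hs.1.le (hf s hs hsD)
  · simp [Ioc_eq_empty (not_lt.2 hab)]

theorem intervalIntegrable_of_leftCont {E : Type*} [NormedAddCommGroup E] [MeasurableSpace E]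
    [BorelSpace E] [SecondCountableTopology E]
    {a b : ℝ} (hab : a ≤ b) {f : ℝ → E} {D : Set ℝ}
    (hD : D.Countable) (hf : ∀ s ∈ Ioc a b, s ∉ D → ContinuousWithinAt f (Iic s) s) {K : ℝ}
    (hK : ∀ s ∈ Ioc a b, ‖f s‖ ≤ K) :
    IntervalIntegrable f volume a b := by
  rw [intervalIntegrable_iff_integrableOn_Ioc_of_le hab]
  refine Integrable.mono' (g := fun _ => K) (by simp) (aestronglyMeasurable_of_leftCont hD hf) ?_
  filter_upwards [ae_restrict_mem measurableSet_Ioc] with s hs using hK s hs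

/-- Integrals of left-point samples, cell by cell. -/
theorem sum_integral_grid {E : Type*} [NormedAddCommGroup E] [NormedSpace ℝ E] {a b : ℝ}
    (hab : a ≤ b) {n : ℕ} (hn : n ≠ 0) (F : ℝ → ℝ → E)
    (hF : ∀ p ∈ Icc a b, IntervalIntegrable (F p) volume a b) :
    ∑ k ∈ Finset.range n, ∫ s in (a + k * (b - a) / n)..(a + (k + 1) * (b - a) / n),
      F (a + k * (b - a) / n) s = ∫ s in a..b, F (gridFloor a b n s) s := by
  have hn' : (0 : ℝ) < n := by exact_mod_cast Nat.pos_of_ne_zero hn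
  rcases hab.eq_or_lt with rfl | hab'
  · simp
  have key : ∀ k < n, ∀ s ∈ Ioo (a + (k : ℝ) * (b - a) / n) (a + ((k : ℝ) + 1) * (b - a) / n),
      F (a + k * (b - a) / n) s = F (gridFloor a b n s) s := fun k _ s hs => by
    rw [gridFloor_eq hab' hn k ⟨hs.1.le, hs.2⟩]
  have hle : ∀ k : ℕ, a + (k : ℝ) * (b - a) / n ≤ a + ((k : ℝ) + 1) * (b - a) / n := fun k => by
    simpa using gridPt_mono hab n (Nat.le_succ k)
  have hii : ∀ k < n, ∀ p ∈ Icc a b, IntervalIntegrable (F p) volume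
      (a + (k : ℝ) * (b - a) / n) (a + ((k : ℝ) + 1) * (b - a) / n) := fun k hk p hp => by
    refine (hF p hp).mono_set ?_
    rw [uIcc_of_le hab, uIcc_of_le (hle k)]
    refine Icc_subset_Icc (gridPt_mem_Icc hab hk.le).1 ?_
    have := (gridPt_mem_Icc hab (n := n) (k := k + 1) hk).2
    push_cast at this
    exact this
  have hcong : ∀ k < n, IntervalIntegrable (fun s => F (gridFloor a b n s) s) volume
      (a + (k : ℝ) * (b - a) / n) (a + ((k : ℝ) + 1) * (b - a) / n) := fun k hk => by
    have h := hii k hk _ (gridPt_mem_Icc hab hk.le)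
    rw [intervalIntegrable_iff_integrableOn_Ioo_of_le (hle k)] at h ⊢
    exact h.congr_fun (key k hk) measurableSet_Ioo
  have h1 := intervalIntegral.sum_integral_adjacent_intervals (μ := volume)
    (f := fun s => F (gridFloor a b n s) s) (a := fun k : ℕ => a + (k : ℝ) * (b - a) / n) (n := n)
    (fun k hk => by simpa using hcong k hk)
  have h2 : a + (n : ℝ) * (b - a) / n = b := by field_simp; ring
  simp only [Nat.cast_zero, zero_mul, zero_div, add_zero, h2] at h1
  rw [← h1]
  refine Finset.sum_congr rfl fun k hk => ?_
  have hk' := Finset.mem_range.1 hk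
  push_cast
  rw [intervalIntegral.integral_of_le (hle k), intervalIntegral.integral_of_le (hle k),
    integral_Ioc_eq_integral_Ioo, integral_Ioc_eq_integral_Ioo]
  exact setIntegral_congr_fun measurableSet_Ioo (key k hk')

/-! ### Increments of the Brownian motion -/

theorem continuousOn_quadForm {d : ℕ} {R : ℝ → Matrix (Fin d) (Fin d) ℝ} {S : Set ℝ}
    (hR : ContinuousOn R S) (a b : Fin d → ℝ) : ContinuousOn (fun τ => a ⬝ᵥ (R τ *ᵥ b)) S := by
  have : Continuous fun A : Matrix (Fin d) (Fin d) ℝ => a ⬝ᵥ (A *ᵥ b) := by fun_prop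
  exact this.comp_continuousOn hR

theorem intervalIntegrable_quadForm {d : ℕ} {R : ℝ → Matrix (Fin d) (Fin d) ℝ} {T p q : ℝ}
    (hR : ContinuousOn R (Icc 0 T)) (hp : 0 ≤ p) (hpq : p ≤ q) (hq : q ≤ T) (a b : Fin d → ℝ) :
    IntervalIntegrable (fun τ => a ⬝ᵥ (R τ *ᵥ b)) volume p q := by
  apply ContinuousOn.intervalIntegrable
  rw [uIcc_of_le hpq]
  exact continuousOn_quadForm (hR.mono (Icc_subset_Icc hp hq)) a b

theorem quadForm_comm {d : ℕ} {A : Matrix (Fin d) (Fin d) ℝ} (hA : A.PosDef) (a b : Fin d → ℝ) :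
    a ⬝ᵥ (A *ᵥ b) = b ⬝ᵥ (A *ᵥ a) := by
  have hs : Aᵀ = A := by simpa [Matrix.IsHermitian] using hA.isHermitian
  rw [Matrix.dotProduct_mulVec, dotProduct_comm, ← Matrix.mulVec_transpose, hs]

theorem quadForm_nonneg {d : ℕ} {A : Matrix (Fin d) (Fin d) ℝ} (hA : A.PosDef) (a : Fin d → ℝ) :
    0 ≤ a ⬝ᵥ (A *ᵥ a) := by
  simpa using hA.posSemidef.dotProduct_mulVec_nonneg a

section Increments

set_option linter.unusedSectionVars false

variable {Ω : Type*} {mΩ : MeasurableSpace Ω} {P : Measure Ω} [IsProbabilityMeasure P]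
  {ℱ : Filtration ℝ mΩ} {T : ℝ} {d : ℕ} {R : ℝ → Matrix (Fin d) (Fin d) ℝ}
  {W : ℝ → Ω → Fin d → ℝ}

theorem IsCorrelatedBM.measurable_incr (hW : IsCorrelatedBM P ℱ T R W) {p q : ℝ} (hp : 0 ≤ p)
    (hpq : p ≤ q) (hq : q ≤ T) : Measurable[ℱ q] (fun ω => W q ω - W p ω) :=
  (hW.adapted q ⟨hp.trans hpq, hq⟩).sub
    ((hW.adapted p ⟨hp, hpq.trans hq⟩).mono (ℱ.mono hpq) le_rfl)

theorem IsCorrelatedBM.measurable_incr' (hW : IsCorrelatedBM P ℱ T R W) {p q : ℝ} (hp : 0 ≤ p)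
    (hpq : p ≤ q) (hq : q ≤ T) : Measurable (fun ω => W q ω - W p ω) :=
  (hW.measurable_incr hp hpq hq).mono (ℱ.le q) le_rfl

theorem IsCorrelatedBM.indepFun_incr (hW : IsCorrelatedBM P ℱ T R W) {p q : ℝ} (hp : 0 ≤ p)
    (hpq : p ≤ q) (hq : q ≤ T) {β : Type*} [MeasurableSpace β] {f : Ω → β}
    (hf : Measurable[ℱ p] f) : IndepFun f (fun ω => W q ω - W p ω) P := by
  have h := (hW.indep p q hp hpq hq).symm
  rw [IndepFun_iff_Indep]
  exact indep_of_indep_of_le_left h hf.comap_le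

theorem IsCorrelatedBM.memLp_incr (hW : IsCorrelatedBM P ℱ T R W) {p q : ℝ} (hp : 0 ≤ p)
    (hpq : p ≤ q) (hq : q ≤ T) (a : Fin d → ℝ) :
    MemLp (fun ω => a ⬝ᵥ (W q ω - W p ω)) 2 P := by
  have hm : Measurable (fun ω => a ⬝ᵥ (W q ω - W p ω)) := by
    have := hW.measurable_incr' hp hpq hq
    have h2 : Measurable fun y : Fin d → ℝ => a ⬝ᵥ y := by unfold dotProduct; fun_prop
    exact h2.comp this
  have h := memLp_id_gaussianReal (μ := 0)
    (v := (∫ τ in p..q, a ⬝ᵥ (R τ *ᵥ a)).toNNReal) 2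
  rw [← hW.gauss p q hp hpq hq a] at h
  exact (memLp_map_measure_iff (by fun_prop) hm.aemeasurable).1 h

theorem IsCorrelatedBM.integral_incr (hW : IsCorrelatedBM P ℱ T R W) {p q : ℝ} (hp : 0 ≤ p)
    (hpq : p ≤ q) (hq : q ≤ T) (a : Fin d → ℝ) :
    ∫ ω, a ⬝ᵥ (W q ω - W p ω) ∂P = 0 := by
  have hm := (hW.memLp_incr hp hpq hq a).aestronglyMeasurable.aemeasurable
  have h := integral_map (f := fun x : ℝ => x) hm (by fun_prop)
  rw [← h, hW.gauss p q hp hpq hq a, integral_id_gaussianReal]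

theorem IsCorrelatedBM.integral_incr_sq (hW : IsCorrelatedBM P ℱ T R W)
    (hRp : ∀ t ∈ Icc 0 T, (R t).PosDef) {p q : ℝ} (hp : 0 ≤ p)
    (hpq : p ≤ q) (hq : q ≤ T) (a : Fin d → ℝ) :
    ∫ ω, (a ⬝ᵥ (W q ω - W p ω)) ^ 2 ∂P = ∫ τ in p..q, a ⬝ᵥ (R τ *ᵥ a) := by
  have hm := (hW.memLp_incr hp hpq hq a).aestronglyMeasurable.aemeasurable
  have h := integral_map (f := fun x : ℝ => x ^ 2) hm (by fun_prop)
  rw [← h, hW.gauss p q hp hpq hq a]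
  have h2 := variance_eq_sub (memLp_id_gaussianReal (μ := 0)
    (v := (∫ τ in p..q, a ⬝ᵥ (R τ *ᵥ a)).toNNReal) 2)
  rw [variance_id_gaussianReal] at h2
  simp only [id, Pi.pow_apply, integral_id_gaussianReal] at h2
  rw [← sub_zero (∫ x, _ ∂_)]
  simp only [ne_eq, OfNat.ofNat_ne_zero, not_false_eq_true, zero_pow, sub_zero] at h2 ⊢
  rw [← h2, Real.coe_toNNReal]
  refine intervalIntegral.integral_nonneg hpq fun s hs => quadForm_nonneg (hRp s ?_) a
  exact ⟨hp.trans hs.1, hs.2.trans hq⟩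

theorem IsCorrelatedBM.memLp_incr_coord (hW : IsCorrelatedBM P ℱ T R W) {p q : ℝ} (hp : 0 ≤ p)
    (hpq : p ≤ q) (hq : q ≤ T) (j : Fin d) :
    MemLp (fun ω => (W q ω - W p ω) j) 2 P := by
  simpa [single_one_dotProduct] using hW.memLp_incr hp hpq hq (Pi.single j 1)

theorem IsCorrelatedBM.integral_incr_coord (hW : IsCorrelatedBM P ℱ T R W) {p q : ℝ} (hp : 0 ≤ p)
    (hpq : p ≤ q) (hq : q ≤ T) (j : Fin d) : ∫ ω, (W q ω - W p ω) j ∂P = 0 := by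
  simpa [single_one_dotProduct] using hW.integral_incr hp hpq hq (Pi.single j 1)

theorem IsCorrelatedBM.integral_incr_mul (hW : IsCorrelatedBM P ℱ T R W)
    (hR : ContinuousOn R (Icc 0 T))
    (hRp : ∀ t ∈ Icc 0 T, (R t).PosDef) {p q : ℝ} (hp : 0 ≤ p)
    (hpq : p ≤ q) (hq : q ≤ T) (j l : Fin d) :
    ∫ ω, (W q ω - W p ω) j * (W q ω - W p ω) l ∂P = ∫ τ in p..q, R τ j l := by
  have hj := hW.integral_incr_sq hRp hp hpq hq (Pi.single j 1)
  have hl := hW.integral_incr_sq hRp hp hpq hq (Pi.single l 1)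
  have hjl := hW.integral_incr_sq hRp hp hpq hq (Pi.single j 1 + Pi.single l 1)
  have h1 : ∀ i k, IntervalIntegrable (fun τ => R τ i k) volume p q := fun i k => by
    simpa [single_one_dotProduct] using
      intervalIntegrable_quadForm hR hp hpq hq (Pi.single i 1) (Pi.single k 1)
  have h2 : ∀ i k, Integrable (fun ω => (W q ω - W p ω) i * (W q ω - W p ω) k) P := fun i k =>
    (hW.memLp_incr_coord hp hpq hq i).integrable_mul (hW.memLp_incr_coord hp hpq hq k)
  simp only [single_one_dotProduct, add_dotProduct, Matrix.mulVec_add, Matrix.mulVec_single_one,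
    Pi.add_apply, Matrix.col_apply] at hj hl hjl
  have e1 : ∫ ω, ((W q ω - W p ω) j + (W q ω - W p ω) l) ^ 2 ∂P =
      ∫ ω, (W q ω - W p ω) j ^ 2 ∂P + ∫ ω, (W q ω - W p ω) l ^ 2 ∂P +
        2 * ∫ ω, (W q ω - W p ω) j * (W q ω - W p ω) l ∂P := by
    rw [← integral_const_mul, ← integral_add, ← integral_add]
    · congr 1; ext ω; ring
    · exact ((h2 j j).add (h2 l l)).congr (ae_of_all _ fun ω => by simp [sq])
    · exact (h2 j l).const_mul 2
    · exact (h2 j j).congr (ae_of_all _ fun ω => by simp [sq])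
    · exact (h2 l l).congr (ae_of_all _ fun ω => by simp [sq])
  have e2 : ∫ τ in p..q, (R τ j j + R τ j l + (R τ l j + R τ l l)) =
      (∫ τ in p..q, R τ j j) + (∫ τ in p..q, R τ l l) + 2 * ∫ τ in p..q, R τ j l := by
    rw [← intervalIntegral.integral_const_mul, ← intervalIntegral.integral_add (h1 _ _) (h1 _ _),
      ← intervalIntegral.integral_add ((h1 _ _).add (h1 _ _)) ((h1 _ _).const_mul 2)]
    refine intervalIntegral.integral_congr fun τ hτ => ?_
    rw [uIcc_of_le hpq] at hτ
    have hs : (R τ)ᵀ = R τ := by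
      simpa [Matrix.IsHermitian] using (hRp τ ⟨hp.trans hτ.1, hτ.2.trans hq⟩).isHermitian
    have : R τ l j = R τ j l := by conv_lhs => rw [← hs, Matrix.transpose_apply]
    simp only [this]; ring
  rw [e1, hj, hl] at hjl
  linarith [hjl, e2]

end Increments

/-! ### Integrals of simple integrands and their isometry -/

section Isometry

set_option linter.unusedSectionVars false

variable {Ω : Type*} {mΩ : MeasurableSpace Ω} {P : Measure Ω} [IsProbabilityMeasure P]
  {ℱ : Filtration ℝ mΩ} {T : ℝ} {d : ℕ} {R : ℝ → Matrix (Fin d) (Fin d) ℝ}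
  {W : ℝ → Ω → Fin d → ℝ}

/-- `SimpleInt ℱ T W φ S`: the integrand `φ` is a finite sum of terms `1_{[p, q)} ξ` with `ξ` bounded
and `ℱ_p`-measurable, and `S = ∫ φ dW` is the sum of the corresponding `ξ ⬝ᵥ (W_q - W_p)`. -/
inductive SimpleInt (ℱ : Filtration ℝ mΩ) (T : ℝ) (W : ℝ → Ω → Fin d → ℝ) :
    (ℝ → Ω → Fin d → ℝ) → (Ω → ℝ) → Prop
  | elem (p q : ℝ) (ξ : Ω → Fin d → ℝ) (K : ℝ) (hp : 0 ≤ p) (hpq : p ≤ q) (hq : q ≤ T)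
      (hξ : Measurable[ℱ p] ξ) (hK : ∀ ω, ‖ξ ω‖ ≤ K) :
      SimpleInt ℱ T W ((Ico p q).indicator (fun _ => ξ)) (fun ω => ξ ω ⬝ᵥ (W q ω - W p ω))
  | zero : SimpleInt ℱ T W 0 0
  | add {φ φ' : ℝ → Ω → Fin d → ℝ} {S S' : Ω → ℝ} (h : SimpleInt ℱ T W φ S)
      (h' : SimpleInt ℱ T W φ' S') : SimpleInt ℱ T W (φ + φ') (S + S')

theorem SimpleInt.neg {φ : ℝ → Ω → Fin d → ℝ} {S : Ω → ℝ} (h : SimpleInt ℱ T W φ S) :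
    SimpleInt ℱ T W (-φ) (-S) := by
  induction h with
  | elem p q ξ K hp hpq hq hξ hK =>
    have := SimpleInt.elem (W := W) p q (-ξ) K hp hpq hq (hξ.neg) (by simpa using hK)
    convert this using 1
    · ext s ω; by_cases hs : s ∈ Ico p q <;> simp [indicator, hs]
    · ext ω; simp [neg_add_eq_sub]
  | zero => simpa using SimpleInt.zero
  | add _ _ h h' => rw [neg_add, neg_add]; exact h.add h'

theorem SimpleInt.sub {φ φ' : ℝ → Ω → Fin d → ℝ} {S S' : Ω → ℝ} (h : SimpleInt ℱ T W φ S)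
    (h' : SimpleInt ℱ T W φ' S') : SimpleInt ℱ T W (φ - φ') (S - S') := by
  rw [sub_eq_add_neg, sub_eq_add_neg]; exact h.add h'.neg

theorem SimpleInt.sum {ι : Type*} (s : Finset ι) {φ : ι → ℝ → Ω → Fin d → ℝ} {S : ι → Ω → ℝ}
    (h : ∀ i ∈ s, SimpleInt ℱ T W (φ i) (S i)) :
    SimpleInt ℱ T W (∑ i ∈ s, φ i) (∑ i ∈ s, S i) := by
  classical
  induction s using Finset.induction_on with
  | empty => simpa using SimpleInt.zero
  | insert i s hi ih =>
    rw [Finset.sum_insert hi, Finset.sum_insert hi]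
    exact (h i (Finset.mem_insert_self _ _)).add (ih fun j hj => h j (Finset.mem_insert_of_mem hj))

/-- The polarized Itô isometry `E[S S'] = ∫_0^T E[φ_sᵀ R_s φ'_s] ds`, with the integrability it
presupposes. -/
structure ItoPair (P : Measure Ω) (T : ℝ) (R : ℝ → Matrix (Fin d) (Fin d) ℝ)
    (φ : ℝ → Ω → Fin d → ℝ) (S : Ω → ℝ) (φ' : ℝ → Ω → Fin d → ℝ) (S' : Ω → ℝ) : Prop where
  int : Integrable (fun ω => S ω * S' ω) P
  int_slice : ∀ s ∈ Icc 0 T, Integrable (fun ω => φ s ω ⬝ᵥ (R s *ᵥ φ' s ω)) P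
  int_time : IntervalIntegrable (fun s => ∫ ω, φ s ω ⬝ᵥ (R s *ᵥ φ' s ω) ∂P) volume 0 T
  eq : ∫ ω, S ω * S' ω ∂P = ∫ s in 0..T, ∫ ω, φ s ω ⬝ᵥ (R s *ᵥ φ' s ω) ∂P

theorem ItoPair.symm (hT : 0 ≤ T) (hRp : ∀ t ∈ Icc 0 T, (R t).PosDef)
    {φ φ' : ℝ → Ω → Fin d → ℝ} {S S' : Ω → ℝ} (h : ItoPair P T R φ S φ' S') :
    ItoPair P T R φ' S' φ S := by
  have e : ∀ s ∈ Icc 0 T, ∀ ω, φ' s ω ⬝ᵥ (R s *ᵥ φ s ω) = φ s ω ⬝ᵥ (R s *ᵥ φ' s ω) :=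
    fun s hs ω => quadForm_comm (hRp s hs) _ _
  refine ⟨by simpa [mul_comm] using h.int, fun s hs => by simpa only [e s hs] using h.int_slice s hs,
    ?_, ?_⟩
  · refine h.int_time.congr fun s hs => ?_
    rw [uIoc_of_le hT] at hs
    simp only [e s (Ioc_subset_Icc_self hs)]
  · have : ∫ ω, S' ω * S ω ∂P = ∫ ω, S ω * S' ω ∂P := by simp only [mul_comm]
    rw [this, h.eq]
    refine intervalIntegral.integral_congr fun s hs => ?_
    rw [uIcc_of_le hT] at hs
    simp only [e s hs]

theorem ItoPair.add_left (hT : 0 ≤ T) {φ₁ φ₂ φ' : ℝ → Ω → Fin d → ℝ} {S₁ S₂ S' : Ω → ℝ}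
    (h₁ : ItoPair P T R φ₁ S₁ φ' S') (h₂ : ItoPair P T R φ₂ S₂ φ' S') :
    ItoPair P T R (φ₁ + φ₂) (S₁ + S₂) φ' S' := by
  have e : ∀ s ∈ Icc 0 T, ∫ ω, (φ₁ + φ₂) s ω ⬝ᵥ (R s *ᵥ φ' s ω) ∂P =
      ∫ ω, φ₁ s ω ⬝ᵥ (R s *ᵥ φ' s ω) ∂P + ∫ ω, φ₂ s ω ⬝ᵥ (R s *ᵥ φ' s ω) ∂P := fun s hs => by
    rw [← integral_add (h₁.int_slice s hs) (h₂.int_slice s hs)]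
    simp only [Pi.add_apply, add_dotProduct]
  refine ⟨?_, fun s hs => ?_, ?_, ?_⟩
  · simp only [Pi.add_apply, add_mul]; exact h₁.int.add h₂.int
  · simp only [Pi.add_apply, add_dotProduct]; exact (h₁.int_slice s hs).add (h₂.int_slice s hs)
  · refine (h₁.int_time.add h₂.int_time).congr fun s hs => ?_
    rw [uIoc_of_le hT] at hs
    exact (e s (Ioc_subset_Icc_self hs)).symm
  · simp only [Pi.add_apply, add_mul]
    rw [integral_add h₁.int h₂.int, h₁.eq, h₂.eq, ← intervalIntegral.integral_add h₁.int_time h₂.int_time]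
    refine intervalIntegral.integral_congr fun s hs => ?_
    rw [uIcc_of_le hT] at hs
    exact (e s hs).symm

theorem ItoPair.zero_left (φ' : ℝ → Ω → Fin d → ℝ) (S' : Ω → ℝ) :
    ItoPair P T R 0 0 φ' S' :=
  ⟨by simp, by simp, by simp, by simp⟩

/-- Increments over consecutive intervals are uncorrelated. -/
theorem ItoPair.elem_of_le (hW : IsCorrelatedBM P ℱ T R W) {p q p' q' : ℝ}
    (hp : 0 ≤ p) (hpq : p ≤ q) (hqp' : q ≤ p') (hpq' : p' ≤ q') (hq' : q' ≤ T)
    {ξ ξ' : Ω → Fin d → ℝ} (hξ : Measurable[ℱ p] ξ) (hξ' : Measurable[ℱ p'] ξ') {K K' : ℝ}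
    (hK : ∀ ω, ‖ξ ω‖ ≤ K) (hK' : ∀ ω, ‖ξ' ω‖ ≤ K') :
    ItoPair P T R ((Ico p q).indicator (fun _ => ξ)) (fun ω => ξ ω ⬝ᵥ (W q ω - W p ω))
      ((Ico p' q').indicator (fun _ => ξ')) (fun ω => ξ' ω ⬝ᵥ (W q' ω - W p' ω)) := by
  have z : ∀ s ω, (Ico p q).indicator (fun _ => ξ) s ω ⬝ᵥ
      (R s *ᵥ (Ico p' q').indicator (fun _ => ξ') s ω) = 0 := fun s ω => by
    by_cases hs : s ∈ Ico p q
    · have : s ∉ Ico p' q' := fun h => by linarith [hs.2, h.1]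
      simp [indicator_of_notMem this]
    · simp [indicator_of_notMem hs]
  have hp' : 0 ≤ p' := hp.trans (hpq.trans hqp')
  have hqT : q ≤ T := hqp'.trans (hpq'.trans hq')
  have hΔ : Measurable[ℱ p'] fun ω => W q ω - W p ω :=
    (hW.measurable_incr hp hpq hqT).mono (ℱ.mono hqp') le_rfl
  have hξp : Measurable[ℱ p'] ξ := hξ.mono (ℱ.mono (hpq.trans hqp')) le_rfl
  -- the product is `∑ A_l Δ'_l` with `A_l` square integrable and `ℱ_{p'}`-measurable
  have hA : ∀ l, Measurable[ℱ p'] fun ω => (ξ ω ⬝ᵥ (W q ω - W p ω)) * ξ' ω l := fun l => by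
    refine Measurable.mul ?_ ((measurable_pi_apply l).comp hξ')
    unfold dotProduct
    exact Finset.measurable_sum _ fun i _ =>
      ((measurable_pi_apply i).comp hξp).mul ((measurable_pi_apply i).comp hΔ)
  have hAi : ∀ l, Integrable (fun ω => (ξ ω ⬝ᵥ (W q ω - W p ω)) * ξ' ω l) P := fun l => by
    have : Integrable (fun ω => ξ ω ⬝ᵥ (W q ω - W p ω)) P := by
      unfold dotProduct
      refine integrable_finsetSum _ fun i _ => ?_
      refine ((hW.memLp_incr_coord hp hpq hqT i).integrable one_le_two).bdd_mul (c := K)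
        (((measurable_pi_apply i).comp (hξ.mono (ℱ.le _) le_rfl)).aestronglyMeasurable)
        (ae_of_all _ fun ω => (norm_le_pi_norm _ i).trans (hK ω))
    refine this.mul_bdd (c := K')
      (((measurable_pi_apply l).comp (hξ'.mono (ℱ.le _) le_rfl)).aestronglyMeasurable)
      (ae_of_all _ fun ω => (norm_le_pi_norm _ l).trans (hK' ω))
  have hind : ∀ l, IndepFun (fun ω => (ξ ω ⬝ᵥ (W q ω - W p ω)) * ξ' ω l)
      (fun ω => (W q' ω - W p' ω) l) P := fun l =>
    (hW.indepFun_incr hp' hpq' hq' (hA l)).comp measurable_id (measurable_pi_apply l)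
  have hi : ∀ l, Integrable (fun ω => (ξ ω ⬝ᵥ (W q ω - W p ω)) * ξ' ω l * (W q' ω - W p' ω) l) P :=
    fun l => (hind l).integrable_mul (hAi l)
      ((hW.memLp_incr_coord hp' hpq' hq' l).integrable one_le_two)
  have e : ∀ ω, (ξ ω ⬝ᵥ (W q ω - W p ω)) * (ξ' ω ⬝ᵥ (W q' ω - W p' ω)) =
      ∑ l, (ξ ω ⬝ᵥ (W q ω - W p ω)) * ξ' ω l * (W q' ω - W p' ω) l := fun ω => by
    rw [dotProduct.eq_1 (ξ' ω), Finset.mul_sum]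
    exact Finset.sum_congr rfl fun l _ => by ring
  refine ⟨?_, by simp [z], by simp [z], ?_⟩
  · simp only [e]; exact integrable_finsetSum _ fun l _ => hi l
  · simp only [e, z]
    rw [integral_finsetSum _ fun l _ => hi l]
    simp only [integral_zero, intervalIntegral.integral_zero]
    refine Finset.sum_eq_zero fun l _ => ?_
    have := (hind l).integral_fun_mul_eq_mul_integral (hAi l).aestronglyMeasurable
      (hW.memLp_incr_coord hp' hpq' hq' l).aestronglyMeasurable
    rw [this, hW.integral_incr_coord hp' hpq' hq' l, mul_zero]

theorem ItoPair.elem_same (hW : IsCorrelatedBM P ℱ T R W) (hR : ContinuousOn R (Icc 0 T))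
    (hRp : ∀ t ∈ Icc 0 T, (R t).PosDef) {p q : ℝ}
    (hp : 0 ≤ p) (hpq : p ≤ q) (hq : q ≤ T)
    {ξ ξ' : Ω → Fin d → ℝ} (hξ : Measurable[ℱ p] ξ) (hξ' : Measurable[ℱ p] ξ') {K K' : ℝ}
    (hK : ∀ ω, ‖ξ ω‖ ≤ K) (hK' : ∀ ω, ‖ξ' ω‖ ≤ K') :
    ItoPair P T R ((Ico p q).indicator (fun _ => ξ)) (fun ω => ξ ω ⬝ᵥ (W q ω - W p ω))
      ((Ico p q).indicator (fun _ => ξ')) (fun ω => ξ' ω ⬝ᵥ (W q ω - W p ω)) := by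
  have hT : 0 ≤ T := hp.trans (hpq.trans hq)
  have hm : ∀ j l, Measurable[ℱ p] fun ω => ξ ω j * ξ' ω l := fun j l =>
    ((measurable_pi_apply j).comp hξ).mul ((measurable_pi_apply l).comp hξ')
  have hb : ∀ j l, Integrable (fun ω => ξ ω j * ξ' ω l) P := fun j l => by
    refine Integrable.of_bound ((hm j l).mono (ℱ.le _) le_rfl).aestronglyMeasurable (K * K')
      (ae_of_all _ fun ω => ?_)
    rw [norm_mul]
    exact mul_le_mul ((norm_le_pi_norm _ j).trans (hK ω)) ((norm_le_pi_norm _ l).trans (hK' ω))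
      (norm_nonneg _) ((norm_nonneg _).trans (hK ω))
  have hd : ∀ j l, Integrable (fun ω => (W q ω - W p ω) j * (W q ω - W p ω) l) P := fun i k =>
    (hW.memLp_incr_coord hp hpq hq i).integrable_mul (hW.memLp_incr_coord hp hpq hq k)
  have hind : ∀ j l, IndepFun (fun ω => ξ ω j * ξ' ω l)
      (fun ω => (W q ω - W p ω) j * (W q ω - W p ω) l) P := fun j l =>
    (hW.indepFun_incr hp hpq hq (hm j l)).comp measurable_id
      ((measurable_pi_apply j).mul (measurable_pi_apply l))
  have hi : ∀ j l, Integrable (fun ω => ξ ω j * ξ' ω l *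
      ((W q ω - W p ω) j * (W q ω - W p ω) l)) P := fun j l =>
    (hind j l).integrable_mul (hb j l) (hd j l)
  have e : ∀ ω, (ξ ω ⬝ᵥ (W q ω - W p ω)) * (ξ' ω ⬝ᵥ (W q ω - W p ω)) =
      ∑ j, ∑ l, ξ ω j * ξ' ω l * ((W q ω - W p ω) j * (W q ω - W p ω) l) := fun ω => by
    rw [dotProduct, dotProduct, Finset.sum_mul_sum]
    exact Finset.sum_congr rfl fun j _ => Finset.sum_congr rfl fun l _ => by ring
  have e2 : ∀ s ω, ξ ω ⬝ᵥ (R s *ᵥ ξ' ω) = ∑ j, ∑ l, R s j l * (ξ ω j * ξ' ω l) := fun s ω => by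
    rw [dotProduct]
    refine Finset.sum_congr rfl fun j _ => ?_
    rw [Matrix.mulVec, dotProduct, Finset.mul_sum]
    exact Finset.sum_congr rfl fun l _ => by ring
  have hs2 : ∀ s, Integrable (fun ω => ξ ω ⬝ᵥ (R s *ᵥ ξ' ω)) P := fun s => by
    simp only [e2]
    exact integrable_finsetSum _ fun j _ => integrable_finsetSum _ fun l _ => (hb j l).const_mul _
  have aux : ∀ r : Fin d → Fin d → ℝ, ∫ ω, ∑ j, ∑ l, r j l * (ξ ω j * ξ' ω l) ∂P =
      ∑ j, ∑ l, r j l * ∫ ω, ξ ω j * ξ' ω l ∂P := fun r => by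
    rw [integral_finsetSum _ fun j _ => integrable_finsetSum _ fun l _ => (hb j l).const_mul _]
    refine Finset.sum_congr rfl fun j _ => ?_
    rw [integral_finsetSum _ fun l _ => (hb j l).const_mul _]
    exact Finset.sum_congr rfl fun l _ => integral_const_mul _ _
  have hs3 : ∀ s, ∫ ω, ξ ω ⬝ᵥ (R s *ᵥ ξ' ω) ∂P =
      ∑ j, ∑ l, R s j l * ∫ ω, ξ ω j * ξ' ω l ∂P := fun s =>
    (integral_congr_ae (ae_of_all _ (e2 s))).trans (aux (R s))
  have e3 : ∀ s, ∫ ω, (Ico p q).indicator (fun _ => ξ) s ω ⬝ᵥ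
      (R s *ᵥ (Ico p q).indicator (fun _ => ξ') s ω) ∂P =
      (Ico p q).indicator (fun s => ∑ j, ∑ l, R s j l * ∫ ω, ξ ω j * ξ' ω l ∂P) s := fun s => by
    by_cases hs : s ∈ Ico p q
    · simp only [indicator_of_mem hs]
      exact hs3 s
    · simp [indicator_of_notMem hs]
  have hRi : ∀ j l, IntervalIntegrable (fun s => R s j l) volume p q := fun j l => by
    simpa [single_one_dotProduct] using
      intervalIntegrable_quadForm hR hp hpq hq (Pi.single j 1) (Pi.single l 1)
  have hgl : ∀ j, IntervalIntegrable (fun s => ∑ l, R s j l * ∫ ω, ξ ω j * ξ' ω l ∂P)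
      volume p q := fun j =>
    (IntervalIntegrable.sum Finset.univ
      (f := fun l s => R s j l * ∫ ω, ξ ω j * ξ' ω l ∂P) fun l _ => (hRi j l).mul_const _).congr
      fun s _ => by simp only [Finset.sum_apply]
  have hgi : IntervalIntegrable (fun s => ∑ j, ∑ l, R s j l * ∫ ω, ξ ω j * ξ' ω l ∂P)
      volume p q :=
    (IntervalIntegrable.sum Finset.univ
      (f := fun j s => ∑ l, R s j l * ∫ ω, ξ ω j * ξ' ω l ∂P) fun j _ => hgl j).congr
      fun s _ => by simp only [Finset.sum_apply]
  have hgi' : IntegrableOn (fun s => ∑ j, ∑ l, R s j l * ∫ ω, ξ ω j * ξ' ω l ∂P) (Ico p q) := by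
    rw [intervalIntegrable_iff_integrableOn_Ico_of_le hpq] at hgi
    exact hgi
  refine ⟨?_, fun s _ => ?_, ?_, ?_⟩
  · simp only [e]
    exact integrable_finsetSum _ fun j _ => integrable_finsetSum _ fun l _ => hi j l
  · by_cases hs : s ∈ Ico p q
    · simpa only [indicator_of_mem hs] using hs2 s
    · simp [indicator_of_notMem hs]
  · simp only [e3]
    exact ((integrable_indicator_iff measurableSet_Ico).2 hgi').intervalIntegrable
  · simp only [e, e3]
    rw [integral_finsetSum _ fun j _ => integrable_finsetSum _ fun l _ => hi j l]
    have r : ∫ s in 0..T, (Ico p q).indicator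
        (fun s => ∑ j, ∑ l, R s j l * ∫ ω, ξ ω j * ξ' ω l ∂P) s =
        ∫ s in p..q, ∑ j, ∑ l, R s j l * ∫ ω, ξ ω j * ξ' ω l ∂P := by
      rw [intervalIntegral.integral_of_le hT, intervalIntegral.integral_of_le hpq,
        ← integral_Icc_eq_integral_Ioc, setIntegral_indicator measurableSet_Ico,
        ← integral_Ico_eq_integral_Ioc, inter_eq_self_of_subset_right]
      exact fun s hs => ⟨hp.trans hs.1, hs.2.le.trans hq⟩
    rw [r, intervalIntegral.integral_finsetSum]
    · refine Finset.sum_congr rfl fun j _ => ?_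
      rw [intervalIntegral.integral_finsetSum fun l _ => (hRi j l).mul_const _,
        integral_finsetSum _ fun l _ => hi j l]
      refine Finset.sum_congr rfl fun l _ => ?_
      rw [intervalIntegral.integral_mul_const, ← hW.integral_incr_mul hR hRp hp hpq hq j l,
        (hind j l).integral_fun_mul_eq_mul_integral (hb j l).aestronglyMeasurable
        (hd j l).aestronglyMeasurable, mul_comm]
    · exact fun j _ => hgl j

theorem indicator_Ico_add {p m q : ℝ} (hpm : p ≤ m) (hmq : m ≤ q) (ξ : Ω → Fin d → ℝ) :
    (Ico p q).indicator (fun _ => ξ) =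
      (Ico p m).indicator (fun _ => ξ) + (Ico m q).indicator (fun _ => ξ) := by
  rw [← Ico_union_Ico_eq_Ico hpm hmq]
  exact indicator_union_of_disjoint (Ico_disjoint_Ico_same) _

theorem incr_add (ξ : Ω → Fin d → ℝ) (p m q : ℝ) :
    (fun ω => ξ ω ⬝ᵥ (W q ω - W p ω)) =
      (fun ω => ξ ω ⬝ᵥ (W m ω - W p ω)) + fun ω => ξ ω ⬝ᵥ (W q ω - W m ω) := by
  ext ω
  rw [Pi.add_apply, ← dotProduct_add]
  congr 1; abel

theorem ItoPair.elem_same_left (hW : IsCorrelatedBM P ℱ T R W) (hR : ContinuousOn R (Icc 0 T))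
    (hRp : ∀ t ∈ Icc 0 T, (R t).PosDef) {p q q' : ℝ}
    (hp : 0 ≤ p) (hpq : p ≤ q) (hqq' : q ≤ q') (hq' : q' ≤ T)
    {ξ ξ' : Ω → Fin d → ℝ} (hξ : Measurable[ℱ p] ξ) (hξ' : Measurable[ℱ p] ξ') {K K' : ℝ}
    (hK : ∀ ω, ‖ξ ω‖ ≤ K) (hK' : ∀ ω, ‖ξ' ω‖ ≤ K') :
    ItoPair P T R ((Ico p q).indicator (fun _ => ξ)) (fun ω => ξ ω ⬝ᵥ (W q ω - W p ω))
      ((Ico p q').indicator (fun _ => ξ')) (fun ω => ξ' ω ⬝ᵥ (W q' ω - W p ω)) := by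
  have hT : 0 ≤ T := hp.trans (hpq.trans (hqq'.trans hq'))
  apply ItoPair.symm hT hRp
  rw [indicator_Ico_add hpq hqq', incr_add ξ' p q q']
  refine ItoPair.add_left hT ?_ (ItoPair.symm hT hRp ?_)
  · exact ItoPair.elem_same hW hR hRp hp hpq (hqq'.trans hq') hξ' hξ hK' hK
  · exact ItoPair.elem_of_le hW hp hpq le_rfl hqq' hq' hξ (hξ'.mono (ℱ.mono hpq) le_rfl) hK hK'

theorem ItoPair.elem (hW : IsCorrelatedBM P ℱ T R W) (hR : ContinuousOn R (Icc 0 T))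
    (hRp : ∀ t ∈ Icc 0 T, (R t).PosDef) {p q p' q' : ℝ} (hpp' : p ≤ p')
    (hp : 0 ≤ p) (hpq : p ≤ q) (hq : q ≤ T) (hpq' : p' ≤ q') (hq' : q' ≤ T)
    {ξ ξ' : Ω → Fin d → ℝ} (hξ : Measurable[ℱ p] ξ) (hξ' : Measurable[ℱ p'] ξ') {K K' : ℝ}
    (hK : ∀ ω, ‖ξ ω‖ ≤ K) (hK' : ∀ ω, ‖ξ' ω‖ ≤ K') :
    ItoPair P T R ((Ico p q).indicator (fun _ => ξ)) (fun ω => ξ ω ⬝ᵥ (W q ω - W p ω))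
      ((Ico p' q').indicator (fun _ => ξ')) (fun ω => ξ' ω ⬝ᵥ (W q' ω - W p' ω)) := by
  have hT : 0 ≤ T := hp.trans (hpq.trans hq)
  rcases le_total q p' with h | h
  · exact ItoPair.elem_of_le hW hp hpq h hpq' hq' hξ hξ' hK hK'
  have hξp : Measurable[ℱ p'] ξ := hξ.mono (ℱ.mono hpp') le_rfl
  rw [indicator_Ico_add hpp' h, incr_add ξ p p' q]
  refine ItoPair.add_left hT
    (ItoPair.elem_of_le hW hp hpp' le_rfl hpq' hq' hξ hξ' hK hK') ?_
  rcases le_total q q' with h' | h'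
  · exact ItoPair.elem_same_left hW hR hRp (hp.trans hpp') h h' hq' hξp hξ' hK hK'
  · exact (ItoPair.elem_same_left hW hR hRp (hp.trans hpp') hpq' h' hq hξ' hξp hK' hK).symm hT hRp

/-- Itô isometry for simple integrands, by induction on both of them; two elementary terms are
split until their intervals are consecutive or equal. -/
theorem SimpleInt.isometry (hT : 0 ≤ T) (hW : IsCorrelatedBM P ℱ T R W)
    (hR : ContinuousOn R (Icc 0 T)) (hRp : ∀ t ∈ Icc 0 T, (R t).PosDef)
    {φ φ' : ℝ → Ω → Fin d → ℝ} {S S' : Ω → ℝ}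
    (h : SimpleInt ℱ T W φ S) (h' : SimpleInt ℱ T W φ' S') : ItoPair P T R φ S φ' S' := by
  induction h with
  | zero => exact ItoPair.zero_left _ _
  | add _ _ ih ih' => exact ItoPair.add_left hT ih ih'
  | elem p q ξ K hp hpq hq hξ hK =>
    apply ItoPair.symm hT hRp
    induction h' with
    | zero => exact ItoPair.zero_left _ _
    | add _ _ ih ih' => exact ItoPair.add_left hT ih ih'
    | elem p' q' ξ' K' hp' hpq' hq' hξ' hK' =>
      rcases le_total p p' with hpp | hpp
      · exact (ItoPair.elem hW hR hRp hpp hp hpq hq hpq' hq' hξ hξ' hK hK').symm hT hRp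
      · exact ItoPair.elem hW hR hRp hpp hp' hpq' hq' hpq hq hξ' hξ hK' hK

end Isometry

/-! ### The stochastic integral as an `L²` limit -/

theorem eLpNorm_two_eq {Ω : Type*} {mΩ : MeasurableSpace Ω} {P : Measure Ω} {f : Ω → ℝ}
    (hf : MemLp f 2 P) : eLpNorm f 2 P = ENNReal.ofReal ((∫ ω, f ω ^ 2 ∂P) ^ (2⁻¹ : ℝ)) := by
  rw [hf.eLpNorm_eq_integral_rpow_norm (by norm_num) (by norm_num)]
  simp

/-- A real `L²` sequence whose second moments vanish tends to `0` in `L²`. -/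
theorem tendsto_eLpNorm_two_of_integral_sq {Ω ι : Type*} {mΩ : MeasurableSpace Ω} {P : Measure Ω}
    {l : Filter ι} {f : ι → Ω → ℝ} (hf : ∀ i, MemLp (f i) 2 P)
    (h : Tendsto (fun i => ∫ ω, f i ω ^ 2 ∂P) l (𝓝 0)) :
    Tendsto (fun i => eLpNorm (f i) 2 P) l (𝓝 0) := by
  have e := fun i => eLpNorm_two_eq (hf i)
  simp only [e]
  have h2 : Tendsto (fun x : ℝ => ENNReal.ofReal (x ^ (2⁻¹ : ℝ))) (𝓝 0) (𝓝 0) := by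
    have : Continuous fun x : ℝ => ENNReal.ofReal (x ^ (2⁻¹ : ℝ)) :=
      ENNReal.continuous_ofReal.comp (Real.continuous_rpow_const (by norm_num))
    have h3 := this.tendsto 0
    simpa using h3
  exact h2.comp h

/-- Almost sure limits of functions measurable with respect to a sub-σ-algebra. -/
theorem aestronglyMeasurable_sub_of_tendsto_ae {Ω : Type*} {m mΩ : MeasurableSpace Ω}
    {P : Measure Ω} {f : ℕ → Ω → ℝ} {g : Ω → ℝ} (hf : ∀ n, AEStronglyMeasurable[m] (f n) P)
    (h : ∀ᵐ ω ∂P, Tendsto (fun n => f n ω) atTop (𝓝 (g ω))) : AEStronglyMeasurable[m] g P := by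
  choose f' hf' hff' using hf
  refine ⟨fun ω => limsup (fun n => f' n ω) atTop, ?_, ?_⟩
  · exact (Measurable.limsup fun n => (hf' n).measurable).stronglyMeasurable
  · filter_upwards [h, ae_all_iff.2 hff'] with ω h1 h2
    simp only [h2] at h1
    exact h1.limsup_eq.symm

theorem exists_quadForm_bound {d : ℕ} {R : ℝ → Matrix (Fin d) (Fin d) ℝ} {T : ℝ}
    (hR : ContinuousOn R (Icc 0 T)) :
    ∃ C, 0 ≤ C ∧ ∀ s ∈ Icc 0 T, ∀ a b : Fin d → ℝ, |a ⬝ᵥ (R s *ᵥ b)| ≤ C * (‖a‖ * ‖b‖) := by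
  have hc : ContinuousOn (fun s => ∑ j, ∑ l, |R s j l|) (Icc 0 T) := by
    have : Continuous fun A : Matrix (Fin d) (Fin d) ℝ => ∑ j, ∑ l, |A j l| := by fun_prop
    exact this.comp_continuousOn hR
  obtain ⟨C, hC⟩ := isCompact_Icc.exists_bound_of_continuousOn hc
  refine ⟨max C 0, le_max_right _ _, fun s hs a b => ?_⟩
  calc |a ⬝ᵥ (R s *ᵥ b)| = |∑ j, ∑ l, a j * (R s j l * b l)| := by
        simp only [dotProduct, Matrix.mulVec, Finset.mul_sum]
    _ ≤ ∑ j, ∑ l, |a j * (R s j l * b l)| :=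
        (Finset.abs_sum_le_sum_abs _ _).trans
          (Finset.sum_le_sum fun j _ => Finset.abs_sum_le_sum_abs _ _)
    _ ≤ ∑ j, ∑ l, |R s j l| * (‖a‖ * ‖b‖) := by
        refine Finset.sum_le_sum fun j _ => Finset.sum_le_sum fun l _ => ?_
        have h1 : |a j| ≤ ‖a‖ := norm_le_pi_norm a j
        have h2 : |b l| ≤ ‖b‖ := norm_le_pi_norm b l
        rw [abs_mul, abs_mul]
        calc |a j| * (|R s j l| * |b l|) = |R s j l| * (|a j| * |b l|) := by ring
          _ ≤ _ := by gcongr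
    _ = (∑ j, ∑ l, |R s j l|) * (‖a‖ * ‖b‖) := by simp only [Finset.sum_mul]
    _ ≤ _ := by
        gcongr
        exact (le_abs_self _).trans ((hC s hs).trans (le_max_left _ _))

section ItoLimit

set_option linter.unusedSectionVars false

variable {Ω : Type*} {mΩ : MeasurableSpace Ω} {P : Measure Ω} [IsProbabilityMeasure P]
  {ℱ : Filtration ℝ mΩ} {T : ℝ} {d : ℕ} {R : ℝ → Matrix (Fin d) (Fin d) ℝ}
  {W : ℝ → Ω → Fin d → ℝ}

/-- Bounded adapted integrands on `[0, T]` whose paths are left-continuous off a countable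
deterministic set of times. The exceptional set makes room for deviations from a control, which are
not left-continuous at the switching times, and is invisible to `dt`. -/
structure IsAdmissible (ℱ : Filtration ℝ mΩ) (T : ℝ) (H : ℝ → Ω → Fin d → ℝ) : Prop where
  adapted : ∀ t ∈ Icc 0 T, Measurable[ℱ t] (H t)
  bdd : ∃ K, ∀ t ∈ Icc 0 T, ∀ ω, ‖H t ω‖ ≤ K
  leftCont : ∃ D : Set ℝ, D.Countable ∧ ∀ t ∈ Ioc 0 T, t ∉ D → ∀ ω,
    ContinuousWithinAt (fun s => H s ω) (Iic t) t

theorem SimpleInt.measurable (hW : IsCorrelatedBM P ℱ T R W) {φ : ℝ → Ω → Fin d → ℝ} {S : Ω → ℝ}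
    (h : SimpleInt ℱ T W φ S) : Measurable S := by
  induction h with
  | zero => exact measurable_const
  | add _ _ h h' => exact h.add h'
  | elem p q ξ K hp hpq hq hξ hK =>
    unfold dotProduct
    exact Finset.measurable_sum _ fun i _ =>
      ((measurable_pi_apply i).comp (hξ.mono (ℱ.le _) le_rfl)).mul
        ((measurable_pi_apply i).comp (hW.measurable_incr' hp hpq hq))

theorem SimpleInt.memLp (hT : 0 ≤ T) (hW : IsCorrelatedBM P ℱ T R W)
    (hR : ContinuousOn R (Icc 0 T)) (hRp : ∀ t ∈ Icc 0 T, (R t).PosDef)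
    {φ : ℝ → Ω → Fin d → ℝ} {S : Ω → ℝ} (h : SimpleInt ℱ T W φ S) : MemLp S 2 P := by
  rw [memLp_two_iff_integrable_sq (h.measurable hW).aestronglyMeasurable]
  simpa only [sq] using (h.isometry hT hW hR hRp h).int

/-- Simple integrals of uniformly bounded integrands that tend to `0` at almost every time tend to
`0` in mean square. -/
theorem SimpleInt.tendsto_integral_sq (hT : 0 ≤ T) (hW : IsCorrelatedBM P ℱ T R W)
    (hR : ContinuousOn R (Icc 0 T)) (hRp : ∀ t ∈ Icc 0 T, (R t).PosDef)
    {ι : Type*} {l : Filter ι} [l.IsCountablyGenerated] {φ : ι → ℝ → Ω → Fin d → ℝ}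
    {S : ι → Ω → ℝ} (h : ∀ i, SimpleInt ℱ T W (φ i) (S i)) {K : ℝ}
    (hK : ∀ i, ∀ s ∈ Icc 0 T, ∀ ω, ‖φ i s ω‖ ≤ K)
    (hlim : ∀ᵐ s, s ∈ Ioc 0 T → ∀ ω, Tendsto (fun i => φ i s ω) l (𝓝 0)) :
    Tendsto (fun i => ∫ ω, S i ω ^ 2 ∂P) l (𝓝 0) := by
  obtain ⟨C, hC0, hC⟩ := exists_quadForm_bound hR
  have hiso := fun i => (h i).isometry hT hW hR hRp (h i)
  have hb : ∀ i, ∀ s ∈ Icc 0 T, ∀ ω, ‖φ i s ω ⬝ᵥ (R s *ᵥ φ i s ω)‖ ≤ C * (K * K) :=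
    fun i s hs ω => by
      refine (hC s hs _ _).trans ?_
      have := hK i s hs ω
      have h0 : 0 ≤ K := (norm_nonneg _).trans this
      gcongr
  have e : ∀ i, ∫ ω, S i ω ^ 2 ∂P = ∫ s in 0..T, ∫ ω, φ i s ω ⬝ᵥ (R s *ᵥ φ i s ω) ∂P := fun i => by
    rw [← (hiso i).eq]; simp only [sq]
  simp only [e]
  have := intervalIntegral.tendsto_integral_filter_of_dominated_convergence (μ := volume) (l := l)
    (a := 0) (b := T) (F := fun i s => ∫ ω, φ i s ω ⬝ᵥ (R s *ᵥ φ i s ω) ∂P) (f := fun _ => 0)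
    (fun _ => C * (K * K)) (Eventually.of_forall fun i => ?_) (Eventually.of_forall fun i => ?_)
    (by simp) ?_
  · simpa using this
  · have := (hiso i).int_time
    rw [intervalIntegrable_iff] at this
    exact this.aestronglyMeasurable
  · refine ae_of_all _ fun s hs => ?_
    rw [uIoc_of_le hT] at hs
    have := norm_integral_le_of_norm_le_const (μ := P) (ae_of_all _ (hb i s (Ioc_subset_Icc_self hs)))
    simpa using this
  · filter_upwards [hlim] with s hs hsT
    rw [uIoc_of_le hT] at hsT
    have hs' := Ioc_subset_Icc_self hsT
    have := tendsto_integral_filter_of_dominated_convergence (μ := P) (l := l)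
      (F := fun i ω => φ i s ω ⬝ᵥ (R s *ᵥ φ i s ω)) (f := fun _ => 0)
      (fun _ => C * (K * K)) (Eventually.of_forall fun i => ((hiso i).int_slice s hs').aestronglyMeasurable)
      (Eventually.of_forall fun i => ae_of_all _ (hb i s hs')) (integrable_const _)
      (ae_of_all _ fun ω => ?_)
    · simpa using this
    · have hc : Continuous fun y : Fin d → ℝ => y ⬝ᵥ (R s *ᵥ y) := by fun_prop
      have := (hc.tendsto 0).comp (hs hsT ω)
      simpa [Function.comp_def] using this

theorem SimpleInt.exists_integral_sq_le (hT : 0 ≤ T) (hW : IsCorrelatedBM P ℱ T R W)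
    (hR : ContinuousOn R (Icc 0 T)) (hRp : ∀ t ∈ Icc 0 T, (R t).PosDef) :
    ∃ C, 0 ≤ C ∧ ∀ (φ : ℝ → Ω → Fin d → ℝ) (S : Ω → ℝ), SimpleInt ℱ T W φ S → ∀ K : ℝ,
      (∀ s ∈ Icc 0 T, ∀ ω, ‖φ s ω‖ ≤ K) → ∫ ω, S ω ^ 2 ∂P ≤ C * K ^ 2 := by
  obtain ⟨C, hC0, hC⟩ := exists_quadForm_bound hR
  refine ⟨C * T, by positivity, fun φ S h K hK => ?_⟩
  have hiso := h.isometry hT hW hR hRp h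
  have e : ∫ ω, S ω ^ 2 ∂P = ∫ s in 0..T, ∫ ω, φ s ω ⬝ᵥ (R s *ᵥ φ s ω) ∂P := by
    rw [← hiso.eq]; simp only [sq]
  rw [e]
  have hb : ∀ s ∈ Icc 0 T, ∀ ω, ‖φ s ω ⬝ᵥ (R s *ᵥ φ s ω)‖ ≤ C * (K * K) := fun s hs ω => by
    refine (hC s hs _ _).trans ?_
    have := hK s hs ω
    have h0 : 0 ≤ K := (norm_nonneg _).trans this
    gcongr
  have := intervalIntegral.norm_integral_le_of_norm_le_const (a := 0) (b := T)
    (f := fun s => ∫ ω, φ s ω ⬝ᵥ (R s *ᵥ φ s ω) ∂P) (C := C * (K * K)) (fun s hs => by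
      rw [uIoc_of_le hT] at hs
      have := norm_integral_le_of_norm_le_const (μ := P) (ae_of_all _ (hb s (Ioc_subset_Icc_self hs)))
      simpa using this)
  rw [sub_zero, abs_of_nonneg hT] at this
  refine (le_abs_self _).trans (this.trans (le_of_eq (by ring)))

/-- A left-point Riemann sum is the integral of the integrand sampled at the left grid points. -/
theorem simpleInt_itoSum {H : ℝ → Ω → Fin d → ℝ} (hH : IsAdmissible ℱ T H) {a b : ℝ} (ha : 0 ≤ a)
    (hab : a ≤ b) (hb : b ≤ T) {n : ℕ} (hn : n ≠ 0) :
    SimpleInt ℱ T W ((Ico a b).indicator fun s => H (gridFloor a b n s)) (itoSum H W a b n) := by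
  obtain ⟨K, hK⟩ := hH.bdd
  have hmem : ∀ k ≤ n, a + (k : ℝ) * (b - a) / n ∈ Icc 0 T := fun k hk =>
    Icc_subset_Icc ha hb (gridPt_mem_Icc hab hk)
  have := SimpleInt.sum (ℱ := ℱ) (T := T) (W := W) (Finset.range n)
    (φ := fun k : ℕ => (Ico (a + k * (b - a) / n) (a + (k + 1) * (b - a) / n)).indicator
      (fun _ => H (a + k * (b - a) / n)))
    (S := fun k ω => H (a + k * (b - a) / n) ω ⬝ᵥ
      (W (a + (k + 1) * (b - a) / n) ω - W (a + k * (b - a) / n) ω)) (fun k hk => by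
    have hk := Finset.mem_range.1 hk
    have h1 := hmem k hk.le
    have h2 := hmem (k + 1) hk
    have h3 := gridPt_mono hab n (Nat.le_succ k)
    push_cast at h2
    simp only [Nat.succ_eq_add_one, Nat.cast_add, Nat.cast_one] at h3
    exact SimpleInt.elem _ _ _ K h1.1 h3 h2.2 (hH.adapted _ h1) (hK _ h1))
  convert this using 1
  · funext s
    rw [Finset.sum_apply, sum_indicator_grid hab hn H s]
  · funext ω
    simp [itoSum, Finset.sum_apply]

/-- `I` is the `L²(P)` limit of the left-point Riemann sums of `∫_a^b H dW`. The index is shifted as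
the sum over `0` cells is the junk value `0`. -/
structure IsItoLimit (P : Measure Ω) (H W : ℝ → Ω → Fin d → ℝ) (a b : ℝ) (I : Ω → ℝ) : Prop where
  memLp : MemLp I 2 P
  tendsto : Tendsto (fun n => eLpNorm (itoSum H W a b (n + 1) - I) 2 P) atTop (𝓝 0)

theorem norm_indicator_grid_le {H : ℝ → Ω → Fin d → ℝ} {K : ℝ}
    (hK : ∀ t ∈ Icc 0 T, ∀ ω, ‖H t ω‖ ≤ K) (hT : 0 ≤ T) {a b : ℝ} (ha : 0 ≤ a) (hb : b ≤ T) (n : ℕ)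
    (s : ℝ) (ω : Ω) : ‖(Ico a b).indicator (fun s => H (gridFloor a b n s)) s ω‖ ≤ K := by
  by_cases hs : s ∈ Ico a b
  · rw [indicator_of_mem hs]
    have := gridFloor_mem_Icc (hs.1.trans_lt hs.2) (Ico_subset_Icc_self hs) n
    exact hK _ ⟨ha.trans this.1, this.2.trans hb⟩ ω
  · rw [indicator_of_notMem hs]
    simpa using (norm_nonneg _).trans (hK 0 ⟨le_rfl, hT⟩ ω)

theorem tendsto_indicator_grid {H : ℝ → Ω → Fin d → ℝ} {s : ℝ} {ω : Ω}
    (hs : ContinuousWithinAt (fun s => H s ω) (Iic s) s) (a b : ℝ) :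
    Tendsto (fun n : ℕ => (Ico a b).indicator (fun s => H (gridFloor a b (n + 1) s)) s ω) atTop
      (𝓝 ((Ico a b).indicator H s ω)) := by
  by_cases hsm : s ∈ Ico a b
  · simp only [indicator_of_mem hsm]
    exact (tendsto_comp_gridFloor (hsm.1.trans_lt hsm.2) hsm.1 hs).comp (tendsto_add_atTop_nat 1)
  · simp only [indicator_of_notMem hsm]
    exact tendsto_const_nhds

variable {H : ℝ → Ω → Fin d → ℝ}

theorem memLp_itoSum (hT : 0 ≤ T) (hW : IsCorrelatedBM P ℱ T R W)
    (hR : ContinuousOn R (Icc 0 T)) (hRp : ∀ t ∈ Icc 0 T, (R t).PosDef) (hH : IsAdmissible ℱ T H)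
    {a b : ℝ} (ha : 0 ≤ a) (hab : a ≤ b) (hb : b ≤ T) (n : ℕ) :
    MemLp (itoSum H W a b (n + 1)) 2 P :=
  (simpleInt_itoSum hH ha hab hb n.succ_ne_zero).memLp hT hW hR hRp

/-- The Riemann sums are Cauchy in `L²` by the isometry, as the sampled integrands converge. -/
theorem exists_isItoLimit (hT : 0 ≤ T) (hW : IsCorrelatedBM P ℱ T R W)
    (hR : ContinuousOn R (Icc 0 T)) (hRp : ∀ t ∈ Icc 0 T, (R t).PosDef) (hH : IsAdmissible ℱ T H)
    {a b : ℝ} (ha : 0 ≤ a) (hab : a ≤ b) (hb : b ≤ T) :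
    ∃ I, IsItoLimit P H W a b I := by
  have hm := memLp_itoSum hT hW hR hRp hH ha hab hb
  obtain ⟨K, hK⟩ := hH.bdd
  obtain ⟨D, hD, hDc⟩ := hH.leftCont
  have hsub : ∀ x : ℕ × ℕ, SimpleInt ℱ T W
      (((Ico a b).indicator fun s => H (gridFloor a b (x.1 + 1) s)) -
        ((Ico a b).indicator fun s => H (gridFloor a b (x.2 + 1) s)))
      (itoSum H W a b (x.1 + 1) - itoSum H W a b (x.2 + 1)) := fun x =>
    (simpleInt_itoSum hH ha hab hb x.1.succ_ne_zero).sub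
      (simpleInt_itoSum hH ha hab hb x.2.succ_ne_zero)
  have h0 := SimpleInt.tendsto_integral_sq hT hW hR hRp (l := (atTop : Filter (ℕ × ℕ))) hsub
    (K := K + K) (fun x s _ ω => (norm_sub_le _ _).trans (add_le_add
      (norm_indicator_grid_le hK hT ha hb _ s ω) (norm_indicator_grid_le hK hT ha hb _ s ω))) (by
      filter_upwards [hD.ae_notMem volume] with s hsD hs ω
      have h1 := tendsto_indicator_grid (hDc s hs hsD ω) a b
      rw [← prod_atTop_atTop_eq]
      have := (h1.comp tendsto_fst).sub (h1.comp (tendsto_snd (f := (atTop : Filter ℕ))))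
      rw [sub_self] at this
      exact this)
  have h1 := tendsto_eLpNorm_two_of_integral_sq (fun x => (hsub x).memLp hT hW hR hRp) h0
  have hc : CauchySeq fun n => (hm n).toLp (itoSum H W a b (n + 1)) := by
    rw [Lp.cauchySeq_Lp_iff_cauchySeq_eLpNorm]
    refine h1.congr fun x => eLpNorm_congr_ae ?_
    filter_upwards [(hm x.1).coeFn_toLp, (hm x.2).coeFn_toLp] with ω h1 h2
    simp [h1, h2]
  obtain ⟨I, hI⟩ := cauchySeq_tendsto_of_complete hc
  refine ⟨I, Lp.memLp I, ?_⟩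
  rw [Lp.tendsto_Lp_iff_tendsto_eLpNorm'] at hI
  refine hI.congr fun n => eLpNorm_congr_ae ?_
  filter_upwards [(hm n).coeFn_toLp] with ω h1
  simp [h1]

theorem IsItoLimit.tendstoInMeasure (hT : 0 ≤ T) (hW : IsCorrelatedBM P ℱ T R W)
    (hR : ContinuousOn R (Icc 0 T)) (hRp : ∀ t ∈ Icc 0 T, (R t).PosDef) (hH : IsAdmissible ℱ T H)
    {a b : ℝ} (ha : 0 ≤ a) (hab : a ≤ b) (hb : b ≤ T) {I : Ω → ℝ} (hI : IsItoLimit P H W a b I) :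
    TendstoInMeasure P (fun n => itoSum H W a b (n + 1)) atTop I :=
  tendstoInMeasure_of_tendsto_eLpNorm two_ne_zero
    (fun n => (memLp_itoSum hT hW hR hRp hH ha hab hb n).aestronglyMeasurable)
    hI.memLp.aestronglyMeasurable hI.tendsto

theorem IsItoLimit.isItoIntegral (hT : 0 ≤ T) (hW : IsCorrelatedBM P ℱ T R W)
    (hR : ContinuousOn R (Icc 0 T)) (hRp : ∀ t ∈ Icc 0 T, (R t).PosDef) (hH : IsAdmissible ℱ T H)
    {a b : ℝ} (ha : 0 ≤ a) (hab : a ≤ b) (hb : b ≤ T) {I : Ω → ℝ} (hI : IsItoLimit P H W a b I) :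
    IsItoIntegral P H W a b I := fun ε hε =>
  (tendsto_add_atTop_iff_nat 1).1
    (hI.tendstoInMeasure hT hW hR hRp hH ha hab hb ε hε)

theorem IsItoLimit.aestronglyMeasurable (hT : 0 ≤ T) (hW : IsCorrelatedBM P ℱ T R W)
    (hR : ContinuousOn R (Icc 0 T)) (hRp : ∀ t ∈ Icc 0 T, (R t).PosDef) (hH : IsAdmissible ℱ T H)
    {a b : ℝ} (ha : 0 ≤ a) (hab : a ≤ b) (hb : b ≤ T) {I : Ω → ℝ} (hI : IsItoLimit P H W a b I) :
    AEStronglyMeasurable[ℱ b] I P := by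
  obtain ⟨ns, -, h⟩ := (hI.tendstoInMeasure hT hW hR hRp hH ha hab hb).exists_seq_tendsto_ae
  refine aestronglyMeasurable_sub_of_tendsto_ae (fun n => ?_) h
  refine (Measurable.stronglyMeasurable ?_).aestronglyMeasurable
  unfold itoSum dotProduct
  refine Finset.measurable_sum _ fun k hk => Finset.measurable_sum _ fun i _ => ?_
  have hk := Finset.mem_range.1 hk
  have h1 := gridPt_mem_Icc hab hk.le
  have h2 := gridPt_mem_Icc hab (show k + 1 ≤ ns n + 1 from hk)
  simp only [Nat.cast_add, Nat.cast_one] at h1 h2 ⊢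
  have h1' := Icc_subset_Icc ha hb h1
  have h2' := Icc_subset_Icc ha hb h2
  refine Measurable.mul ?_ ?_
  · exact ((measurable_pi_apply i).comp (hH.adapted _ h1')).mono (ℱ.mono h1.2) le_rfl
  · exact (((measurable_pi_apply i).comp (hW.adapted _ h2')).mono (ℱ.mono h2.2) le_rfl).sub
      (((measurable_pi_apply i).comp (hW.adapted _ h1')).mono (ℱ.mono h1.2) le_rfl)

/-- Additivity of the integral in the interval. The grids on `[a, b]`, `[b, c]` and `[a, c]` are
unrelated; the comparison is made through the isometry. -/
theorem IsItoLimit.add (hT : 0 ≤ T) (hW : IsCorrelatedBM P ℱ T R W)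
    (hR : ContinuousOn R (Icc 0 T)) (hRp : ∀ t ∈ Icc 0 T, (R t).PosDef) (hH : IsAdmissible ℱ T H)
    {a b c : ℝ} (ha : 0 ≤ a) (hab : a ≤ b) (hbc : b ≤ c) (hc : c ≤ T) {I J : Ω → ℝ}
    (hI : IsItoLimit P H W a b I) (hJ : IsItoLimit P H W b c J) :
    IsItoLimit P H W a c (I + J) := by
  refine ⟨hI.memLp.add hJ.memLp, ?_⟩
  obtain ⟨K, hK⟩ := hH.bdd
  obtain ⟨D, hD, hDc⟩ := hH.leftCont
  have hb0 : 0 ≤ b := ha.trans hab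
  have hbT : b ≤ T := hbc.trans hc
  have hsub : ∀ n : ℕ, SimpleInt ℱ T W
      (((Ico a c).indicator fun s => H (gridFloor a c (n + 1) s)) -
        (((Ico a b).indicator fun s => H (gridFloor a b (n + 1) s)) +
        ((Ico b c).indicator fun s => H (gridFloor b c (n + 1) s))))
      (itoSum H W a c (n + 1) - (itoSum H W a b (n + 1) + itoSum H W b c (n + 1))) := fun n =>
    (simpleInt_itoSum hH ha (hab.trans hbc) hc n.succ_ne_zero).sub
      ((simpleInt_itoSum hH ha hab hbT n.succ_ne_zero).add
        (simpleInt_itoSum hH hb0 hbc hc n.succ_ne_zero))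
  have h0 := SimpleInt.tendsto_integral_sq hT hW hR hRp (l := (atTop : Filter ℕ)) hsub
    (K := K + (K + K)) (fun x s _ ω => (norm_sub_le _ _).trans (add_le_add
      (norm_indicator_grid_le hK hT ha hc _ s ω) ((norm_add_le _ _).trans (add_le_add
      (norm_indicator_grid_le hK hT ha hbT _ s ω)
      (norm_indicator_grid_le hK hT hb0 hc _ s ω))))) (by
      filter_upwards [hD.ae_notMem volume] with s hsD hs ω
      have hl := hDc s hs hsD ω
      have := (tendsto_indicator_grid hl a c).sub
        ((tendsto_indicator_grid hl a b).add (tendsto_indicator_grid hl b c))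
      have z : (Ico a c).indicator H s ω - ((Ico a b).indicator H s ω + (Ico b c).indicator H s ω)
          = 0 := by
        rw [← Ico_union_Ico_eq_Ico hab hbc, indicator_union_of_disjoint Ico_disjoint_Ico_same]
        simp
      rw [z] at this
      exact this)
  have h1 := tendsto_eLpNorm_two_of_integral_sq (fun x => (hsub x).memLp hT hW hR hRp) h0
  have h2 := h1.add (hI.tendsto.add hJ.tendsto)
  simp only [add_zero] at h2
  refine tendsto_of_tendsto_of_tendsto_of_le_of_le tendsto_const_nhds h2 (fun _ => zero_le)
    fun n => ?_
  have hm1 := (memLp_itoSum hT hW hR hRp hH ha hab hbT n).sub hI.memLp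
  have hm2 := (memLp_itoSum hT hW hR hRp hH hb0 hbc hc n).sub hJ.memLp
  have hm3 := (hsub n).memLp hT hW hR hRp
  have e : itoSum H W a c (n + 1) - (I + J) =
      (itoSum H W a c (n + 1) - (itoSum H W a b (n + 1) + itoSum H W b c (n + 1))) +
      ((itoSum H W a b (n + 1) - I) + (itoSum H W b c (n + 1) - J)) := by abel
  rw [e]
  refine (eLpNorm_add_le hm3.aestronglyMeasurable
    (hm1.aestronglyMeasurable.add hm2.aestronglyMeasurable) one_le_two).trans ?_
  gcongr
  exact eLpNorm_add_le hm1.aestronglyMeasurable hm2.aestronglyMeasurable one_le_two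

theorem IsItoLimit.ae_eq (hT : 0 ≤ T) (hW : IsCorrelatedBM P ℱ T R W)
    (hR : ContinuousOn R (Icc 0 T)) (hRp : ∀ t ∈ Icc 0 T, (R t).PosDef) (hH : IsAdmissible ℱ T H)
    {a b : ℝ} (ha : 0 ≤ a) (hab : a ≤ b) (hb : b ≤ T) {I J : Ω → ℝ} (hI : IsItoLimit P H W a b I)
    (hJ : IsItoLimit P H W a b J) : I =ᵐ[P] J :=
  tendstoInMeasure_ae_unique (hI.tendstoInMeasure hT hW hR hRp hH ha hab hb)
    (hJ.tendstoInMeasure hT hW hR hRp hH ha hab hb)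

theorem IsItoLimit.congr {a b : ℝ} {I J : Ω → ℝ} (hI : IsItoLimit P H W a b I)
    (h : I =ᵐ[P] J) : IsItoLimit P H W a b J :=
  ⟨(memLp_congr_ae h).1 hI.memLp, hI.tendsto.congr fun _ =>
    eLpNorm_congr_ae ((EventuallyEq.refl _ _).sub h)⟩

theorem isItoLimit_same (a : ℝ) : IsItoLimit P H W a a 0 := by
  refine ⟨MemLp.zero, ?_⟩
  have e : ∀ n : ℕ, itoSum H W a a (n + 1) - 0 = 0 := fun n => by
    ext ω; simp [itoSum]
  simp only [e, eLpNorm_zero]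
  exact tendsto_const_nhds

end ItoLimit

/-! ### Exponential moments of Itô sums -/

section Exponential

set_option linter.unusedSectionVars false

variable {Ω : Type*} {mΩ : MeasurableSpace Ω} {P : Measure Ω} [IsProbabilityMeasure P]
  {ℱ : Filtration ℝ mΩ} {T : ℝ} {d : ℕ} {R : ℝ → Matrix (Fin d) (Fin d) ℝ}
  {W : ℝ → Ω → Fin d → ℝ}

theorem measurable_dotProduct {m : MeasurableSpace Ω} {f g : Ω → Fin d → ℝ} (hf : Measurable f)
    (hg : Measurable g) : Measurable fun ω => f ω ⬝ᵥ g ω := by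
  unfold dotProduct
  exact Finset.measurable_sum _ fun i _ =>
    ((measurable_pi_apply i).comp hf).mul ((measurable_pi_apply i).comp hg)

theorem continuous_integral_quadForm (hR : ContinuousOn R (Icc 0 T)) {p q : ℝ} (hp : 0 ≤ p)
    (hpq : p ≤ q) (hq : q ≤ T) :
    Continuous fun x : Fin d → ℝ => ∫ s in p..q, x ⬝ᵥ (R s *ᵥ x) := by
  have hRi : ∀ j l, IntervalIntegrable (fun s => R s j l) volume p q := fun j l => by
    simpa [single_one_dotProduct] using
      intervalIntegrable_quadForm hR hp hpq hq (Pi.single j 1) (Pi.single l 1)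
  have hgl : ∀ (x : Fin d → ℝ) (j : Fin d),
      IntervalIntegrable (fun s => ∑ l, x j * (R s j l * x l)) volume p q := fun x j =>
    (IntervalIntegrable.sum Finset.univ
      (f := fun l s => x j * (R s j l * x l)) fun l _ =>
        ((hRi j l).mul_const _).const_mul _).congr
      fun s _ => by simp only [Finset.sum_apply]
  have e : ∀ x : Fin d → ℝ, ∫ s in p..q, x ⬝ᵥ (R s *ᵥ x) =
      ∑ j, ∑ l, x j * ((∫ s in p..q, R s j l) * x l) := fun x => by
    simp only [dotProduct, Matrix.mulVec, Finset.mul_sum]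
    rw [intervalIntegral.integral_finsetSum fun j _ => hgl x j]
    refine Finset.sum_congr rfl fun j _ => ?_
    rw [intervalIntegral.integral_finsetSum fun l _ => ((hRi j l).mul_const _).const_mul _]
    refine Finset.sum_congr rfl fun l _ => ?_
    rw [intervalIntegral.integral_const_mul, intervalIntegral.integral_mul_const]
  simp only [e]
  fun_prop

theorem IsCorrelatedBM.lintegral_exp_incr (hW : IsCorrelatedBM P ℱ T R W)
    (hRp : ∀ t ∈ Icc 0 T, (R t).PosDef) {p q : ℝ} (hp : 0 ≤ p)
    (hpq : p ≤ q) (hq : q ≤ T) (a : Fin d → ℝ) :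
    ∫⁻ ω, ENNReal.ofReal (Real.exp (a ⬝ᵥ (W q ω - W p ω) -
      1 / 2 * ∫ s in p..q, a ⬝ᵥ (R s *ᵥ a))) ∂P = 1 := by
  have hm := (hW.memLp_incr hp hpq hq a).aestronglyMeasurable.aemeasurable
  have hg := hW.gauss p q hp hpq hq a
  have h1 := mgf_gaussianReal hg 1
  rw [mgf, Real.coe_toNNReal _ (intervalIntegral.integral_nonneg hpq fun s hs =>
    quadForm_nonneg (hRp s ⟨hp.trans hs.1, hs.2.trans hq⟩) a)] at h1
  have hi : Integrable (fun ω => Real.exp (a ⬝ᵥ (W q ω - W p ω))) P := by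
    have := integrable_exp_mul_gaussianReal (μ := 0)
      (v := (∫ τ in p..q, a ⬝ᵥ (R τ *ᵥ a)).toNNReal) 1
    rw [← hg, integrable_map_measure (by fun_prop) hm] at this
    simpa [Function.comp_def] using this
  have e : ∀ ω, Real.exp (a ⬝ᵥ (W q ω - W p ω) - 1 / 2 * ∫ s in p..q, a ⬝ᵥ (R s *ᵥ a)) =
      Real.exp (a ⬝ᵥ (W q ω - W p ω)) * Real.exp (-(1 / 2 * ∫ s in p..q, a ⬝ᵥ (R s *ᵥ a))) :=
    fun ω => by rw [← Real.exp_add, sub_eq_add_neg]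
  simp only [e]
  rw [← ofReal_integral_eq_lintegral_ofReal (hi.mul_const _)
    (ae_of_all _ fun ω => by positivity), integral_mul_const]
  simp only [one_mul] at h1
  rw [h1, ← Real.exp_add]
  simp
  ring

/-- One step of the exponential martingale, for an `ℱ_p`-measurable integrand and weight. -/
theorem IsCorrelatedBM.lintegral_mul_exp_incr (hW : IsCorrelatedBM P ℱ T R W)
    (hR : ContinuousOn R (Icc 0 T)) (hRp : ∀ t ∈ Icc 0 T, (R t).PosDef) {p q : ℝ} (hp : 0 ≤ p)
    (hpq : p ≤ q) (hq : q ≤ T) {ξ : Ω → Fin d → ℝ} (hξ : Measurable[ℱ p] ξ)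
    {Z : Ω → ENNReal} (hZ : Measurable[ℱ p] Z) :
    ∫⁻ ω, Z ω * ENNReal.ofReal (Real.exp (ξ ω ⬝ᵥ (W q ω - W p ω) -
      1 / 2 * ∫ s in p..q, ξ ω ⬝ᵥ (R s *ᵥ ξ ω))) ∂P = ∫⁻ ω, Z ω ∂P := by
  have hV := (continuous_integral_quadForm hR hp hpq hq).measurable
  have hpair : Measurable[ℱ p] fun ω => (Z ω, ξ ω) := hZ.prodMk hξ
  have hpair' : Measurable fun ω => (Z ω, ξ ω) := hpair.mono (ℱ.le _) le_rfl
  have hΔ := hW.measurable_incr' hp hpq hq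
  have hprod := (indepFun_iff_map_prod_eq_prod_map_map hpair'.aemeasurable hΔ.aemeasurable).1
    (hW.indepFun_incr hp hpq hq hpair)
  let g : (ENNReal × (Fin d → ℝ)) × (Fin d → ℝ) → ENNReal := fun x =>
    x.1.1 * ENNReal.ofReal (Real.exp (x.1.2 ⬝ᵥ x.2 - 1 / 2 * ∫ s in p..q, x.1.2 ⬝ᵥ (R s *ᵥ x.1.2)))
  have hg : Measurable g := by
    refine (measurable_fst.comp measurable_fst).mul (ENNReal.measurable_ofReal.comp
      (Real.measurable_exp.comp ((measurable_dotProduct (measurable_snd.comp measurable_fst)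
        measurable_snd).sub (Measurable.const_mul ?_ _))))
    exact hV.comp (measurable_snd.comp measurable_fst)
  have hprob : IsProbabilityMeasure (P.map fun ω => W q ω - W p ω) :=
    Measure.isProbabilityMeasure_map hΔ.aemeasurable
  calc ∫⁻ ω, Z ω * ENNReal.ofReal (Real.exp (ξ ω ⬝ᵥ (W q ω - W p ω) -
        1 / 2 * ∫ s in p..q, ξ ω ⬝ᵥ (R s *ᵥ ξ ω))) ∂P
      = ∫⁻ x, g x ∂(P.map fun ω => ((Z ω, ξ ω), W q ω - W p ω)) :=
        (lintegral_map hg (hpair'.prodMk hΔ)).symm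
    _ = ∫⁻ x, ∫⁻ y, g (x, y) ∂(P.map fun ω => W q ω - W p ω) ∂(P.map fun ω => (Z ω, ξ ω)) := by
        rw [hprod, lintegral_prod _ hg.aemeasurable]
    _ = ∫⁻ x, x.1 ∂(P.map fun ω => (Z ω, ξ ω)) := by
        refine lintegral_congr fun x => ?_
        have hgx : Measurable fun y => g (x, y) := hg.comp measurable_prodMk_left
        rw [lintegral_map hgx hΔ]
        have hmx : Measurable fun ω => ENNReal.ofReal (Real.exp (x.2 ⬝ᵥ (W q ω - W p ω) -
            1 / 2 * ∫ s in p..q, x.2 ⬝ᵥ (R s *ᵥ x.2))) :=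
          ENNReal.measurable_ofReal.comp (Real.measurable_exp.comp
            ((measurable_dotProduct measurable_const hΔ).sub_const _))
        change ∫⁻ ω, x.1 * ENNReal.ofReal (Real.exp (x.2 ⬝ᵥ (W q ω - W p ω) -
            1 / 2 * ∫ s in p..q, x.2 ⬝ᵥ (R s *ᵥ x.2))) ∂P = x.1
        rw [lintegral_const_mul _ hmx, hW.lintegral_exp_incr hRp hp hpq hq, mul_one]
    _ = ∫⁻ ω, Z ω ∂P := lintegral_map measurable_fst hpair'

/-- The exponential martingale along a grid. -/
theorem IsCorrelatedBM.lintegral_exp_sum (hW : IsCorrelatedBM P ℱ T R W)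
    (hR : ContinuousOn R (Icc 0 T)) (hRp : ∀ t ∈ Icc 0 T, (R t).PosDef) {τ : ℕ → ℝ}
    (hτ : Monotone τ) (h0 : 0 ≤ τ 0) {ξ : ℕ → Ω → Fin d → ℝ} (n : ℕ) (hn : τ n ≤ T)
    (hξ : ∀ k < n, Measurable[ℱ (τ k)] (ξ k)) :
    ∫⁻ ω, ENNReal.ofReal (Real.exp (∑ k ∈ Finset.range n, (ξ k ω ⬝ᵥ (W (τ (k + 1)) ω - W (τ k) ω) -
      1 / 2 * ∫ s in (τ k)..(τ (k + 1)), ξ k ω ⬝ᵥ (R s *ᵥ ξ k ω)))) ∂P = 1 := by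
  have hτ0 : ∀ k, 0 ≤ τ k := fun k => h0.trans (hτ (Nat.zero_le k))
  induction n with
  | zero => simp
  | succ n ih =>
    have hτn : τ n ≤ T := (hτ n.le_succ).trans hn
    simp only [Finset.sum_range_succ, Real.exp_add]
    simp_rw [ENNReal.ofReal_mul (Real.exp_pos _).le]
    rw [hW.lintegral_mul_exp_incr hR hRp (hτ0 n) (hτ n.le_succ) hn (hξ n n.lt_succ_self)]
    · exact ih hτn fun k hk => hξ k (hk.trans n.lt_succ_self)
    · refine ENNReal.measurable_ofReal.comp (Real.measurable_exp.comp
        (Finset.measurable_sum _ fun k hk => ?_))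
      have hk := Finset.mem_range.1 hk
      have hξk := (hξ k (hk.trans n.lt_succ_self)).mono (ℱ.mono (hτ hk.le)) le_rfl
      have hk1 : τ (k + 1) ≤ τ n := hτ hk
      refine (measurable_dotProduct hξk ((hW.measurable_incr (hτ0 k) (hτ k.le_succ)
        (hk1.trans hτn)).mono (ℱ.mono hk1) le_rfl)).sub (Measurable.const_mul ?_ _)
      exact (continuous_integral_quadForm hR (hτ0 k) (hτ k.le_succ)
        (hk1.trans hτn)).measurable.comp hξk

variable {H : ℝ → Ω → Fin d → ℝ}

/-- The Doléans exponential of a Riemann sum has expectation one. -/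
theorem lintegral_exp_itoSum (hW : IsCorrelatedBM P ℱ T R W)
    (hR : ContinuousOn R (Icc 0 T)) (hRp : ∀ t ∈ Icc 0 T, (R t).PosDef) (hH : IsAdmissible ℱ T H)
    {a b : ℝ} (ha : 0 ≤ a) (hab : a ≤ b) (hb : b ≤ T) {n : ℕ} (hn : n ≠ 0) :
    ∫⁻ ω, ENNReal.ofReal (Real.exp (itoSum H W a b n ω - 1 / 2 *
      ∫ s in a..b, H (gridFloor a b n s) ω ⬝ᵥ (R s *ᵥ H (gridFloor a b n s) ω))) ∂P = 1 := by
  have hn' : (n : ℝ) ≠ 0 := by exact_mod_cast hn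
  have hend : a + (n : ℝ) * (b - a) / n = b := by field_simp; ring
  have h := hW.lintegral_exp_sum hR hRp (gridPt_mono hab n) (by simpa using ha)
    (ξ := fun k => H (a + k * (b - a) / n)) n (by simpa only [hend] using hb)
    (fun k hk => hH.adapted _ (Icc_subset_Icc ha hb (gridPt_mem_Icc hab hk.le)))
  rw [← h]
  refine lintegral_congr fun ω => ?_
  congr 2
  rw [Finset.sum_sub_distrib, ← Finset.mul_sum]
  push_cast
  congr 2
  exact (sum_integral_grid hab hn (fun p s => H p ω ⬝ᵥ (R s *ᵥ H p ω)) fun p hp =>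
    intervalIntegrable_quadForm hR ha hab hb _ _).symm

theorem lintegral_exp_itoSum_le (hW : IsCorrelatedBM P ℱ T R W)
    (hR : ContinuousOn R (Icc 0 T)) (hRp : ∀ t ∈ Icc 0 T, (R t).PosDef) (hH : IsAdmissible ℱ T H)
    {C K : ℝ} (hC0 : 0 ≤ C)
    (hC : ∀ s ∈ Icc 0 T, ∀ a b : Fin d → ℝ, |a ⬝ᵥ (R s *ᵥ b)| ≤ C * (‖a‖ * ‖b‖))
    (hK : ∀ t ∈ Icc 0 T, ∀ ω, ‖H t ω‖ ≤ K)
    {a b : ℝ} (ha : 0 ≤ a) (hab : a ≤ b) (hb : b ≤ T) {n : ℕ} (hn : n ≠ 0) :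
    ∫⁻ ω, ENNReal.ofReal (Real.exp (itoSum H W a b n ω)) ∂P ≤
      ENNReal.ofReal (Real.exp (1 / 2 * (C * K ^ 2 * (b - a)))) := by
  rcases hab.eq_or_lt with rfl | hlt
  · simp [itoSum]
  have hq : ∀ ω, ∫ s in a..b, H (gridFloor a b n s) ω ⬝ᵥ (R s *ᵥ H (gridFloor a b n s) ω) ≤
      C * K ^ 2 * (b - a) := fun ω => by
    have := intervalIntegral.norm_integral_le_of_norm_le_const (a := a) (b := b)
      (f := fun s => H (gridFloor a b n s) ω ⬝ᵥ (R s *ᵥ H (gridFloor a b n s) ω))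
      (C := C * K ^ 2) (fun s hs => by
        rw [uIoc_of_le hab] at hs
        have h1 := gridFloor_mem_Icc hlt (Ioc_subset_Icc_self hs) n
        have h2 := hK _ ⟨ha.trans h1.1, h1.2.trans hb⟩ ω
        have h0 : 0 ≤ K := (norm_nonneg _).trans h2
        refine (hC s ⟨ha.trans hs.1.le, hs.2.trans hb⟩ _ _).trans ?_
        rw [sq]
        gcongr)
    rw [abs_of_nonneg (sub_nonneg.2 hab)] at this
    exact (le_abs_self _).trans this
  calc ∫⁻ ω, ENNReal.ofReal (Real.exp (itoSum H W a b n ω)) ∂P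
      ≤ ∫⁻ ω, ENNReal.ofReal (Real.exp (1 / 2 * (C * K ^ 2 * (b - a)))) *
        ENNReal.ofReal (Real.exp (itoSum H W a b n ω - 1 / 2 *
      ∫ s in a..b, H (gridFloor a b n s) ω ⬝ᵥ (R s *ᵥ H (gridFloor a b n s) ω))) ∂P := by
        refine lintegral_mono fun ω => ?_
        rw [← ENNReal.ofReal_mul (Real.exp_pos _).le, ← Real.exp_add]
        refine ENNReal.ofReal_le_ofReal (Real.exp_le_exp.2 ?_)
        linarith [hq ω]
    _ = _ := by
        rw [lintegral_const_mul' _ _ ENNReal.ofReal_ne_top, lintegral_exp_itoSum hW hR hRp hH ha hab hb hn, mul_one]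

theorem IsAdmissible.const_smul (hH : IsAdmissible ℱ T H) (c : ℝ) :
    IsAdmissible ℱ T (fun s ω => c • H s ω) := by
  obtain ⟨K, hK⟩ := hH.bdd
  obtain ⟨D, hD, hDc⟩ := hH.leftCont
  refine ⟨fun t ht => (hH.adapted t ht).const_smul c, ⟨|c| * K, fun t ht ω => ?_⟩,
    D, hD, fun t ht htD ω => (hDc t ht htD ω).const_smul c⟩
  rw [norm_smul]
  exact mul_le_mul_of_nonneg_left (hK t ht ω) (abs_nonneg c)

theorem itoSum_const_smul (c a b : ℝ) (n : ℕ) (ω : Ω) :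
    itoSum (fun s ω => c • H s ω) W a b n ω = c * itoSum H W a b n ω := by
  simp only [itoSum, Finset.mul_sum, smul_dotProduct, smul_eq_mul]

theorem pow_four_le_exp (x : ℝ) : x ^ 4 ≤ 24 * (Real.exp x + Real.exp (-x)) := by
  have key : ∀ y : ℝ, 0 ≤ y → y ^ 4 ≤ 24 * (Real.exp y + Real.exp (-y)) := fun y hy => by
    have := Real.pow_div_factorial_le_exp y hy 4
    have h2 := Real.exp_pos (-y)
    norm_num [Nat.factorial] at this
    linarith
  rcases le_total 0 x with h | h
  · exact key x h
  · have := key (-x) (by linarith)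
    simpa [add_comm, Even.neg_pow (show Even 4 by decide)] using this

/-- Fourth moments of Itô sums are of the order of the square of the interval length. -/
theorem exists_lintegral_itoSum_pow_four_le (hW : IsCorrelatedBM P ℱ T R W)
    (hR : ContinuousOn R (Icc 0 T)) (hRp : ∀ t ∈ Icc 0 T, (R t).PosDef) (hH : IsAdmissible ℱ T H) :
    ∃ C : ℝ, 0 ≤ C ∧ ∀ a b : ℝ, 0 ≤ a → a ≤ b → b ≤ T → ∀ n : ℕ, n ≠ 0 →
      ∫⁻ ω, ENNReal.ofReal (itoSum H W a b n ω ^ 4) ∂P ≤ ENNReal.ofReal (C * (b - a) ^ 2) := by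
  obtain ⟨C, hC0, hC⟩ := exists_quadForm_bound hR
  obtain ⟨K, hK⟩ := hH.bdd
  refine ⟨24 * (2 * Real.exp (1 / 2 * (C * K ^ 2))), by positivity, fun a b ha hab hb n hn => ?_⟩
  rcases hab.eq_or_lt with rfl | hlt
  · simp [itoSum]
  have hba : 0 < b - a := by linarith
  have hexp : ∀ c : ℝ, c ^ 2 * (b - a) = 1 →
      ∫⁻ ω, ENNReal.ofReal (Real.exp (c * itoSum H W a b n ω)) ∂P ≤
        ENNReal.ofReal (Real.exp (1 / 2 * (C * K ^ 2))) := fun c hc => by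
    have := lintegral_exp_itoSum_le hW hR hRp (hH.const_smul c) hC0 hC (K := |c| * K)
      (fun t ht ω => by
        rw [norm_smul]
        exact mul_le_mul_of_nonneg_left (hK t ht ω) (abs_nonneg c)) ha hab hb hn
    simp only [itoSum_const_smul] at this
    refine this.trans (le_of_eq ?_)
    congr 3
    rw [mul_pow, sq_abs]
    linear_combination C * K ^ 2 * hc
  -- rescaled by `(b - a)^{-1/2}`, the sum has exponential moments independent of the interval
  set c := 1 / Real.sqrt (b - a) with hc
  have hc2 : c ^ 2 * (b - a) = 1 := by
    rw [hc, div_pow, Real.sq_sqrt hba.le]; field_simp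
  have h1 := hexp c hc2
  have h2 := hexp (-c) (by rw [neg_sq, hc2])
  have hc4 : c ^ 4 * (b - a) ^ 2 = 1 := by
    linear_combination (c ^ 2 * (b - a) + 1) * hc2
  have hm : Measurable (itoSum H W a b n) :=
    (simpleInt_itoSum (W := W) hH ha hab hb hn).measurable hW
  calc ∫⁻ ω, ENNReal.ofReal (itoSum H W a b n ω ^ 4) ∂P
      ≤ ∫⁻ ω, ENNReal.ofReal (24 * (b - a) ^ 2) *
        (ENNReal.ofReal (Real.exp (c * itoSum H W a b n ω)) +
          ENNReal.ofReal (Real.exp (-c * itoSum H W a b n ω))) ∂P := by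
        refine lintegral_mono fun ω => ?_
        rw [← ENNReal.ofReal_add (Real.exp_pos _).le (Real.exp_pos _).le,
          ← ENNReal.ofReal_mul (by positivity)]
        refine ENNReal.ofReal_le_ofReal ?_
        have h := pow_four_le_exp (c * itoSum H W a b n ω)
        have h' := mul_le_mul_of_nonneg_left h (sq_nonneg (b - a))
        have e : (b - a) ^ 2 * (c * itoSum H W a b n ω) ^ 4 = itoSum H W a b n ω ^ 4 := by
          linear_combination (itoSum H W a b n ω ^ 4) * hc4
        rw [e] at h'
        rw [neg_mul]
        linarith
    _ = ENNReal.ofReal (24 * (b - a) ^ 2) *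
        (∫⁻ ω, ENNReal.ofReal (Real.exp (c * itoSum H W a b n ω)) ∂P +
          ∫⁻ ω, ENNReal.ofReal (Real.exp (-c * itoSum H W a b n ω)) ∂P) := by
        rw [lintegral_const_mul' _ _ ENNReal.ofReal_ne_top, lintegral_add_left]
        exact ENNReal.measurable_ofReal.comp (Real.measurable_exp.comp (hm.const_mul c))
    _ ≤ ENNReal.ofReal (24 * (b - a) ^ 2) * (ENNReal.ofReal (Real.exp (1 / 2 * (C * K ^ 2))) +
          ENNReal.ofReal (Real.exp (1 / 2 * (C * K ^ 2)))) := by gcongr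
    _ = _ := by
        rw [← ENNReal.ofReal_add (Real.exp_pos _).le (Real.exp_pos _).le,
          ← ENNReal.ofReal_mul (by positivity)]
        congr 1; ring

/-- The fourth moment bound passes to the integral by Fatou's lemma. -/
theorem exists_lintegral_isItoLimit_pow_four_le (hT : 0 ≤ T) (hW : IsCorrelatedBM P ℱ T R W)
    (hR : ContinuousOn R (Icc 0 T)) (hRp : ∀ t ∈ Icc 0 T, (R t).PosDef) (hH : IsAdmissible ℱ T H) :
    ∃ C : ℝ, 0 ≤ C ∧ ∀ a b : ℝ, 0 ≤ a → a ≤ b → b ≤ T → ∀ I : Ω → ℝ, IsItoLimit P H W a b I →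
      ∫⁻ ω, ENNReal.ofReal (I ω ^ 4) ∂P ≤ ENNReal.ofReal (C * (b - a) ^ 2) := by
  obtain ⟨C, hC0, hC⟩ := exists_lintegral_itoSum_pow_four_le hW hR hRp hH
  refine ⟨C, hC0, fun a b ha hab hb I hI => ?_⟩
  obtain ⟨ns, -, h⟩ := (hI.tendstoInMeasure hT hW hR hRp hH ha hab hb).exists_seq_tendsto_ae
  have hm : ∀ n, Measurable (itoSum H W a b (n + 1)) := fun n =>
    (simpleInt_itoSum (W := W) hH ha hab hb n.succ_ne_zero).measurable hW
  calc ∫⁻ ω, ENNReal.ofReal (I ω ^ 4) ∂P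
      = ∫⁻ ω, liminf (fun i => ENNReal.ofReal (itoSum H W a b (ns i + 1) ω ^ 4)) atTop ∂P := by
        refine lintegral_congr_ae ?_
        filter_upwards [h] with ω hω
        have : Continuous fun x : ℝ => ENNReal.ofReal (x ^ 4) :=
          ENNReal.continuous_ofReal.comp (continuous_pow 4)
        exact ((this.tendsto _).comp hω).liminf_eq.symm
    _ ≤ liminf (fun i => ∫⁻ ω, ENNReal.ofReal (itoSum H W a b (ns i + 1) ω ^ 4) ∂P) atTop :=
        lintegral_liminf_le fun i => ENNReal.measurable_ofReal.comp ((hm _).pow_const 4)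
    _ ≤ ENNReal.ofReal (C * (b - a) ^ 2) := by
        refine liminf_le_of_le (by isBoundedDefault) fun x hx => ?_
        obtain ⟨i, hi⟩ := hx.exists
        exact hi.trans (hC a b ha hab hb _ (Nat.succ_ne_zero _))

end Exponential

/-! ### Continuous versions -/

theorem gridFloor_eq_natFloor {a b s : ℝ} (hab : a < b) (hs : s ∈ Icc a b) (n : ℕ) :
    gridFloor a b n s = a + (⌊(s - a) / (b - a) * n⌋₊ : ℝ) * (b - a) / n := by
  have h0 : 0 ≤ (s - a) / (b - a) * n :=
    mul_nonneg (div_nonneg (sub_nonneg.2 hs.1) (sub_nonneg.2 hab.le)) (Nat.cast_nonneg n)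
  rw [gridFloor, natCast_floor_eq_intCast_floor h0]

theorem natFloor_grid_le {a b s : ℝ} (hab : a < b) (hs : s ∈ Icc a b) (n : ℕ) :
    ⌊(s - a) / (b - a) * n⌋₊ ≤ n := by
  have h1 : (s - a) / (b - a) ≤ 1 := by
    rw [div_le_one (sub_pos.2 hab)]; linarith [hs.2]
  apply Nat.floor_le_of_le
  exact mul_le_of_le_one_left (Nat.cast_nonneg n) h1

/-- A function on `[a, b]` whose increments over the dyadic cells of level `n` are at most `B ρ^n`
extends from the dyadic points to a continuous function. -/
theorem exists_continuousOn_of_dyadic {a b : ℝ} (hab : a < b) {f : ℝ → ℝ} {B ρ : ℝ} (hB : 0 ≤ B)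
    (hρ0 : 0 < ρ) (hρ1 : ρ < 1)
    (hf : ∀ n k : ℕ, k < 2 ^ n → |f (a + (k + 1) * (b - a) / (2 ^ n : ℕ)) -
      f (a + k * (b - a) / (2 ^ n : ℕ))| ≤ B * ρ ^ n) :
    ∃ g : ℝ → ℝ, ContinuousOn g (Icc a b) ∧
      ∀ s ∈ Icc a b, Tendsto (fun n : ℕ => f (gridFloor a b (2 ^ n) s)) atTop (𝓝 (g s)) := by
  have hba : 0 < b - a := sub_pos.2 hab
  -- neighbouring or equal indices of level `n`
  have near : ∀ n k l : ℕ, k ≤ l → l ≤ k + 1 → l ≤ 2 ^ n →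
      |f (a + l * (b - a) / (2 ^ n : ℕ)) - f (a + k * (b - a) / (2 ^ n : ℕ))| ≤ B * ρ ^ n := by
    intro n k l h1 h2 h3
    rcases h1.eq_or_lt with rfl | h1
    · simp only [sub_self, abs_zero]; positivity
    · obtain rfl : l = k + 1 := by omega
      simpa using hf n k (by omega)
  have step : ∀ s ∈ Icc a b, ∀ n : ℕ, dist (f (gridFloor a b (2 ^ n) s))
      (f (gridFloor a b (2 ^ (n + 1)) s)) ≤ B * ρ ^ n := by
    intro s hs n
    set y := (s - a) / (b - a) * (2 ^ n : ℕ) with hy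
    have hy0 : 0 ≤ y := mul_nonneg (div_nonneg (sub_nonneg.2 hs.1) hba.le) (Nat.cast_nonneg _)
    have hy2 : (s - a) / (b - a) * (2 ^ (n + 1) : ℕ) = 2 * y := by rw [hy]; push_cast; ring
    have e1 : gridFloor a b (2 ^ n) s = a + ((2 * ⌊y⌋₊ : ℕ) : ℝ) * (b - a) / (2 ^ (n + 1) : ℕ) := by
      rw [gridFloor_eq_natFloor hab hs, ← hy]; push_cast; rw [pow_succ]; field_simp
    have e2 : gridFloor a b (2 ^ (n + 1)) s =
        a + (⌊2 * y⌋₊ : ℝ) * (b - a) / (2 ^ (n + 1) : ℕ) := by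
      rw [gridFloor_eq_natFloor hab hs, hy2]
    have h1 : 2 * ⌊y⌋₊ ≤ ⌊2 * y⌋₊ := by
      apply Nat.le_floor; push_cast; linarith [Nat.floor_le hy0]
    have h2 : ⌊2 * y⌋₊ ≤ 2 * ⌊y⌋₊ + 1 := by
      have : ⌊2 * y⌋₊ < 2 * ⌊y⌋₊ + 2 := by
        rw [Nat.floor_lt (by positivity)]; push_cast; linarith [Nat.lt_floor_add_one y]
      omega
    have h3 : ⌊2 * y⌋₊ ≤ 2 ^ (n + 1) := by
      rw [← hy2]; exact natFloor_grid_le hab hs _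
    rw [dist_comm, Real.dist_eq, e1, e2]
    refine (near (n + 1) _ _ h1 h2 h3).trans ?_
    rw [pow_succ]
    have : 0 < ρ ^ n := by positivity
    nlinarith [mul_nonneg hB this.le]
  have hlim : ∀ s : ℝ, ∃ x, s ∈ Icc a b →
      Tendsto (fun n : ℕ => f (gridFloor a b (2 ^ n) s)) atTop (𝓝 x) := fun s => by
    by_cases hs : s ∈ Icc a b
    · obtain ⟨x, hx⟩ := cauchySeq_tendsto_of_complete
        (cauchySeq_of_le_geometric ρ B hρ1 (step s hs))
      exact ⟨x, fun _ => hx⟩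
    · exact ⟨0, fun h => absurd h hs⟩
  choose g hg using hlim
  have dist_g : ∀ s ∈ Icc a b, ∀ n, dist (f (gridFloor a b (2 ^ n) s)) (g s) ≤
      B * ρ ^ n / (1 - ρ) := fun s hs n =>
    dist_le_of_le_geometric_of_tendsto ρ B hρ1 (step s hs) (hg s hs) n
  have cont : ∀ n : ℕ, ∀ s ∈ Icc a b, ∀ s' ∈ Icc a b, s ≤ s' → s' - s < (b - a) / 2 ^ n →
      dist (g s') (g s) ≤ B * ρ ^ n * (2 / (1 - ρ) + 1) := by
    intro n s hs s' hs' hss hlt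
    have h1 := dist_g s hs n
    have h2 := dist_g s' hs' n
    have h3 : dist (f (gridFloor a b (2 ^ n) s')) (f (gridFloor a b (2 ^ n) s)) ≤ B * ρ ^ n := by
      rw [Real.dist_eq, gridFloor_eq_natFloor hab hs, gridFloor_eq_natFloor hab hs']
      have hle : (s - a) / (b - a) * (2 ^ n : ℕ) ≤ (s' - a) / (b - a) * (2 ^ n : ℕ) := by gcongr
      refine near n _ _ (Nat.floor_le_floor hle) ?_ (natFloor_grid_le hab hs' _)
      have h0 : 0 ≤ (s' - a) / (b - a) * (2 ^ n : ℕ) :=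
        mul_nonneg (div_nonneg (sub_nonneg.2 hs'.1) hba.le) (Nat.cast_nonneg _)
      have : ⌊(s' - a) / (b - a) * (2 ^ n : ℕ)⌋₊ < ⌊(s - a) / (b - a) * (2 ^ n : ℕ)⌋₊ + 2 := by
        rw [Nat.floor_lt h0]
        have h4 := Nat.lt_floor_add_one ((s - a) / (b - a) * (2 ^ n : ℕ))
        have h5 : (s' - a) / (b - a) * (2 ^ n : ℕ) < (s - a) / (b - a) * (2 ^ n : ℕ) + 1 := by
          rw [lt_div_iff₀ (by positivity)] at hlt
          have : (s' - a) / (b - a) * (2 ^ n : ℕ) - (s - a) / (b - a) * (2 ^ n : ℕ) =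
              (s' - s) * 2 ^ n / (b - a) := by push_cast; field_simp; ring
          have h6 : (s' - s) * 2 ^ n / (b - a) < 1 := by rwa [div_lt_one hba]
          linarith
        push_cast at h4 h5 ⊢
        linarith
      omega
    have h4 := dist_triangle4 (g s') (f (gridFloor a b (2 ^ n) s')) (f (gridFloor a b (2 ^ n) s))
      (g s)
    rw [dist_comm (g s') (f _)] at h4
    have : B * ρ ^ n * (2 / (1 - ρ) + 1) = B * ρ ^ n / (1 - ρ) + B * ρ ^ n + B * ρ ^ n / (1 - ρ) := by
      ring
    linarith
  refine ⟨g, ?_, hg⟩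
  rw [Metric.continuousOn_iff]
  intro s hs ε hε
  have ht : Tendsto (fun n : ℕ => B * ρ ^ n * (2 / (1 - ρ) + 1)) atTop (𝓝 (B * 0 * (2 / (1 - ρ) + 1))) :=
    ((tendsto_pow_atTop_nhds_zero_of_lt_one hρ0.le hρ1).const_mul B).mul_const _
  rw [mul_zero, zero_mul] at ht
  obtain ⟨n, hn⟩ := (ht.eventually (gt_mem_nhds hε)).exists
  refine ⟨(b - a) / 2 ^ n, by positivity, fun s' hs' hd => ?_⟩
  rw [Real.dist_eq, abs_lt] at hd
  rcases le_total s s' with h | h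
  · exact (cont n s hs s' hs' h (by linarith)).trans_lt hn
  · rw [dist_comm]
    exact (cont n s' hs' s hs h (by linarith)).trans_lt hn

section Version

variable {Ω : Type*} {mΩ : MeasurableSpace Ω} {P : Measure Ω}

/-- A case of the Kolmogorov continuity theorem: a process with `E|Y_s - Y_t|⁴ ≤ C |s - t|²` has a
continuous version. -/
theorem exists_continuous_version {a b : ℝ} (hab : a < b) {Y : ℝ → Ω → ℝ}
    (hY : ∀ s ∈ Icc a b, AEMeasurable (Y s) P) {C : ℝ} (hC : 0 ≤ C)
    (h : ∀ s t, a ≤ s → s ≤ t → t ≤ b →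
      ∫⁻ ω, ENNReal.ofReal ((Y t ω - Y s ω) ^ 4) ∂P ≤ ENNReal.ofReal (C * (t - s) ^ 2)) :
    ∃ Z : ℝ → Ω → ℝ, (∀ s ∈ Icc a b, Z s =ᵐ[P] Y s) ∧
      ∀ᵐ ω ∂P, ContinuousOn (fun s => Z s ω) (Icc a b) := by
  have hba : 0 < b - a := sub_pos.2 hab
  have hmeas : ∀ s ∈ Icc a b, ∀ t ∈ Icc a b,
      AEMeasurable (fun ω => ENNReal.ofReal ((Y t ω - Y s ω) ^ 4)) P := fun s hs t ht =>
    ENNReal.measurable_ofReal.comp_aemeasurable (((hY t ht).sub (hY s hs)).pow_const 4)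
  have hmem : ∀ n k : ℕ, k ≤ 2 ^ n → a + (k : ℝ) * (b - a) / (2 ^ n : ℕ) ∈ Icc a b := fun n k hk =>
    gridPt_mem_Icc hab.le hk
  have hmem' : ∀ n k : ℕ, k < 2 ^ n → a + ((k : ℝ) + 1) * (b - a) / (2 ^ n : ℕ) ∈ Icc a b :=
    fun n k hk => by simpa using hmem n (k + 1) hk
  -- Weighted fourth powers of all dyadic increments have a finite expected sum: level `n` has
  -- `2^n` cells with moments of order `4^{-n}`, and `(10/9)^4 / 2 ≤ 4/5`. Where the sum is finite,
  -- the increments of level `n` are of order `(9/10)^n`.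
  let V : ℕ → Ω → ENNReal := fun n ω => ENNReal.ofReal ((10 / 9 : ℝ) ^ (4 * n)) *
    ∑ k ∈ Finset.range (2 ^ n), ENNReal.ofReal ((Y (a + (k + 1) * (b - a) / (2 ^ n : ℕ)) ω -
      Y (a + k * (b - a) / (2 ^ n : ℕ)) ω) ^ 4)
  have hVm : ∀ n, AEMeasurable (V n) P := fun n =>
    (Finset.aemeasurable_fun_sum _ fun k hk =>
      hmeas _ (hmem n k (Finset.mem_range.1 hk).le) _ (hmem' n k (Finset.mem_range.1 hk))).const_mul _
  have hV : ∀ n, ∫⁻ ω, V n ω ∂P ≤ ENNReal.ofReal (C * (b - a) ^ 2 * (4 / 5) ^ n) := fun n => by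
    rw [lintegral_const_mul' _ _ ENNReal.ofReal_ne_top, lintegral_finsetSum' _ fun k hk =>
      hmeas _ (hmem n k (Finset.mem_range.1 hk).le) _ (hmem' n k (Finset.mem_range.1 hk))]
    calc _ ≤ ENNReal.ofReal ((10 / 9 : ℝ) ^ (4 * n)) * ∑ k ∈ Finset.range (2 ^ n),
          ENNReal.ofReal (C * ((b - a) / 2 ^ n) ^ 2) := by
          gcongr with k hk
          have hk := Finset.mem_range.1 hk
          refine (h _ _ (hmem n k hk.le).1 ?_ (hmem' n k hk).2).trans (le_of_eq ?_)
          · simpa using gridPt_mono hab.le (2 ^ n) k.le_succ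
          · congr 3; push_cast; ring
      _ = ENNReal.ofReal ((10 / 9 : ℝ) ^ (4 * n) * (2 ^ n * (C * ((b - a) / 2 ^ n) ^ 2))) := by
          rw [Finset.sum_const, Finset.card_range, nsmul_eq_mul, ← ENNReal.ofReal_natCast,
            ← ENNReal.ofReal_mul (by positivity), ← ENNReal.ofReal_mul (by positivity)]
          push_cast; rfl
      _ ≤ _ := by
          refine ENNReal.ofReal_le_ofReal ?_
          have e : (10 / 9 : ℝ) ^ (4 * n) * (2 ^ n * (C * ((b - a) / 2 ^ n) ^ 2)) =
              C * (b - a) ^ 2 * ((10 / 9 : ℝ) ^ 4 / 2) ^ n := by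
            rw [div_pow ((10 / 9 : ℝ) ^ 4), ← pow_mul]; field_simp
          rw [e]
          exact mul_le_mul_of_nonneg_left (pow_le_pow_left₀ (by norm_num) (by norm_num) n)
            (by positivity)
  have hsum : ∫⁻ ω, ∑' n, V n ω ∂P < ⊤ := by
    rw [lintegral_tsum hVm]
    refine (ENNReal.tsum_le_tsum hV).trans_lt ?_
    rw [← ENNReal.ofReal_tsum_of_nonneg (fun n => by positivity)
      ((summable_geometric_of_lt_one (by norm_num) (by norm_num)).mul_left _)]
    exact ENNReal.ofReal_lt_top
  have hfin : ∀ᵐ ω ∂P, ∑' n, V n ω < ⊤ :=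
    ae_lt_top' (AEMeasurable.tsum hVm) hsum.ne
  have hpath : ∀ᵐ ω ∂P, ∃ g : ℝ → ℝ, ContinuousOn g (Icc a b) ∧ ∀ s ∈ Icc a b,
      Tendsto (fun n : ℕ => Y (gridFloor a b (2 ^ n) s) ω) atTop (𝓝 (g s)) := by
    filter_upwards [hfin] with ω hω
    set A := (∑' n, V n ω).toReal with hA
    have hA0 : 0 ≤ A := ENNReal.toReal_nonneg
    refine exists_continuousOn_of_dyadic hab (f := fun s => Y s ω) (B := A + 1) (ρ := 9 / 10)
      (by positivity) (by norm_num) (by norm_num) fun n k hk => ?_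
    set x := Y (a + (k + 1) * (b - a) / (2 ^ n : ℕ)) ω - Y (a + k * (b - a) / (2 ^ n : ℕ)) ω with hx
    have h1 : ENNReal.ofReal ((10 / 9 : ℝ) ^ (4 * n) * x ^ 4) ≤ ENNReal.ofReal A := by
      rw [hA, ENNReal.ofReal_toReal hω.ne, ENNReal.ofReal_mul (by positivity)]
      refine le_trans ?_ (ENNReal.le_tsum n)
      dsimp only [V]
      gcongr
      exact Finset.single_le_sum (f := fun k : ℕ =>
        ENNReal.ofReal ((Y (a + (k + 1) * (b - a) / (2 ^ n : ℕ)) ω -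
        Y (a + k * (b - a) / (2 ^ n : ℕ)) ω) ^ 4)) (fun _ _ => zero_le) (Finset.mem_range.2 hk)
    rw [ENNReal.ofReal_le_ofReal_iff hA0] at h1
    have h2 : |x| ^ 4 ≤ ((A + 1) * (9 / 10) ^ n) ^ 4 := by
      rw [Even.pow_abs (by decide), mul_pow, ← pow_mul, mul_comm n 4]
      have e : (10 / 9 : ℝ) ^ (4 * n) * (9 / 10) ^ (4 * n) = 1 := by
        rw [← mul_pow]; norm_num
      have hp : (0 : ℝ) < (9 / 10) ^ (4 * n) := by positivity
      have h3 : x ^ 4 ≤ A * (9 / 10) ^ (4 * n) := by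
        calc x ^ 4 = ((10 / 9 : ℝ) ^ (4 * n) * x ^ 4) * (9 / 10) ^ (4 * n) := by
              linear_combination (-x ^ 4) * e
          _ ≤ _ := by gcongr
      refine h3.trans ?_
      gcongr
      calc A ≤ A + 1 := by linarith
        _ ≤ (A + 1) ^ 4 := le_self_pow₀ (by linarith) (by norm_num)
    exact (pow_le_pow_iff_left₀ (abs_nonneg x) (by positivity) (by norm_num)).1 h2
  refine ⟨fun s ω => limUnder atTop fun n : ℕ => Y (gridFloor a b (2 ^ n) s) ω, fun s hs => ?_, ?_⟩
  · have hgm := fun n => gridFloor_mem_Icc hab hs n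
    have h0 : ∫⁻ ω, ENNReal.ofReal ((Y s ω -
        limUnder atTop fun n : ℕ => Y (gridFloor a b (2 ^ n) s) ω) ^ 4) ∂P = 0 := by
      rw [← nonpos_iff_eq_zero]
      calc _ = ∫⁻ ω, liminf (fun n : ℕ =>
            ENNReal.ofReal ((Y s ω - Y (gridFloor a b (2 ^ n) s) ω) ^ 4)) atTop ∂P := by
            refine lintegral_congr_ae ?_
            filter_upwards [hpath] with ω ⟨g, _, hg⟩
            rw [(hg s hs).limUnder_eq]
            have : Continuous fun x : ℝ => ENNReal.ofReal ((Y s ω - x) ^ 4) :=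
              ENNReal.continuous_ofReal.comp (by fun_prop)
            exact ((this.tendsto _).comp (hg s hs)).liminf_eq.symm
        _ ≤ liminf (fun n : ℕ =>
            ∫⁻ ω, ENNReal.ofReal ((Y s ω - Y (gridFloor a b (2 ^ n) s) ω) ^ 4) ∂P) atTop :=
            lintegral_liminf_le' fun n => hmeas _ (hgm _) _ hs
        _ ≤ liminf (fun n : ℕ => ENNReal.ofReal (C * (s - gridFloor a b (2 ^ n) s) ^ 2)) atTop := by
            refine liminf_le_liminf (Eventually.of_forall fun n => ?_)
            exact h _ _ (hgm _).1 (gridFloor_le hab hs.1 _) hs.2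
        _ = 0 := by
            have h1 := ((tendsto_gridFloor hab hs.1).mono_right nhdsWithin_le_nhds).comp
              (tendsto_pow_atTop_atTop_of_one_lt (r := 2) one_lt_two)
            have : Continuous fun x : ℝ => ENNReal.ofReal (C * (s - x) ^ 2) :=
              ENNReal.continuous_ofReal.comp (by fun_prop)
            have h2 := (this.tendsto s).comp h1
            simp only [sub_self, ne_eq, OfNat.ofNat_ne_zero, not_false_eq_true, zero_pow, mul_zero,
              ENNReal.ofReal_zero] at h2
            exact h2.liminf_eq
    rw [lintegral_eq_zero_iff'] at h0
    · filter_upwards [h0] with ω hω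
      have h1 : ENNReal.ofReal ((Y s ω -
        limUnder atTop fun n : ℕ => Y (gridFloor a b (2 ^ n) s) ω) ^ 4) = 0 := hω
      rw [ENNReal.ofReal_eq_zero] at h1
      have h2 := le_antisymm h1 (by positivity)
      have h3 := pow_eq_zero_iff (by norm_num) |>.1 h2
      linarith
    · refine ENNReal.measurable_ofReal.comp_aemeasurable (((hY s hs).sub ?_).pow_const 4)
      refine aemeasurable_of_tendsto_metrizable_ae atTop (fun n => hY _ (hgm (2 ^ n))) ?_
      filter_upwards [hpath] with ω ⟨g, _, hg⟩
      rw [(hg s hs).limUnder_eq]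
      exact hg s hs
  · filter_upwards [hpath] with ω ⟨g, hg, hlim⟩
    exact hg.congr fun s hs => (hlim s hs).limUnder_eq

set_option linter.unusedSectionVars false

variable [IsProbabilityMeasure P] {ℱ : Filtration ℝ mΩ} {T : ℝ} {d : ℕ}
  {R : ℝ → Matrix (Fin d) (Fin d) ℝ} {W H : ℝ → Ω → Fin d → ℝ}

/-- The stochastic integral as a continuous process. -/
theorem exists_ito_process (hW : IsCorrelatedBM P ℱ T R W)
    (hR : ContinuousOn R (Icc 0 T)) (hRp : ∀ t ∈ Icc 0 T, (R t).PosDef) (hH : IsAdmissible ℱ T H)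
    {a : ℝ} (ha : 0 ≤ a) (haT : a < T) :
    ∃ N : ℝ → Ω → ℝ, (∀ s ∈ Icc a T, IsItoLimit P H W a s (N s)) ∧
      ∀ᵐ ω ∂P, ContinuousOn (fun s => N s ω) (Icc a T) := by
  have hT : 0 ≤ T := ha.trans haT.le
  have hex : ∀ s, ∃ I, s ∈ Icc a T → IsItoLimit P H W a s I := fun s => by
    by_cases hs : s ∈ Icc a T
    · obtain ⟨I, hI⟩ := exists_isItoLimit hT hW hR hRp hH ha hs.1 hs.2
      exact ⟨I, fun _ => hI⟩
    · exact ⟨0, fun h => absurd h hs⟩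
  choose Y hY using hex
  obtain ⟨C, hC0, hC⟩ := exists_lintegral_isItoLimit_pow_four_le hT hW hR hRp hH
  obtain ⟨N, hN, hNc⟩ := exists_continuous_version haT (Y := Y) (P := P)
    (fun s hs => (hY s hs).memLp.aestronglyMeasurable.aemeasurable) hC0 (fun s t has hst htb => by
      have hs : s ∈ Icc a T := ⟨has, hst.trans htb⟩
      have ht : t ∈ Icc a T := ⟨has.trans hst, htb⟩
      obtain ⟨I, hI⟩ := exists_isItoLimit hT hW hR hRp hH (ha.trans has) hst htb
      have hadd := (hY s hs).add hT hW hR hRp hH ha has hst htb hI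
      have heq := hadd.ae_eq hT hW hR hRp hH ha ht.1 htb (hY t ht)
      refine le_of_eq_of_le (lintegral_congr_ae ?_) (hC s t (ha.trans has) hst htb I hI)
      filter_upwards [heq] with ω hω
      rw [← hω]
      simp)
  exact ⟨N, fun s hs => (hY s hs).congr (hN s hs).symm, hNc⟩

end Version

/-! ### Pathwise integration and the linear equation -/

/-- Left-point Riemann sums converge for bounded functions that are left-continuous off a countable
set. -/
theorem tendsto_integral_gridFloor {a b : ℝ} (hab : a ≤ b) {f : ℝ → ℝ} {D : Set ℝ}
    (hD : D.Countable) (hf : ∀ s ∈ Ioc a b, s ∉ D → ContinuousWithinAt f (Iic s) s) {K : ℝ}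
    (hK : ∀ s ∈ Icc a b, |f s| ≤ K) :
    Tendsto (fun n : ℕ => ∫ s in a..b, f (gridFloor a b (n + 1) s)) atTop (𝓝 (∫ s in a..b, f s)) := by
  rcases hab.eq_or_lt with rfl | hlt
  · simp
  refine intervalIntegral.tendsto_integral_filter_of_dominated_convergence (fun _ => K)
    (Eventually.of_forall fun n => (measurable_comp_gridFloor a b _ f).aestronglyMeasurable)
    (Eventually.of_forall fun n => ae_of_all _ fun s hs => ?_) (by simp) ?_
  · rw [uIoc_of_le hab] at hs
    exact hK _ (gridFloor_mem_Icc hlt (Ioc_subset_Icc_self hs) _)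
  · filter_upwards [hD.ae_notMem volume] with s hsD hs
    rw [uIoc_of_le hab] at hs
    exact (tendsto_comp_gridFloor hlt hs.1.le (hf s hs hsD)).comp (tendsto_add_atTop_nat 1)

/-- Pathwise integrals over `[a, b]` inherit measurability with respect to a sub-σ-algebra. -/
theorem aestronglyMeasurable_integral {Ω : Type*} {m mΩ : MeasurableSpace Ω} {P : Measure Ω}
    {a b : ℝ} (hab : a ≤ b) {f : ℝ → Ω → ℝ} (hfm : ∀ s ∈ Icc a b, AEStronglyMeasurable[m] (f s) P)
    (hf : ∀ᵐ ω ∂P, ∃ D : Set ℝ, D.Countable ∧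
      (∀ s ∈ Ioc a b, s ∉ D → ContinuousWithinAt (fun s => f s ω) (Iic s) s) ∧
      ∃ K, ∀ s ∈ Icc a b, |f s ω| ≤ K) :
    AEStronglyMeasurable[m] (fun ω => ∫ s in a..b, f s ω) P := by
  refine aestronglyMeasurable_sub_of_tendsto_ae
    (f := fun n ω => ∫ s in a..b, f (gridFloor a b (n + 1) s) ω) (fun n => ?_) ?_
  · have e : (fun ω => ∫ s in a..b, f (gridFloor a b (n + 1) s) ω) =
        ∑ k ∈ Finset.range (n + 1), fun ω => ((a + (k + 1) * (b - a) / (n + 1 : ℕ)) -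
          (a + k * (b - a) / (n + 1 : ℕ))) * f (a + k * (b - a) / (n + 1 : ℕ)) ω := by
      ext ω
      rw [← sum_integral_grid hab n.succ_ne_zero (fun p _ => f p ω) fun p _ => by simp]
      simp
    rw [e]
    refine Finset.sum_induction _ (fun g => AEStronglyMeasurable[m] g P) (fun _ _ h h' => h.add h')
      aestronglyMeasurable_const fun k hk => ?_
    exact (hfm _ (gridPt_mem_Icc hab (Finset.mem_range.1 hk).le)).const_mul _
  · filter_upwards [hf] with ω ⟨D, hD, hl, K, hK⟩
    exact tendsto_integral_gridFloor hab hD hl hK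

theorem ContinuousOn.leftCont_Icc {E : Type*} [TopologicalSpace E] {a b : ℝ} {f : ℝ → E}
    (hf : ContinuousOn f (Icc a b)) {s : ℝ} (hs : s ∈ Ioc a b) : ContinuousWithinAt f (Iic s) s :=
  (hf s (Ioc_subset_Icc_self hs)).mono_of_mem_nhdsWithin (by
    have : Ioi a ∩ Iic s ∈ 𝓝[Iic s] s := inter_mem (mem_nhdsWithin_of_mem_nhds (Ioi_mem_nhds hs.1)) self_mem_nhdsWithin
    exact mem_of_superset this fun y hy => ⟨hy.1.le, hy.2.trans hs.2⟩)

/-- A continuous function on `[a, b]`, extended to the real line by its boundary values. -/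
theorem exists_continuous_extension {a b : ℝ} (hab : a ≤ b) {f : ℝ → ℝ}
    (hf : ContinuousOn f (Icc a b)) :
    ∃ g : ℝ → ℝ, Continuous g ∧ (∀ s ∈ Icc a b, g s = f s) ∧ ∃ K, ∀ s, |g s| ≤ K := by
  obtain ⟨K, hK⟩ := isCompact_Icc.exists_bound_of_continuousOn hf
  refine ⟨fun s => f (projIcc a b hab s), ?_, fun s hs => ?_, K, fun s => hK _ (projIcc a b hab s).2⟩
  · exact (continuousOn_iff_continuous_domRestrict.1 hf).comp continuous_projIcc
  · simp [projIcc_of_mem hab hs]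

/-- The solution `X` of `X_s = M_s + r ∫_t^s X`. -/
theorem linear_equation {t T r : ℝ} (htT : t ≤ T) {M : ℝ → ℝ} (hM : ContinuousOn M (Icc t T)) :
    ContinuousOn (fun s => M s + r * Real.exp (r * s) * ∫ τ in t..s, Real.exp (-r * τ) * M τ)
      (Icc t T) ∧ ∀ s ∈ Icc t T,
      M s + r * Real.exp (r * s) * ∫ τ in t..s, Real.exp (-r * τ) * M τ = M s + r *
        ∫ v in t..s, (M v + r * Real.exp (r * v) * ∫ τ in t..v, Real.exp (-r * τ) * M τ) := by
  obtain ⟨g, hg, hgM, -⟩ := exists_continuous_extension htT hM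
  set Φ : ℝ → ℝ := fun s => ∫ τ in t..s, Real.exp (-r * τ) * g τ with hΦ
  have hcont : Continuous fun τ => Real.exp (-r * τ) * g τ := by fun_prop
  have hd : ∀ s, HasDerivAt Φ (Real.exp (-r * s) * g s) s := fun s =>
    intervalIntegral.integral_hasDerivAt_right (hcont.intervalIntegrable _ _)
      (hcont.stronglyMeasurableAtFilter _ _) hcont.continuousAt
  have hΦc : Continuous Φ := continuous_iff_continuousAt.2 fun s => (hd s).continuousAt
  have e1 : ∀ s ∈ Icc t T, M s + r * Real.exp (r * s) * ∫ τ in t..s, Real.exp (-r * τ) * M τ =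
      g s + r * Real.exp (r * s) * Φ s := fun s hs => by
    rw [hΦ, hgM s hs]
    congr 2
    refine intervalIntegral.integral_congr fun τ hτ => ?_
    rw [uIcc_of_le hs.1] at hτ
    simp only [hgM τ ⟨hτ.1, hτ.2.trans hs.2⟩]
  have hXc : Continuous fun s => g s + r * Real.exp (r * s) * Φ s := by fun_prop
  refine ⟨hXc.continuousOn.congr e1, fun s hs => ?_⟩
  have e2 : ∫ v in t..s, (M v + r * Real.exp (r * v) * ∫ τ in t..v, Real.exp (-r * τ) * M τ) =
      ∫ v in t..s, (g v + r * Real.exp (r * v) * Φ v) := by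
    refine intervalIntegral.integral_congr fun v hv => ?_
    rw [uIcc_of_le hs.1] at hv
    exact e1 v ⟨hv.1, hv.2.trans hs.2⟩
  have hF : ∀ v ∈ uIcc t s, HasDerivAt (fun v => Real.exp (r * v) * Φ v)
      (g v + r * Real.exp (r * v) * Φ v) v := fun v _ => by
    have h1 : HasDerivAt (fun v : ℝ => Real.exp (r * v)) (Real.exp (r * v) * (r * 1)) v :=
      ((hasDerivAt_id v).const_mul r).exp
    have h2 := h1.mul (hd v)
    refine h2.congr_deriv ?_
    have : Real.exp (r * v) * Real.exp (-r * v) = 1 := by rw [← Real.exp_add]; simp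
    linear_combination (g v) * this
  have h3 := intervalIntegral.integral_eq_sub_of_hasDerivAt hF (hXc.intervalIntegrable _ _)
  rw [e2, h3, e1 s hs, hgM s hs]
  simp only [hΦ, intervalIntegral.integral_same]
  ring

/-! ### Existence of the wealth process -/

section Wealth

set_option linter.unusedSectionVars false

variable {Ω : Type*} {mΩ : MeasurableSpace Ω} {P : Measure Ω} [IsProbabilityMeasure P]
  {ℱ : Filtration ℝ mΩ} {T : ℝ} {d : ℕ} {W u : ℝ → Ω → Fin d → ℝ}

theorem IsAdmissible.vecMul (hu : IsAdmissible ℱ T u) {A : ℝ → Matrix (Fin d) (Fin d) ℝ}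
    (hA : ContinuousOn A (Icc 0 T)) : IsAdmissible ℱ T (fun s ω => u s ω ᵥ* A s) := by
  obtain ⟨K, hK⟩ := hu.bdd
  obtain ⟨D, hD, hDc⟩ := hu.leftCont
  have hc : ContinuousOn (fun s => ∑ i, ∑ j, |A s i j|) (Icc 0 T) := by
    have : Continuous fun B : Matrix (Fin d) (Fin d) ℝ => ∑ i, ∑ j, |B i j| := by fun_prop
    exact this.comp_continuousOn hA
  obtain ⟨C, hC⟩ := isCompact_Icc.exists_bound_of_continuousOn hc
  refine ⟨fun t ht => ?_, ⟨K * C, fun t ht ω => ?_⟩, D, hD, fun t ht htD ω => ?_⟩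
  · have : Continuous fun y : Fin d → ℝ => y ᵥ* A t := by fun_prop
    exact this.measurable.comp (hu.adapted t ht)
  · have hK0 : 0 ≤ K := (norm_nonneg _).trans (hK t ht ω)
    have hCt : ∑ i, ∑ j, |A t i j| ≤ C := (le_abs_self _).trans (hC t ht)
    have hC0 : 0 ≤ C := le_trans (by positivity) hCt
    rw [pi_norm_le_iff_of_nonneg (by positivity)]
    intro j
    calc ‖(u t ω ᵥ* A t) j‖ = |∑ i, u t ω i * A t i j| := by
          rw [Matrix.vecMul, dotProduct, Real.norm_eq_abs]
      _ ≤ ∑ i, |u t ω i * A t i j| := Finset.abs_sum_le_sum_abs _ _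
      _ ≤ ∑ i, K * ∑ j, |A t i j| := by
          refine Finset.sum_le_sum fun i _ => ?_
          rw [abs_mul]
          have h1 : |u t ω i| ≤ K := (norm_le_pi_norm _ i).trans (hK t ht ω)
          have h2 : |A t i j| ≤ ∑ j, |A t i j| :=
            Finset.single_le_sum (f := fun j => |A t i j|) (fun _ _ => abs_nonneg _)
              (Finset.mem_univ j)
          gcongr
      _ ≤ K * C := by rw [← Finset.mul_sum]; gcongr
  · have : Continuous fun p : (Fin d → ℝ) × Matrix (Fin d) (Fin d) ℝ => p.1 ᵥ* p.2 := by fun_prop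
    exact this.continuousAt.comp_continuousWithinAt
      ((hDc t ht htD ω).prodMk (hA.leftCont_Icc ht))

/-- The excess drift `∑_i u^i (μ^i - r)` of the wealth. -/
def drift (m : BSMarket d) (u : ℝ → Ω → Fin d → ℝ) (s : ℝ) (ω : Ω) : ℝ :=
  ∑ i, u s ω i * (m.μ s i - m.r)

theorem measurable_drift {m : BSMarket d} (hu : IsAdmissible ℱ m.T u) {s : ℝ} (hs : s ∈ Icc 0 m.T) :
    Measurable[ℱ s] (drift m u s) :=
  Finset.measurable_sum _ fun i _ =>
    ((measurable_pi_apply i).comp (hu.adapted s hs)).mul_const _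

theorem exists_drift_bound {m : BSMarket d} (hu : IsAdmissible ℱ m.T u) :
    ∃ K, ∀ s ∈ Icc 0 m.T, ∀ ω, |drift m u s ω| ≤ K := by
  obtain ⟨K, hK⟩ := hu.bdd
  have hc : ContinuousOn (fun s => ∑ i, |m.μ s i - m.r|) (Icc 0 m.T) := by
    have : Continuous fun y : Fin d → ℝ => ∑ i, |y i - m.r| := by fun_prop
    exact this.comp_continuousOn m.μ_cont
  obtain ⟨C, hC⟩ := isCompact_Icc.exists_bound_of_continuousOn hc
  refine ⟨K * C, fun s hs ω => ?_⟩
  have hK0 : 0 ≤ K := (norm_nonneg _).trans (hK s hs ω)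
  have hCt : ∑ i, |m.μ s i - m.r| ≤ C := (le_abs_self _).trans (hC s hs)
  calc |drift m u s ω| ≤ ∑ i, |u s ω i * (m.μ s i - m.r)| := Finset.abs_sum_le_sum_abs _ _
    _ ≤ ∑ i, K * |m.μ s i - m.r| := by
        refine Finset.sum_le_sum fun i _ => ?_
        rw [abs_mul]
        have h1 : |u s ω i| ≤ K := (norm_le_pi_norm _ i).trans (hK s hs ω)
        gcongr
    _ ≤ K * C := by rw [← Finset.mul_sum]; gcongr

theorem exists_drift_leftCont {m : BSMarket d} (hu : IsAdmissible ℱ m.T u) :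
    ∃ D : Set ℝ, D.Countable ∧ ∀ t ∈ Ioc 0 m.T, t ∉ D → ∀ ω,
      ContinuousWithinAt (fun s => drift m u s ω) (Iic t) t := by
  obtain ⟨D, hD, hDc⟩ := hu.leftCont
  refine ⟨D, hD, fun t ht htD ω => ?_⟩
  have : Continuous fun p : (Fin d → ℝ) × (Fin d → ℝ) => ∑ i, p.1 i * (p.2 i - m.r) := by fun_prop
  exact this.continuousAt.comp_continuousWithinAt
    ((hDc t ht htD ω).prodMk (m.μ_cont.leftCont_Icc ht))

theorem intervalIntegrable_drift {m : BSMarket d} (hu : IsAdmissible ℱ m.T u) {p q : ℝ} (hp : 0 ≤ p)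
    (hpq : p ≤ q) (hq : q ≤ m.T) (ω : Ω) :
    IntervalIntegrable (fun s => drift m u s ω) volume p q := by
  obtain ⟨D, hD, hDc⟩ := exists_drift_leftCont (m := m) hu
  obtain ⟨K, hK⟩ := exists_drift_bound (m := m) hu
  have hsub : Ioc p q ⊆ Ioc 0 m.T := Ioc_subset_Ioc hp hq
  exact intervalIntegrable_of_leftCont hpq hD (fun s hs hsD => hDc s (hsub hs) hsD ω)
    (fun s hs => hK s (Ioc_subset_Icc_self (hsub hs)) ω)

/-- The wealth equation has a solution, by variation of constants: with
`N_s = x + ∫ u·(μ - r) dτ + ∫ u σ dW` it is `X_s = N_s + r ∫_t^s e^{r (s - τ)} N_τ dτ`. -/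
theorem exists_isWealth (m : BSMarket d) (hW : IsCorrelatedBM P ℱ m.T m.R W)
    (hu : IsAdmissible ℱ m.T u) {t : ℝ} (ht : t ∈ Ico 0 m.T) (x : ℝ) :
    ∃ X, IsWealth P ℱ m W u t x X := by
  have hT := m.T_pos.le
  have htT := ht.2.le
  have hH := hu.vecMul m.σ_cont
  obtain ⟨N, hN, hNc⟩ := exists_ito_process hW m.R_cont m.R_posDef hH ht.1 ht.2
  obtain ⟨D, hD, hDc⟩ := exists_drift_leftCont (m := m) hu
  obtain ⟨K, hK⟩ := exists_drift_bound (m := m) hu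
  have hBi : ∀ ω, ∀ s ∈ Icc t m.T, IntervalIntegrable (fun s => drift m u s ω) volume t s :=
    fun ω s hs => intervalIntegrable_drift hu ht.1 hs.1 hs.2 ω
  let M : ℝ → Ω → ℝ := fun s ω => x + N s ω + ∫ τ in t..s, drift m u τ ω
  have hMc : ∀ᵐ ω ∂P, ContinuousOn (fun s => M s ω) (Icc t m.T) := by
    filter_upwards [hNc] with ω hω
    refine (continuousOn_const.add hω).add ?_
    have := intervalIntegral.continuousOn_primitive_interval' (hBi ω m.T ⟨htT, le_rfl⟩)
      left_mem_uIcc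
    rwa [uIcc_of_le htT] at this
  have hMm : ∀ s ∈ Icc t m.T, AEStronglyMeasurable[ℱ s] (M s) P := fun s hs => by
    have h1 := (hN s hs).aestronglyMeasurable hT hW m.R_cont m.R_posDef hH ht.1 hs.1 hs.2
    refine (aestronglyMeasurable_const.add h1).add (aestronglyMeasurable_integral hs.1 ?_ ?_)
    · exact fun τ hτ => (((measurable_drift hu ⟨ht.1.trans hτ.1, hτ.2.trans hs.2⟩).mono
        (ℱ.mono hτ.2) le_rfl).stronglyMeasurable).aestronglyMeasurable
    · exact ae_of_all _ fun ω => ⟨D, hD, fun τ hτ hτD =>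
        hDc τ (Ioc_subset_Ioc ht.1 hs.2 hτ) hτD ω, K, fun τ hτ =>
        hK τ (Icc_subset_Icc ht.1 hs.2 hτ) ω⟩
  have hN0 : N t =ᵐ[P] 0 :=
    (hN t ⟨le_rfl, htT⟩).ae_eq hT hW m.R_cont m.R_posDef hH ht.1 le_rfl htT
      (isItoLimit_same t)
  refine ⟨fun s ω => M s ω + m.r * Real.exp (m.r * s) * ∫ τ in t..s, Real.exp (-m.r * τ) * M τ ω,
    fun s hs => ?_, ?_, ?_, fun s hs => ?_⟩
  · refine (hMm s hs).add ((aestronglyMeasurable_integral hs.1 (fun τ hτ => ?_) ?_).const_mul _)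
    · exact ((hMm τ ⟨hτ.1, hτ.2.trans hs.2⟩).mono (ℱ.mono hτ.2)).const_mul _
    · filter_upwards [hMc] with ω hω
      have hc : ContinuousOn (fun τ => Real.exp (-m.r * τ) * M τ ω) (Icc t s) :=
        ContinuousOn.mul (by fun_prop) (hω.mono (Icc_subset_Icc_right hs.2))
      obtain ⟨K', hK'⟩ := isCompact_Icc.exists_bound_of_continuousOn hc
      exact ⟨∅, countable_empty, fun τ hτ _ => hc.leftCont_Icc hτ, K', hK'⟩
  · filter_upwards [hMc] with ω hω
    exact (linear_equation htT hω).1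
  · filter_upwards [hN0] with ω hω
    simp [M, hω]
  · have hI := (hN s hs).isItoIntegral hT hW m.R_cont m.R_posDef hH ht.1 hs.1 hs.2
    refine TendstoInMeasure.congr_right ?_ hI
    filter_upwards [hMc] with ω hω
    obtain ⟨hXc, hX⟩ := linear_equation (r := m.r) htT hω
    rw [hX s hs]
    have hsub : uIcc t s ⊆ Icc t m.T := by rw [uIcc_of_le hs.1]; exact Icc_subset_Icc_right hs.2
    have hXi := (hXc.mono hsub).intervalIntegrable (μ := volume)
    have e := intervalIntegral.integral_add (hXi.const_mul m.r) (hBi ω s hs)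
    rw [intervalIntegral.integral_const_mul] at e
    change N s ω = _ - x - ∫ τ in t..s, (m.r * (M τ ω + m.r * Real.exp (m.r * τ) *
      ∫ v in t..τ, Real.exp (-m.r * v) * M v ω) + drift m u τ ω)
    rw [e]
    simp only [M]
    ring

theorem wealth_spec (m : BSMarket d) (hW : IsCorrelatedBM P ℱ m.T m.R W)
    (hu : IsAdmissible ℱ m.T u) {t : ℝ} (ht : t ∈ Ico 0 m.T) (x : ℝ) :
    IsWealth P ℱ m W u t x (wealth P ℱ m W u t x) :=
  Classical.epsilon_spec (exists_isWealth m hW hu ht x)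

end Wealth

/-! ### The gain as a stochastic integral -/

theorem integral_discount (r T p q : ℝ) : ∫ s in p..q, r * Real.exp (r * (T - s)) =
    Real.exp (r * (T - p)) - Real.exp (r * (T - q)) := by
  have hd : ∀ s ∈ uIcc p q, HasDerivAt (fun s => -Real.exp (r * (T - s)))
      (r * Real.exp (r * (T - s))) s := fun s _ => by
    have h := ((((hasDerivAt_id s).const_sub T).const_mul r).exp).neg
    refine h.congr_deriv ?_
    simp; ring
  rw [intervalIntegral.integral_eq_sub_of_hasDerivAt hd
    (Continuous.intervalIntegrable (by fun_prop) _ _)]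
  ring

theorem discount_le {r T s : ℝ} (hs : s ∈ Icc 0 T) :
    Real.exp (r * (T - s)) ≤ Real.exp (|r| * T) := by
  refine Real.exp_le_exp.2 ?_
  have h1 : 0 ≤ T - s := sub_nonneg.2 hs.2
  calc r * (T - s) ≤ |r| * (T - s) := by gcongr; exact le_abs_self r
    _ ≤ |r| * T := by gcongr; linarith [hs.1]

theorem abs_discount_sub_le {r T p s : ℝ} (hp : 0 ≤ p) (hps : p ≤ s) (hs : s ≤ T) :
    |Real.exp (r * (T - p)) - Real.exp (r * (T - s))| ≤ |r| * Real.exp (|r| * T) * (s - p) := by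
  rw [← integral_discount]
  have := intervalIntegral.norm_integral_le_of_norm_le_const (a := p) (b := s)
    (f := fun s => r * Real.exp (r * (T - s))) (C := |r| * Real.exp (|r| * T)) (fun v hv => by
      rw [uIoc_of_le hps] at hv
      rw [norm_mul, Real.norm_eq_abs, Real.norm_eq_abs, abs_of_pos (Real.exp_pos _)]
      have := discount_le (r := r) (T := T) (s := v) ⟨hp.trans hv.1.le, hv.2.trans hs⟩
      gcongr)
  rwa [abs_of_nonneg (sub_nonneg.2 hps)] at this

/-- Integration by parts along a path: if `N = X - ∫ (r X + b)`, the left-point sums of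
`∫ e^{r (T - s)} dN_s` tend to `X_T - e^{r (T - t)} X_t - ∫ e^{r (T - s)} b_s ds`. -/
theorem tendsto_sum_discount {t T r x : ℝ} (htT : t < T) {X b N : ℝ → ℝ}
    (hX : ContinuousOn X (Icc t T)) (hb : IntervalIntegrable b volume t T) {K : ℝ}
    (hK : ∀ s ∈ Icc t T, |b s| ≤ K)
    (hN : ∀ s ∈ Icc t T, N s = X s - x - ∫ τ in t..s, (r * X τ + b τ)) :
    Tendsto (fun n : ℕ => ∑ k ∈ Finset.range (n + 1),
      Real.exp (r * (T - (t + k * (T - t) / (n + 1 : ℕ)))) *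
      (N (t + (k + 1) * (T - t) / (n + 1 : ℕ)) - N (t + k * (T - t) / (n + 1 : ℕ)))) atTop
      (𝓝 (X T - Real.exp (r * (T - t)) * X t - ∫ s in t..T, Real.exp (r * (T - s)) * b s)) := by
  obtain ⟨g, hg, hgX, Kg, hKg⟩ := exists_continuous_extension htT.le hX
  set c : ℝ → ℝ := fun s => Real.exp (r * (T - s)) with hc
  have hcc : Continuous c := by fun_prop
  have hcb : IntervalIntegrable (fun s => c s * b s) volume t T := hb.continuousOn_mul hcc.continuousOn
  let δ : ℕ → ℝ := fun n => (T - t) / (n + 1 : ℕ)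
  -- the integrand of the discretization error on the cell `[p, p + δ n]`; it tends to `0` as `p → s`
  let F : ℕ → ℝ → ℝ → ℝ := fun n p s => r * c s * g (p + δ n) - c p * (r * g s + b s) + c s * b s
  have hsub : ∀ p ∈ Icc t T, ∀ q ∈ Icc t T, uIcc p q ⊆ uIcc t T := fun p hp q hq => by
    rw [uIcc_of_le htT.le]
    exact uIcc_subset_Icc hp hq
  have hFi : ∀ n p, IntervalIntegrable (F n p) volume t T := fun n p =>
    (((by fun_prop : Continuous fun s => r * c s * g (p + δ n)).intervalIntegrable _ _).sub
      ((((by fun_prop : Continuous fun s => r * g s).intervalIntegrable _ _).add hb).const_mul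
        (c p))).add hcb
  -- the telescoping decomposition of a single cell
  have cell : ∀ n k : ℕ, k < n + 1 →
      c (t + k * (T - t) / (n + 1 : ℕ)) *
      (N (t + (k + 1) * (T - t) / (n + 1 : ℕ)) - N (t + k * (T - t) / (n + 1 : ℕ))) =
      ((c (t + (k + 1 : ℕ) * (T - t) / (n + 1 : ℕ)) * X (t + (k + 1 : ℕ) * (T - t) / (n + 1 : ℕ)) -
        ∫ s in t..(t + (k + 1 : ℕ) * (T - t) / (n + 1 : ℕ)), c s * b s) -
      (c (t + k * (T - t) / (n + 1 : ℕ)) * X (t + k * (T - t) / (n + 1 : ℕ)) -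
        ∫ s in t..(t + k * (T - t) / (n + 1 : ℕ)), c s * b s)) +
      ∫ s in (t + k * (T - t) / (n + 1 : ℕ))..(t + (k + 1) * (T - t) / (n + 1 : ℕ)),
        F n (t + k * (T - t) / (n + 1 : ℕ)) s := by
    intro n k hk
    have hp := gridPt_mem_Icc htT.le hk.le
    have hq := gridPt_mem_Icc htT.le (show k + 1 ≤ n + 1 from hk)
    have hδ : t + (k : ℝ) * (T - t) / (n + 1 : ℕ) + δ n =
        t + (k + 1 : ℕ) * (T - t) / (n + 1 : ℕ) := by
      simp only [δ]; push_cast; ring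
    have hcast : t + ((k : ℝ) + 1) * (T - t) / (n + 1 : ℕ) =
        t + (k + 1 : ℕ) * (T - t) / (n + 1 : ℕ) := by push_cast; ring
    rw [hcast]
    simp only [F, hδ]
    generalize t + (k : ℝ) * (T - t) / (n + 1 : ℕ) = p at *
    generalize t + ((k + 1 : ℕ) : ℝ) * (T - t) / (n + 1 : ℕ) = q at *
    have ht : t ∈ Icc t T := ⟨le_rfl, htT.le⟩
    have hbpq := hb.mono_set (hsub p hp q hq)
    have hgi : ∀ p q : ℝ, IntervalIntegrable (fun s => r * g s) volume p q := fun p q =>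
      (by fun_prop : Continuous fun s => r * g s).intervalIntegrable _ _
    have hXg : ∀ s ∈ Icc t T, ∫ τ in t..s, (r * X τ + b τ) = ∫ τ in t..s, (r * g τ + b τ) :=
      fun s hs => intervalIntegral.integral_congr fun τ hτ => by
        rw [uIcc_of_le hs.1] at hτ
        simp only [hgX τ ⟨hτ.1, hτ.2.trans hs.2⟩]
    have e1 : (∫ τ in t..q, (r * g τ + b τ)) - ∫ τ in t..p, (r * g τ + b τ) =
        ∫ τ in p..q, (r * g τ + b τ) := by
      rw [intervalIntegral.integral_interval_sub_left]
      · exact (hgi _ _).add (hb.mono_set (hsub t ht q hq))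
      · exact (hgi _ _).add (hb.mono_set (hsub t ht p hp))
    have e2 : (∫ s in t..q, c s * b s) - ∫ s in t..p, c s * b s = ∫ s in p..q, c s * b s := by
      rw [intervalIntegral.integral_interval_sub_left]
      · exact hcb.mono_set (hsub t ht q hq)
      · exact hcb.mono_set (hsub t ht p hp)
    have i1 : IntervalIntegrable (fun s => r * c s * g q) volume p q :=
      (by fun_prop : Continuous fun s => r * c s * g q).intervalIntegrable _ _
    have i2 : IntervalIntegrable (fun s => c p * (r * g s + b s)) volume p q :=
      ((hgi _ _).add hbpq).const_mul _
    rw [intervalIntegral.integral_add (i1.sub i2) (hcb.mono_set (hsub p hp q hq)),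
      intervalIntegral.integral_sub i1 i2, intervalIntegral.integral_mul_const,
      show ∫ s in p..q, r * c s = c p - c q from integral_discount r T p q,
      intervalIntegral.integral_const_mul, hN p hp, hN q hq, hXg p hp, hXg q hq,
      ← e1, ← e2, hgX q hq]
    ring
  have hsum : ∀ n : ℕ, ∑ k ∈ Finset.range (n + 1), c (t + k * (T - t) / (n + 1 : ℕ)) *
      (N (t + (k + 1) * (T - t) / (n + 1 : ℕ)) - N (t + k * (T - t) / (n + 1 : ℕ))) =
      (X T - c t * X t - ∫ s in t..T, c s * b s) +
        ∫ s in t..T, F n (gridFloor t T (n + 1) s) s := fun n => by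
    rw [Finset.sum_congr rfl fun k hk => cell n k (Finset.mem_range.1 hk), Finset.sum_add_distrib,
      Finset.sum_range_sub (fun k : ℕ => c (t + k * (T - t) / (n + 1 : ℕ)) *
        X (t + k * (T - t) / (n + 1 : ℕ)) - ∫ s in t..(t + k * (T - t) / (n + 1 : ℕ)), c s * b s),
      sum_integral_grid htT.le n.succ_ne_zero (F n) fun p _ => hFi n p]
    have hend : t + ((n + 1 : ℕ) : ℝ) * (T - t) / (n + 1 : ℕ) = T := by
      have : ((n + 1 : ℕ) : ℝ) ≠ 0 := by positivity
      field_simp; ring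
    have hcT : c T = 1 := by simp [hc]
    rw [hend, hcT]
    simp
    ring
  have hlim : Tendsto (fun n : ℕ => ∫ s in t..T, F n (gridFloor t T (n + 1) s) s) atTop
      (𝓝 (∫ s in t..T, (0 : ℝ))) := by
    obtain ⟨C, hC⟩ := (isCompact_Icc (a := t) (b := T)).exists_bound_of_continuousOn hcc.continuousOn
    refine intervalIntegral.tendsto_integral_filter_of_dominated_convergence
      (fun _ => |r| * C * Kg + C * (|r| * Kg + K) + C * K) (Eventually.of_forall fun n => ?_)
      (Eventually.of_forall fun n => ae_of_all _ fun s hs => ?_) (by simp)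
      (ae_of_all _ fun s hs => ?_)
    · have hbm : AEStronglyMeasurable b (volume.restrict (uIoc t T)) :=
        (intervalIntegrable_iff.1 hb).aestronglyMeasurable
      have m1 : Measurable fun s => g (gridFloor t T (n + 1) s + δ n) :=
        measurable_comp_gridFloor t T (n + 1) fun p => g (p + δ n)
      have m2 : Measurable fun s => c (gridFloor t T (n + 1) s) :=
        measurable_comp_gridFloor t T (n + 1) c
      exact (((hcc.measurable.const_mul r).mul m1).aestronglyMeasurable.sub
        (m2.aestronglyMeasurable.mul
          (((hg.measurable.const_mul r).aestronglyMeasurable).add hbm))).add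
        (hcc.aestronglyMeasurable.mul hbm)
    · rw [uIoc_of_le htT.le] at hs
      have hs' := Ioc_subset_Icc_self hs
      have h1 : |c s| ≤ C := hC s hs'
      have h2 : |c (gridFloor t T (n + 1) s)| ≤ C := hC _ (gridFloor_mem_Icc htT hs' _)
      have h3 := hK s hs'
      have hC0 : 0 ≤ C := (abs_nonneg _).trans h1
      have hK0 : 0 ≤ Kg := (abs_nonneg _).trans (hKg 0)
      refine (norm_add_le _ _).trans (add_le_add ((norm_sub_le _ _).trans (add_le_add ?_ ?_)) ?_)
      · rw [norm_mul, norm_mul, Real.norm_eq_abs, Real.norm_eq_abs, Real.norm_eq_abs]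
        have := hKg (gridFloor t T (n + 1) s + δ n)
        gcongr
      · rw [norm_mul]
        refine mul_le_mul h2 ((norm_add_le _ _).trans (add_le_add ?_ h3)) (norm_nonneg _) hC0
        rw [norm_mul]
        exact mul_le_mul_of_nonneg_left (hKg s) (norm_nonneg _)
      · rw [norm_mul]
        exact mul_le_mul h1 h3 (norm_nonneg _) hC0
    · rw [uIoc_of_le htT.le] at hs
      have h1 : Tendsto (fun n : ℕ => gridFloor t T (n + 1) s) atTop (𝓝 s) :=
        ((tendsto_gridFloor htT hs.1.le).mono_right nhdsWithin_le_nhds).comp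
          (tendsto_add_atTop_nat 1)
      have h2 : Tendsto δ atTop (𝓝 0) :=
        (tendsto_const_div_atTop_nhds_zero_nat (T - t)).comp (tendsto_add_atTop_nat 1)
      have h3 := (hg.tendsto (s + 0)).comp (h1.add h2)
      have h4 := (hcc.tendsto s).comp h1
      have h5 := ((h3.const_mul (r * c s)).sub (h4.mul_const (r * g s + b s))).add_const (c s * b s)
      have e : r * c s * g (s + 0) - c s * (r * g s + b s) + c s * b s = 0 := by
        rw [add_zero]; ring
      rw [e] at h5
      exact h5
  have := hlim.const_add (X T - c t * X t - ∫ s in t..T, c s * b s)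
  rw [intervalIntegral.integral_zero, add_zero] at this
  refine this.congr fun n => ?_
  rw [← hsum n]

section Gain

set_option linter.unusedSectionVars false

variable {Ω : Type*} {mΩ : MeasurableSpace Ω} {P : Measure Ω} [IsProbabilityMeasure P]
  {ℱ : Filtration ℝ mΩ} {T : ℝ} {d : ℕ} {R : ℝ → Matrix (Fin d) (Fin d) ℝ}
  {W u H : ℝ → Ω → Fin d → ℝ}

/-- Multiplying an admissible integrand by the left-point samples of a bounded function. -/
theorem IsAdmissible.smul_grid (hH : IsAdmissible ℱ T H) {t : ℝ} (ht : 0 ≤ t) (htT : t < T) {n : ℕ}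
    (hn : n ≠ 0) {c : ℝ → ℝ} {C : ℝ} (hC : ∀ s ∈ Icc 0 T, |c s| ≤ C) :
    IsAdmissible ℱ T (fun s ω => c (gridFloor t T n (max t s)) • H s ω) := by
  obtain ⟨K, hK⟩ := hH.bdd
  obtain ⟨D, hD, hDc⟩ := hH.leftCont
  refine ⟨fun s hs => (hH.adapted s hs).const_smul (c (gridFloor t T n (max t s))), ⟨C * K, fun s hs ω => ?_⟩,
    D ∪ range (fun k : ℕ => t + k * (T - t) / n), hD.union (countable_range _),
    fun s hs hsD ω => ?_⟩
  · have h1 := gridFloor_mem_Icc htT (s := max t s) ⟨le_max_left _ _, max_le htT.le hs.2⟩ n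
    have h2 := hC _ ⟨ht.trans h1.1, h1.2⟩
    rw [norm_smul]
    exact mul_le_mul h2 (hK s hs ω) (norm_nonneg _) ((abs_nonneg _).trans h2)
  · simp only [mem_union, not_or] at hsD
    refine ContinuousWithinAt.smul (f := fun s => c (gridFloor t T n (max t s))) ?_
      (hDc s hs hsD.1 ω)
    refine ContinuousAt.continuousWithinAt ?_
    have hst : s ≠ t := fun h => hsD.2 ⟨0, by simp [h]⟩
    have hsT : s ≠ T := fun h => hsD.2 ⟨n, by
      have : (n : ℝ) ≠ 0 := by exact_mod_cast hn
      rw [h]; field_simp; ring⟩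
    rcases lt_or_gt_of_ne hst with hlt | hgt
    · refine ContinuousAt.congr (f := fun _ => c (gridFloor t T n t)) continuousAt_const ?_
      filter_upwards [Iio_mem_nhds hlt] with v hv
      rw [max_eq_left (le_of_lt hv)]
    · obtain ⟨k, hk, hsk⟩ := exists_grid_cell htT hn ⟨hgt.le, lt_of_le_of_ne hs.2 hsT⟩
      have hne : s ≠ t + k * (T - t) / n := fun h => hsD.2 ⟨k, h.symm⟩
      refine ContinuousAt.congr (f := fun _ => c (t + k * (T - t) / n)) continuousAt_const ?_
      filter_upwards [Ioo_mem_nhds (lt_of_le_of_ne hsk.1 hne.symm) hsk.2] with v hv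
      rw [max_eq_right, gridFloor_eq htT hn k ⟨hv.1.le, hv.2⟩]
      exact (gridPt_mem_Icc htT.le hk.le).1.trans hv.1.le

/-- For the integrand `c H` with `c` sampled on a grid, the integral is the weighted sum of the
increments of `∫ H dW`. -/
theorem isItoLimit_smul_grid (hW : IsCorrelatedBM P ℱ T R W)
    (hR : ContinuousOn R (Icc 0 T)) (hRp : ∀ t ∈ Icc 0 T, (R t).PosDef) (hH : IsAdmissible ℱ T H)
    {t : ℝ} (ht : 0 ≤ t) (htT : t < T) {n : ℕ} (hn : n ≠ 0) {c : ℝ → ℝ} {C : ℝ}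
    (hC : ∀ s ∈ Icc 0 T, |c s| ≤ C) {N : ℝ → Ω → ℝ}
    (hN : ∀ s ∈ Icc t T, IsItoLimit P H W t s (N s)) :
    IsItoLimit P (fun s ω => c (gridFloor t T n (max t s)) • H s ω) W t T
      (fun ω => ∑ k ∈ Finset.range n, c (t + k * (T - t) / n) *
        (N (t + (k + 1) * (T - t) / n) ω - N (t + k * (T - t) / n) ω)) := by
  have hT : 0 ≤ T := ht.trans htT.le
  have hG := hH.smul_grid ht htT hn hC
  have hn' : (0 : ℝ) < n := by exact_mod_cast Nat.pos_of_ne_zero hn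
  have main : ∀ j ≤ n, IsItoLimit P (fun s ω => c (gridFloor t T n (max t s)) • H s ω) W t
      (t + j * (T - t) / n) (fun ω => ∑ k ∈ Finset.range j, c (t + k * (T - t) / n) *
        (N (t + (k + 1) * (T - t) / n) ω - N (t + k * (T - t) / n) ω)) := by
    intro j
    induction j with
    | zero =>
      intro _
      simp only [Nat.cast_zero, zero_mul, zero_div, add_zero, Finset.range_zero, Finset.sum_empty]
      exact isItoLimit_same t
    | succ j ih =>
      intro hj
      have h1 := ih (by omega)
      have hp := gridPt_mem_Icc htT.le (show j ≤ n by omega)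
      have hq := gridPt_mem_Icc htT.le hj
      have hpq : t + (j : ℝ) * (T - t) / n < t + (j + 1 : ℕ) * (T - t) / n := by
        have : (0 : ℝ) < T - t := sub_pos.2 htT
        push_cast
        gcongr
        linarith
      obtain ⟨I, hI⟩ := exists_isItoLimit hT hW hR hRp hH (ht.trans hp.1) hpq.le hq.2
      have hI' := ((hN _ hp).add hT hW hR hRp hH ht hp.1 hpq.le hq.2 hI).ae_eq hT hW hR hRp hH ht
        hq.1 hq.2 (hN _ hq)
      have hsmall : ∀ i : ℕ, itoSum (fun s ω => c (gridFloor t T n (max t s)) • H s ω) W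
          (t + (j : ℝ) * (T - t) / n) (t + (j + 1 : ℕ) * (T - t) / n) (i + 1) =
          c (t + j * (T - t) / n) • itoSum H W
          (t + (j : ℝ) * (T - t) / n) (t + (j + 1 : ℕ) * (T - t) / n) (i + 1) := fun i => by
        funext ω
        simp only [itoSum, Pi.smul_apply, Finset.smul_sum]
        refine Finset.sum_congr rfl fun l hl => ?_
        have hl := Finset.mem_range.1 hl
        have hmem := gridPt_mem_Icc hpq.le hl.le
        have hlt : t + (j : ℝ) * (T - t) / n + l * ((t + (j + 1 : ℕ) * (T - t) / n) -
            (t + (j : ℝ) * (T - t) / n)) / (i + 1 : ℕ) < t + (j + 1 : ℕ) * (T - t) / n := by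
          have h2 : (l : ℝ) < (i + 1 : ℕ) := by exact_mod_cast hl
          have h3 := sub_pos.2 hpq
          have h4 : (0 : ℝ) < (i + 1 : ℕ) := by positivity
          have : l * ((t + (j + 1 : ℕ) * (T - t) / n) - (t + (j : ℝ) * (T - t) / n)) / (i + 1 : ℕ)
              < (t + (j + 1 : ℕ) * (T - t) / n) - (t + (j : ℝ) * (T - t) / n) := by
            rw [div_lt_iff₀ h4]
            nlinarith
          linarith
        rw [max_eq_right (hp.1.trans hmem.1), gridFloor_eq htT hn j ⟨hmem.1, by
          simpa using hlt⟩, smul_dotProduct]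
      have h2 : IsItoLimit P (fun s ω => c (gridFloor t T n (max t s)) • H s ω) W
          (t + (j : ℝ) * (T - t) / n) (t + (j + 1 : ℕ) * (T - t) / n)
          (c (t + j * (T - t) / n) • I) := by
        refine ⟨hI.memLp.const_smul _, ?_⟩
        simp only [hsmall, ← smul_sub, eLpNorm_const_smul]
        have := ENNReal.Tendsto.const_mul (a := ‖c (t + j * (T - t) / n)‖ₑ) hI.tendsto
          (Or.inr enorm_ne_top)
        rwa [mul_zero] at this
      refine (h1.add hT hW hR hRp hG ht hp.1 hpq.le hq.2 h2).congr ?_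
      filter_upwards [hI'] with ω hω
      rw [Finset.sum_range_succ]
      simp only [Pi.add_apply, Pi.smul_apply, smul_eq_mul] at hω ⊢
      push_cast at hω
      rw [← hω]
      ring
  have := main n le_rfl
  have hend : t + (n : ℝ) * (T - t) / n = T := by field_simp; ring
  rwa [hend] at this

/-- The weighted increments of `∫ H dW` converge to `∫ e^{r (T - s)} H_s dW_s`. -/
theorem tendsto_eLpNorm_discount (hW : IsCorrelatedBM P ℱ T R W)
    (hR : ContinuousOn R (Icc 0 T)) (hRp : ∀ t ∈ Icc 0 T, (R t).PosDef) (hH : IsAdmissible ℱ T H)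
    {t : ℝ} (ht : 0 ≤ t) (htT : t < T) (r : ℝ) {N : ℝ → Ω → ℝ}
    (hN : ∀ s ∈ Icc t T, IsItoLimit P H W t s (N s)) {I : Ω → ℝ}
    (hcH : IsAdmissible ℱ T fun s ω => Real.exp (r * (T - s)) • H s ω)
    (hI : IsItoLimit P (fun s ω => Real.exp (r * (T - s)) • H s ω) W t T I) :
    Tendsto (fun n : ℕ => eLpNorm ((fun ω => ∑ k ∈ Finset.range (n + 1),
      Real.exp (r * (T - (t + k * (T - t) / (n + 1 : ℕ)))) *
      (N (t + (k + 1) * (T - t) / (n + 1 : ℕ)) ω - N (t + k * (T - t) / (n + 1 : ℕ)) ω)) - I) 2 P)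
      atTop (𝓝 0) := by
  have hT : 0 ≤ T := ht.trans htT.le
  obtain ⟨C, hC0, hC⟩ := SimpleInt.exists_integral_sq_le (P := P) hT hW hR hRp
  obtain ⟨K, hK⟩ := hH.bdd
  have hcb : ∀ s ∈ Icc 0 T, |Real.exp (r * (T - s))| ≤ Real.exp (|r| * T) := fun s hs => by
    rw [abs_of_pos (Real.exp_pos _)]; exact discount_le hs
  let ε : ℕ → ℝ := fun n => |r| * Real.exp (|r| * T) * ((T - t) / (n + 1 : ℕ)) * K
  have bound : ∀ n : ℕ, eLpNorm ((fun ω => ∑ k ∈ Finset.range (n + 1),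
      Real.exp (r * (T - (t + k * (T - t) / (n + 1 : ℕ)))) *
      (N (t + (k + 1) * (T - t) / (n + 1 : ℕ)) ω - N (t + k * (T - t) / (n + 1 : ℕ)) ω)) - I) 2 P ≤
      ENNReal.ofReal ((C * ε n ^ 2) ^ (2⁻¹ : ℝ)) := by
    intro n
    have hG := hH.smul_grid ht htT n.succ_ne_zero hcb
    have hJ := isItoLimit_smul_grid hW hR hRp hH ht htT n.succ_ne_zero hcb hN
    set J : Ω → ℝ := fun ω => ∑ k ∈ Finset.range (n + 1),
      Real.exp (r * (T - (t + k * (T - t) / (n + 1 : ℕ)))) *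
      (N (t + (k + 1) * (T - t) / (n + 1 : ℕ)) ω - N (t + k * (T - t) / (n + 1 : ℕ)) ω)
    set G : ℝ → Ω → Fin d → ℝ :=
      fun s ω => Real.exp (r * (T - gridFloor t T (n + 1) (max t s))) • H s ω with hGdef
    set cH : ℝ → Ω → Fin d → ℝ := fun s ω => Real.exp (r * (T - s)) • H s ω with hcHdef
    have hdiff : ∀ i : ℕ, SimpleInt ℱ T W
        (((Ico t T).indicator fun s => G (gridFloor t T (i + 1) s)) -
          ((Ico t T).indicator fun s => cH (gridFloor t T (i + 1) s)))
        (itoSum G W t T (i + 1) - itoSum cH W t T (i + 1)) := fun i =>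
      (simpleInt_itoSum hG ht htT.le le_rfl i.succ_ne_zero).sub
        (simpleInt_itoSum hcH ht htT.le le_rfl i.succ_ne_zero)
    have hmid : ∀ i : ℕ, eLpNorm (itoSum G W t T (i + 1) - itoSum cH W t T (i + 1)) 2 P ≤
        ENNReal.ofReal ((C * ε n ^ 2) ^ (2⁻¹ : ℝ)) := fun i => by
      rw [eLpNorm_two_eq ((hdiff i).memLp hT hW hR hRp)]
      refine ENNReal.ofReal_le_ofReal (Real.rpow_le_rpow (by positivity)
        (hC _ _ (hdiff i) (ε n) fun s _ ω => ?_) (by norm_num))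
      by_cases hs : s ∈ Ico t T
      · simp only [Pi.sub_apply, indicator_of_mem hs, hGdef, hcHdef]
        set v := gridFloor t T (i + 1) s with hv
        have hvm : v ∈ Icc t T := gridFloor_mem_Icc htT (Ico_subset_Icc_self hs) _
        have hwm := gridFloor_mem_Icc htT hvm (n + 1)
        rw [max_eq_right hvm.1, ← sub_smul, norm_smul]
        refine mul_le_mul ?_ (hK v ⟨ht.trans hvm.1, hvm.2⟩ ω) (norm_nonneg _) ?_
        · refine (abs_discount_sub_le (ht.trans hwm.1) (gridFloor_le htT hvm.1 _) hvm.2).trans ?_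
          gcongr
          exact (sub_gridFloor_lt htT n.succ_ne_zero).le
        · have := sub_pos.2 htT
          positivity
      · simp only [Pi.sub_apply, indicator_of_notMem hs, sub_self, Pi.zero_apply, norm_zero]
        have h0 := (norm_nonneg _).trans (hK 0 ⟨le_rfl, hT⟩ ω)
        have := sub_pos.2 htT
        positivity
    have hlim := (hJ.tendsto.add_const (ENNReal.ofReal ((C * ε n ^ 2) ^ (2⁻¹ : ℝ)))).add hI.tendsto
    rw [zero_add, add_zero] at hlim
    refine ge_of_tendsto' hlim fun i => ?_
    have m1 := ((memLp_itoSum hT hW hR hRp hG ht htT.le le_rfl i).sub hJ.memLp)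
    have m2 := (hdiff i).memLp hT hW hR hRp
    have m3 := ((memLp_itoSum hT hW hR hRp hcH ht htT.le le_rfl i).sub hI.memLp)
    have e : J - I = (-(itoSum G W t T (i + 1) - J) +
        (itoSum G W t T (i + 1) - itoSum cH W t T (i + 1))) + (itoSum cH W t T (i + 1) - I) := by
      abel
    rw [e]
    refine (eLpNorm_add_le (m1.neg.add m2).aestronglyMeasurable m3.aestronglyMeasurable
      one_le_two).trans (add_le_add ((eLpNorm_add_le m1.neg.aestronglyMeasurable
      m2.aestronglyMeasurable one_le_two).trans (add_le_add ?_ (hmid i))) le_rfl)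
    rw [eLpNorm_neg]
  have hε : Tendsto ε atTop (𝓝 0) := by
    have h1 := (tendsto_const_div_atTop_nhds_zero_nat (T - t)).comp (tendsto_add_atTop_nat 1)
    have h2 := (h1.const_mul (|r| * Real.exp (|r| * T))).mul_const K
    rw [mul_zero, zero_mul] at h2
    exact h2
  have hcont : Continuous fun x : ℝ => ENNReal.ofReal ((C * x ^ 2) ^ (2⁻¹ : ℝ)) :=
    ENNReal.continuous_ofReal.comp ((Real.continuous_rpow_const (by norm_num)).comp (by fun_prop))
  have h3 := (hcont.tendsto 0).comp hε
  simp only [ne_eq, OfNat.ofNat_ne_zero, not_false_eq_true, zero_pow, mul_zero] at h3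
  rw [Real.zero_rpow (by norm_num), ENNReal.ofReal_zero] at h3
  exact tendsto_of_tendsto_of_tendsto_of_le_of_le tendsto_const_nhds h3 (fun _ => zero_le) bound

/-- The gain is `∫_t^T e^{r (T - s)} (∑ u^i (μ^i - r) ds + u σ dW)`. The proof applies to any solution
of the wealth equation, so the choice made in `wealth` does not matter. -/
theorem isItoLimit_gain (m : BSMarket d) (hW : IsCorrelatedBM P ℱ m.T m.R W)
    (hu : IsAdmissible ℱ m.T u) {t : ℝ} (ht : t ∈ Ico 0 m.T) (x : ℝ) :
    IsItoLimit P (fun s ω => u s ω ᵥ* (Real.exp (m.r * (m.T - s)) • m.σ s)) W t m.T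
      (fun ω => gain P ℱ m W u t x ω - ∫ s in t..m.T, Real.exp (m.r * (m.T - s)) * drift m u s ω) := by
  have hT := m.T_pos.le
  have hX := wealth_spec m hW hu ht x
  set X := wealth P ℱ m W u t x
  have hH := hu.vecMul m.σ_cont
  have hcσ : ContinuousOn (fun s => Real.exp (m.r * (m.T - s)) • m.σ s) (Icc 0 m.T) :=
    ContinuousOn.smul (f := fun s => Real.exp (m.r * (m.T - s)))
      (Continuous.continuousOn (by fun_prop)) m.σ_cont
  have hcH := hu.vecMul hcσ
  have e : (fun s ω => u s ω ᵥ* (Real.exp (m.r * (m.T - s)) • m.σ s)) =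
      fun s ω => Real.exp (m.r * (m.T - s)) • (u s ω ᵥ* m.σ s) := by
    funext s ω; rw [Matrix.vecMul_smul]
  rw [e] at hcH ⊢
  obtain ⟨I, hI⟩ := exists_isItoLimit hT hW m.R_cont m.R_posDef hcH ht.1 ht.2.le le_rfl
  let N : ℝ → Ω → ℝ := fun s ω => X s ω - x - ∫ τ in t..s, (m.r * X τ ω + drift m u τ ω)
  have hN : ∀ s ∈ Icc t m.T, IsItoLimit P (fun s ω => u s ω ᵥ* m.σ s) W t s (N s) := fun s hs => by
    obtain ⟨J, hJ⟩ := exists_isItoLimit hT hW m.R_cont m.R_posDef hH ht.1 hs.1 hs.2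
    exact hJ.congr (tendstoInMeasure_ae_unique
      (hJ.isItoIntegral hT hW m.R_cont m.R_posDef hH ht.1 hs.1 hs.2) (hX.sde s hs))
  have hlim := tendsto_eLpNorm_discount hW m.R_cont m.R_posDef hH ht.1 ht.2 m.r hN hcH hI
  have hmeas := tendstoInMeasure_of_tendsto_eLpNorm two_ne_zero (fun n =>
    (isItoLimit_smul_grid hW m.R_cont m.R_posDef hH ht.1 ht.2 (n := n + 1) n.succ_ne_zero
      (c := fun s => Real.exp (m.r * (m.T - s))) (C := Real.exp (|m.r| * m.T)) (fun s hs => by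
        rw [abs_of_pos (Real.exp_pos _)]; exact discount_le hs) hN).memLp.aestronglyMeasurable)
    hI.memLp.aestronglyMeasurable hlim
  obtain ⟨ns, hns, hae⟩ := hmeas.exists_seq_tendsto_ae
  obtain ⟨K, hK⟩ := exists_drift_bound (m := m) hu
  refine hI.congr ?_
  filter_upwards [hae, hX.cont, hX.init] with ω h1 h2 h3
  have h4 := tendsto_sum_discount (r := m.r) (x := x) ht.2 (N := fun s => N s ω) h2
    (intervalIntegrable_drift hu ht.1 ht.2.le le_rfl ω)
    (fun s hs => hK s ⟨ht.1.trans hs.1, hs.2⟩ ω) (fun s _ => rfl)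
  have h5 := tendsto_nhds_unique h1 (h4.comp hns.tendsto_atTop)
  rw [h5, gain, h3]
  ring

end Gain

/-! ### Exponential utility of the gain -/

/-- Passage to the limit in `∫ f_n = 1` for nonnegative functions bounded in `L²`. -/
theorem integral_eq_one_of_tendsto_of_sq_le {Ω : Type*} {mΩ : MeasurableSpace Ω} {P : Measure Ω}
    [IsProbabilityMeasure P] {f : ℕ → Ω → ℝ} {g : Ω → ℝ} (h0 : ∀ n ω, 0 ≤ f n ω)
    (hf : ∀ n, Measurable (f n)) (h1 : ∀ n, ∫⁻ ω, ENNReal.ofReal (f n ω) ∂P = 1) {B : ℝ}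
    (hB : ∀ n, ∫⁻ ω, ENNReal.ofReal (f n ω ^ 2) ∂P ≤ ENNReal.ofReal B)
    (h : ∀ᵐ ω ∂P, Tendsto (fun n => f n ω) atTop (𝓝 (g ω))) :
    Integrable g P ∧ ∫ ω, g ω ∂P = 1 := by
  have hgm : AEStronglyMeasurable g P :=
    aestronglyMeasurable_of_tendsto_ae atTop (fun n => (hf n).aestronglyMeasurable) h
  have hg0 : 0 ≤ᵐ[P] g := by
    filter_upwards [h] with ω hω using ge_of_tendsto' hω fun n => h0 n ω
  have hle : ∫⁻ ω, ENNReal.ofReal (g ω) ∂P ≤ 1 := by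
    calc _ = ∫⁻ ω, liminf (fun n => ENNReal.ofReal (f n ω)) atTop ∂P := by
          refine lintegral_congr_ae ?_
          filter_upwards [h] with ω hω
          exact ((ENNReal.continuous_ofReal.tendsto _).comp hω).liminf_eq.symm
      _ ≤ liminf (fun n => ∫⁻ ω, ENNReal.ofReal (f n ω) ∂P) atTop :=
          lintegral_liminf_le fun n => ENNReal.measurable_ofReal.comp (hf n)
      _ = 1 := by simp only [h1]; exact liminf_const 1
  have hgi : Integrable g P := by
    refine ⟨hgm, ?_⟩
    rw [hasFiniteIntegral_iff_ofReal hg0]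
    exact hle.trans_lt ENNReal.one_lt_top
  have hfi : ∀ n, Integrable (f n) P := fun n => by
    refine ⟨(hf n).aestronglyMeasurable, ?_⟩
    rw [hasFiniteIntegral_iff_ofReal (ae_of_all _ (h0 n)), h1]
    exact ENNReal.one_lt_top
  have hf2i : ∀ n, Integrable (fun ω => f n ω ^ 2) P := fun n => by
    refine ⟨((hf n).pow_const 2).aestronglyMeasurable, ?_⟩
    rw [hasFiniteIntegral_iff_ofReal (ae_of_all _ fun ω => sq_nonneg _)]
    exact (hB n).trans_lt ENNReal.ofReal_lt_top
  have hf1 : ∀ n, ∫ ω, f n ω ∂P = 1 := fun n => by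
    rw [integral_eq_lintegral_of_nonneg_ae (ae_of_all _ (h0 n)) (hf n).aestronglyMeasurable, h1]
    simp
  have hf2 : ∀ n, ∫ ω, f n ω ^ 2 ∂P ≤ max B 0 := fun n => by
    rw [integral_eq_lintegral_of_nonneg_ae (ae_of_all _ fun ω => sq_nonneg _)
      ((hf n).pow_const 2).aestronglyMeasurable]
    refine (ENNReal.toReal_mono ENNReal.ofReal_ne_top (hB n)).trans (le_of_eq ?_)
    rw [ENNReal.toReal_ofReal']
  refine ⟨hgi, le_antisymm ?_ ?_⟩
  · rw [integral_eq_lintegral_of_nonneg_ae hg0 hgm]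
    exact (ENNReal.toReal_mono ENNReal.one_ne_top hle).trans (by simp)
  -- truncation at level `A` loses at most `B / A`
  · have key : ∀ A : ℝ, 0 < A → 1 - max B 0 / A ≤ ∫ ω, g ω ∂P := fun A hA => by
      have hlim : Tendsto (fun n => ∫ ω, min (f n ω) A ∂P) atTop (𝓝 (∫ ω, min (g ω) A ∂P)) := by
        refine tendsto_integral_of_dominated_convergence (fun _ => A)
          (fun n => ((hf n).min measurable_const).aestronglyMeasurable) (integrable_const _)
          (fun n => ae_of_all _ fun ω => ?_) ?_
        · rw [Real.norm_eq_abs, abs_of_nonneg (le_min (h0 n ω) hA.le)]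
          exact min_le_right _ _
        · filter_upwards [h] with ω hω using hω.min tendsto_const_nhds
      have hmin : ∀ n, 1 - max B 0 / A ≤ ∫ ω, min (f n ω) A ∂P := fun n => by
        have hi : Integrable (fun ω => f n ω - f n ω ^ 2 / A) P := (hfi n).sub ((hf2i n).div_const A)
        have hm : Integrable (fun ω => min (f n ω) A) P := (hfi n).inf (integrable_const A)
        have h3 : ∫ ω, (f n ω - f n ω ^ 2 / A) ∂P ≤ ∫ ω, min (f n ω) A ∂P := by
          refine integral_mono hi hm fun ω => ?_
          have h4 := h0 n ω
          refine le_min ?_ ?_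
          · have : 0 ≤ f n ω ^ 2 / A := by positivity
            linarith
          · have : f n ω ^ 2 / A - f n ω + A ≥ 0 := by
              have e : f n ω ^ 2 / A - f n ω + A =
                ((f n ω - A / 2) ^ 2 + 3 / 4 * A ^ 2) / A := by field_simp; ring
              rw [e]; positivity
            linarith
        rw [integral_sub (hfi n) ((hf2i n).div_const A), integral_div, hf1] at h3
        have h5 : (∫ ω, f n ω ^ 2 ∂P) / A ≤ max B 0 / A := by gcongr; exact hf2 n
        linarith
      refine (ge_of_tendsto' hlim hmin).trans (integral_mono_ae (hgi.inf (integrable_const A)) hgi ?_)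
      exact ae_of_all _ fun ω => min_le_left _ _
    have hl : Tendsto (fun A : ℝ => 1 - max B 0 / A) atTop (𝓝 (1 - 0)) :=
      tendsto_const_nhds.sub (tendsto_const_nhds.div_atTop tendsto_id)
    rw [sub_zero] at hl
    exact le_of_tendsto hl ((eventually_gt_atTop 0).mono key)

/-- The exponential growth rate of `E[exp(-γ gain)]` at time `s` while the position is `w`: with
`c = e^{r (T - s)}` it is `-γ c w·(μ - r) + γ² c² / 2 w·(σ R σ) w`. -/
noncomputable def lossRate {d : ℕ} (m : BSMarket d) (γ s : ℝ) (w : Fin d → ℝ) : ℝ :=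
  -γ * (Real.exp (m.r * (m.T - s)) * ∑ i, w i * (m.μ s i - m.r)) +
    γ ^ 2 / 2 * Real.exp (m.r * (m.T - s)) ^ 2 * (w ⬝ᵥ ((m.σ s * m.R s * m.σ s) *ᵥ w))

theorem continuousWithinAt_lossRate {d : ℕ} {m : BSMarket d} {γ s : ℝ} {S : Set ℝ}
    {w : ℝ → Fin d → ℝ} (hμ : ContinuousWithinAt m.μ S s) (hσ : ContinuousWithinAt m.σ S s)
    (hR : ContinuousWithinAt m.R S s) (hw : ContinuousWithinAt w S s) :
    ContinuousWithinAt (fun v => lossRate m γ v (w v)) S s := by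
  have h : Continuous fun p : ((Fin d → ℝ) × (Fin d → ℝ)) ×
      (ℝ × Matrix (Fin d) (Fin d) ℝ × Matrix (Fin d) (Fin d) ℝ) =>
      -γ * (Real.exp (m.r * (m.T - p.2.1)) * ∑ i, p.1.1 i * (p.1.2 i - m.r)) +
      γ ^ 2 / 2 * Real.exp (m.r * (m.T - p.2.1)) ^ 2 *
        (p.1.1 ⬝ᵥ ((p.2.2.1 * p.2.2.2 * p.2.2.1) *ᵥ p.1.1)) := by
    fun_prop
  have hp : Tendsto (fun v => ((w v, m.μ v), (v, m.σ v, m.R v))) (𝓝[S] s)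
      (𝓝 ((w s, m.μ s), (s, m.σ s, m.R s))) :=
    (hw.tendsto.prodMk_nhds hμ.tendsto).prodMk_nhds
      ((tendsto_id.mono_left nhdsWithin_le_nhds).prodMk_nhds (hσ.tendsto.prodMk_nhds hR.tendsto))
  have key := (h.tendsto ((w s, m.μ s), (s, m.σ s, m.R s))).comp hp
  simpa only [ContinuousWithinAt, lossRate, Function.comp_def] using key

theorem BSMarket.continuousOn_cov {d : ℕ} (m : BSMarket d) :
    ContinuousOn (fun s => m.σ s * m.R s * m.σ s) (Icc 0 m.T) := by
  have h : Continuous fun p : Matrix (Fin d) (Fin d) ℝ × Matrix (Fin d) (Fin d) ℝ =>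
      p.1 * p.2 * p.1 := by fun_prop
  intro s hs
  have hp : Tendsto (fun v => (m.σ v, m.R v)) (𝓝[Icc 0 m.T] s) (𝓝 (m.σ s, m.R s)) :=
    (m.σ_cont s hs).tendsto.prodMk_nhds (m.R_cont s hs).tendsto
  have key := (h.tendsto (m.σ s, m.R s)).comp hp
  simpa only [ContinuousWithinAt, Function.comp_def] using key

theorem BSMarket.quadForm_cov {d : ℕ} (m : BSMarket d) {s : ℝ} (hs : s ∈ Icc 0 m.T)
    (w : Fin d → ℝ) :
    w ⬝ᵥ ((m.σ s * m.R s * m.σ s) *ᵥ w) = (w ᵥ* m.σ s) ⬝ᵥ (m.R s *ᵥ (w ᵥ* m.σ s)) := by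
  have hσ : (m.σ s)ᵀ = m.σ s := by simpa [Matrix.IsHermitian] using (m.σ_posDef s hs).isHermitian
  conv_rhs => enter [2, 2]; rw [← hσ, Matrix.vecMul_transpose]
  rw [← Matrix.dotProduct_mulVec, Matrix.mulVec_mulVec, Matrix.mulVec_mulVec, Matrix.mul_assoc]

section Utility

set_option linter.unusedSectionVars false

variable {Ω : Type*} {mΩ : MeasurableSpace Ω} {P : Measure Ω} [IsProbabilityMeasure P]
  {ℱ : Filtration ℝ mΩ} {d : ℕ} {m : BSMarket d} {W u : ℝ → Ω → Fin d → ℝ}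

theorem exists_lossRate_leftCont (hu : IsAdmissible ℱ m.T u) (γ : ℝ) :
    ∃ D : Set ℝ, D.Countable ∧ ∀ t ∈ Ioc 0 m.T, t ∉ D → ∀ ω,
      ContinuousWithinAt (fun s => lossRate m γ s (u s ω)) (Iic t) t := by
  obtain ⟨D, hD, hDc⟩ := hu.leftCont
  exact ⟨D, hD, fun t ht htD ω => continuousWithinAt_lossRate (m.μ_cont.leftCont_Icc ht)
    (m.σ_cont.leftCont_Icc ht) (m.R_cont.leftCont_Icc ht) (hDc t ht htD ω)⟩

theorem exists_lossRate_bound (hu : IsAdmissible ℱ m.T u) (γ : ℝ) :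
    ∃ K, ∀ s ∈ Icc 0 m.T, ∀ ω, |lossRate m γ s (u s ω)| ≤ K := by
  obtain ⟨K, hK⟩ := hu.bdd
  obtain ⟨B, hB⟩ := exists_drift_bound (m := m) hu
  obtain ⟨C, hC0, hC⟩ := exists_quadForm_bound m.continuousOn_cov
  set E := Real.exp (|m.r| * m.T)
  refine ⟨|γ| * (E * B) + γ ^ 2 / 2 * E ^ 2 * (C * (K * K)), fun s hs ω => ?_⟩
  have h1 : Real.exp (m.r * (m.T - s)) ≤ E := discount_le hs
  have h2 : |∑ i, u s ω i * (m.μ s i - m.r)| ≤ B := hB s hs ω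
  have h3 := hC s hs (u s ω) (u s ω)
  have h4 := hK s hs ω
  have hK0 := (norm_nonneg _).trans h4
  have hp := Real.exp_pos (m.r * (m.T - s))
  refine (abs_add_le _ _).trans (add_le_add ?_ ?_)
  · rw [abs_mul, abs_neg, abs_mul, abs_of_pos hp]
    gcongr
  · rw [abs_mul, abs_of_nonneg (by positivity : 0 ≤ γ ^ 2 / 2 * Real.exp (m.r * (m.T - s)) ^ 2)]
    have h5 : C * (‖u s ω‖ * ‖u s ω‖) ≤ C * (K * K) := by gcongr
    have h6 := h3.trans h5
    gcongr

theorem intervalIntegrable_lossRate (hu : IsAdmissible ℱ m.T u) (γ : ℝ) {p q : ℝ} (hp : 0 ≤ p)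
    (hpq : p ≤ q) (hq : q ≤ m.T) (ω : Ω) :
    IntervalIntegrable (fun s => lossRate m γ s (u s ω)) volume p q := by
  obtain ⟨D, hD, hDc⟩ := exists_lossRate_leftCont (m := m) hu γ
  obtain ⟨K, hK⟩ := exists_lossRate_bound (m := m) hu γ
  have hsub : Ioc p q ⊆ Ioc 0 m.T := Ioc_subset_Ioc hp hq
  exact intervalIntegrable_of_leftCont hpq hD (fun s hs hsD => hDc s (hsub hs) hsD ω)
    (fun s hs => hK s (Ioc_subset_Icc_self (hsub hs)) ω)

/-- The terminal value of the exponential martingale has expectation one: the identity holds for the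
Riemann sums, whose exponentials are bounded in `L²`, so it passes to the limit. -/
theorem integral_exp_gain (hW : IsCorrelatedBM P ℱ m.T m.R W) (hu : IsAdmissible ℱ m.T u) (γ : ℝ)
    {t : ℝ} (ht : t ∈ Ico 0 m.T) (x : ℝ) :
    Integrable (fun ω => Real.exp (-γ * gain P ℱ m W u t x ω -
      ∫ s in t..m.T, lossRate m γ s (u s ω))) P ∧
    ∫ ω, Real.exp (-γ * gain P ℱ m W u t x ω - ∫ s in t..m.T, lossRate m γ s (u s ω)) ∂P = 1 := by
  have hT := m.T_pos.le
  have hI := isItoLimit_gain m hW hu ht x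
  have hcσ : ContinuousOn (fun s => Real.exp (m.r * (m.T - s)) • m.σ s) (Icc 0 m.T) :=
    ContinuousOn.smul (f := fun s => Real.exp (m.r * (m.T - s)))
      (Continuous.continuousOn (by fun_prop)) m.σ_cont
  have hG := hu.vecMul hcσ
  set G : ℝ → Ω → Fin d → ℝ := fun s ω => u s ω ᵥ* (Real.exp (m.r * (m.T - s)) • m.σ s) with hGdef
  have hφ := hG.const_smul (-γ)
  set φ : ℝ → Ω → Fin d → ℝ := fun s ω => (-γ) • G s ω with hφdef
  obtain ⟨K, hK⟩ := hφ.bdd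
  obtain ⟨D, hD, hDc⟩ := hφ.leftCont
  obtain ⟨C, hC0, hC⟩ := exists_quadForm_bound m.R_cont
  obtain ⟨ns, hns, hae⟩ :=
    (hI.tendstoInMeasure hT hW m.R_cont m.R_posDef hG ht.1 ht.2.le le_rfl).exists_seq_tendsto_ae
  let Q : ℕ → Ω → ℝ := fun n ω => ∫ s in t..m.T,
    φ (gridFloor t m.T (n + 1) s) ω ⬝ᵥ (m.R s *ᵥ φ (gridFloor t m.T (n + 1) s) ω)
  have hQ0 : ∀ n ω, 0 ≤ Q n ω := fun n ω =>
    intervalIntegral.integral_nonneg ht.2.le fun s hs =>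
      quadForm_nonneg (m.R_posDef s ⟨ht.1.trans hs.1, hs.2⟩) _
  have hQm : ∀ n, Measurable (Q n) := fun n => by
    have e : Q n = fun ω => ∑ k ∈ Finset.range (n + 1),
        ∫ s in (t + k * (m.T - t) / (n + 1 : ℕ))..(t + (k + 1) * (m.T - t) / (n + 1 : ℕ)),
        φ (t + k * (m.T - t) / (n + 1 : ℕ)) ω ⬝ᵥ
          (m.R s *ᵥ φ (t + k * (m.T - t) / (n + 1 : ℕ)) ω) := by
      funext ω
      exact (sum_integral_grid ht.2.le n.succ_ne_zero
        (fun p s => φ p ω ⬝ᵥ (m.R s *ᵥ φ p ω)) fun p hp =>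
        intervalIntegrable_quadForm m.R_cont ht.1 ht.2.le le_rfl _ _).symm
    rw [e]
    refine Finset.measurable_sum _ fun k hk => ?_
    have hk := Finset.mem_range.1 hk
    have h1 := gridPt_mem_Icc ht.2.le hk.le
    have h2 := gridPt_mem_Icc ht.2.le (show k + 1 ≤ n + 1 from hk)
    have h3 := gridPt_mono ht.2.le (n + 1) k.le_succ
    simp only [Nat.succ_eq_add_one, Nat.cast_add k 1, Nat.cast_one] at h2 h3
    exact (continuous_integral_quadForm m.R_cont (ht.1.trans h1.1) h3 h2.2).measurable.comp
      ((hφ.adapted _ ⟨ht.1.trans h1.1, h1.2⟩).mono (ℱ.le _) le_rfl)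
  have hQlim : ∀ ω, Tendsto (fun n => Q n ω) atTop
      (𝓝 (∫ s in t..m.T, φ s ω ⬝ᵥ (m.R s *ᵥ φ s ω))) := fun ω => by
    refine intervalIntegral.tendsto_integral_filter_of_dominated_convergence (fun _ => C * (K * K))
      (Eventually.of_forall fun n => ?_) (Eventually.of_forall fun n => ae_of_all _ fun s hs => ?_)
      (by simp) ?_
    · have m1 : Measurable fun s => φ (gridFloor t m.T (n + 1) s) ω :=
        measurable_comp_gridFloor t m.T (n + 1) fun p => φ p ω
      have m2 : ∀ j l, AEStronglyMeasurable (fun s => m.R s j l) (volume.restrict (uIoc t m.T)) :=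
        fun j l => by
          rw [uIoc_of_le ht.2.le]
          have hc : Continuous fun A : Matrix (Fin d) (Fin d) ℝ => A j l := by fun_prop
          exact ((hc.comp_continuousOn m.R_cont).mono fun s hs =>
            ⟨ht.1.trans hs.1.le, hs.2⟩).aestronglyMeasurable measurableSet_Ioc
      have m3 : ∀ j, AEStronglyMeasurable (fun s => φ (gridFloor t m.T (n + 1) s) ω j)
          (volume.restrict (uIoc t m.T)) := fun j =>
        ((measurable_pi_apply j).comp m1).aestronglyMeasurable
      simp only [dotProduct, Matrix.mulVec]
      exact Finset.aestronglyMeasurable_fun_sum _ fun j _ =>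
        (m3 j).mul (Finset.aestronglyMeasurable_fun_sum _ fun l _ => (m2 j l).mul (m3 l))
    · rw [uIoc_of_le ht.2.le] at hs
      have h1 := gridFloor_mem_Icc ht.2 (Ioc_subset_Icc_self hs) (n + 1)
      have h2 := hK _ ⟨ht.1.trans h1.1, h1.2⟩ ω
      have h0 := (norm_nonneg _).trans h2
      refine (hC s ⟨ht.1.trans hs.1.le, hs.2⟩ _ _).trans ?_
      gcongr
    · filter_upwards [hD.ae_notMem volume] with s hsD hs
      rw [uIoc_of_le ht.2.le] at hs
      have h1 := (tendsto_comp_gridFloor ht.2 hs.1.le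
        (hDc s ⟨ht.1.trans_lt hs.1, hs.2⟩ hsD ω)).comp (tendsto_add_atTop_nat 1)
      have hc : Continuous fun y : Fin d → ℝ => y ⬝ᵥ (m.R s *ᵥ y) := by fun_prop
      exact (hc.tendsto _).comp h1
  have hSm : ∀ n, Measurable (itoSum φ W t m.T (n + 1)) := fun n =>
    (simpleInt_itoSum (W := W) hφ ht.1 ht.2.le le_rfl n.succ_ne_zero).measurable hW
  have key := integral_eq_one_of_tendsto_of_sq_le (P := P)
    (f := fun i ω => Real.exp (itoSum φ W t m.T (ns i + 1) ω - 1 / 2 * Q (ns i) ω))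
    (g := fun ω => Real.exp (-γ * gain P ℱ m W u t x ω - ∫ s in t..m.T, lossRate m γ s (u s ω)))
    (B := Real.exp (1 / 2 * (C * (|(2 : ℝ)| * K) ^ 2 * (m.T - t))))
    (fun n ω => (Real.exp_pos _).le)
    (fun i => Real.measurable_exp.comp ((hSm _).sub ((hQm _).const_mul _)))
    (fun i => lintegral_exp_itoSum hW m.R_cont m.R_posDef hφ ht.1 ht.2.le le_rfl (Nat.succ_ne_zero _))
    (fun i => ?_) ?_
  · exact key
  · refine le_trans (lintegral_mono fun ω => ENNReal.ofReal_le_ofReal ?_)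
      (lintegral_exp_itoSum_le hW m.R_cont m.R_posDef (hφ.const_smul 2) hC0 hC
        (K := |(2 : ℝ)| * K) (fun s hs ω => ?_) ht.1 ht.2.le le_rfl (n := ns i + 1) (Nat.succ_ne_zero _))
    · rw [← Real.exp_nat_mul, itoSum_const_smul (H := φ) 2]
      refine Real.exp_le_exp.2 ?_
      have := hQ0 (ns i) ω
      push_cast
      linarith
    · rw [norm_smul]
      exact mul_le_mul_of_nonneg_left (hK s hs ω) (abs_nonneg _)
  · filter_upwards [hae] with ω hω
    have h1 := (hω.const_mul (-γ)).sub (((hQlim ω).comp hns.tendsto_atTop).const_mul (1 / 2))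
    have e : -γ * gain P ℱ m W u t x ω - ∫ s in t..m.T, lossRate m γ s (u s ω) =
        -γ * (gain P ℱ m W u t x ω - ∫ s in t..m.T, Real.exp (m.r * (m.T - s)) * drift m u s ω) -
        1 / 2 * ∫ s in t..m.T, φ s ω ⬝ᵥ (m.R s *ᵥ φ s ω) := by
      have hd : IntervalIntegrable (fun s => Real.exp (m.r * (m.T - s)) * drift m u s ω) volume
          t m.T := (intervalIntegrable_drift hu ht.1 ht.2.le le_rfl ω).continuousOn_mul
            (Continuous.continuousOn (by fun_prop))
      have hl := intervalIntegrable_lossRate hu γ ht.1 ht.2.le le_rfl ω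
      have e2 : ∫ s in t..m.T, φ s ω ⬝ᵥ (m.R s *ᵥ φ s ω) =
          ∫ s in t..m.T, (2 * lossRate m γ s (u s ω) +
            2 * γ * (Real.exp (m.r * (m.T - s)) * drift m u s ω)) := by
        refine intervalIntegral.integral_congr fun s hs => ?_
        rw [uIcc_of_le ht.2.le] at hs
        simp only [hφdef, hGdef, lossRate, drift, m.quadForm_cov ⟨ht.1.trans hs.1, hs.2⟩,
          Matrix.vecMul_smul, Matrix.mulVec_smul, smul_dotProduct, dotProduct_smul, smul_eq_mul]
        ring
      rw [e2, intervalIntegral.integral_add (hl.const_mul 2) (hd.const_mul (2 * γ)),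
        intervalIntegral.integral_const_mul, intervalIntegral.integral_const_mul]
      ring
    rw [e]
    refine (Real.continuous_exp.tendsto _).comp (h1.congr fun i => ?_)
    rw [Function.comp_apply, itoSum_const_smul]

theorem aestronglyMeasurable_gain (hW : IsCorrelatedBM P ℱ m.T m.R W) (hu : IsAdmissible ℱ m.T u)
    {t : ℝ} (ht : t ∈ Ico 0 m.T) (x : ℝ) : AEStronglyMeasurable (gain P ℱ m W u t x) P :=
  (((wealth_spec m hW hu ht x).adapted m.T ⟨ht.2.le, le_rfl⟩).mono (ℱ.le _)).sub
    aestronglyMeasurable_const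

theorem integrable_exp_neg_gain (hW : IsCorrelatedBM P ℱ m.T m.R W) (hu : IsAdmissible ℱ m.T u)
    (γ : ℝ) {t : ℝ} (ht : t ∈ Ico 0 m.T) (x : ℝ) :
    Integrable (fun ω => Real.exp (-γ * gain P ℱ m W u t x ω)) P := by
  obtain ⟨K, hK⟩ := exists_lossRate_bound hu γ
  refine Integrable.mono' ((integral_exp_gain hW hu γ ht x).1.mul_const (Real.exp (K * (m.T - t))))
    (Real.continuous_exp.comp_aestronglyMeasurable
      ((aestronglyMeasurable_gain hW hu ht x).const_mul _)) (ae_of_all _ fun ω => ?_)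
  rw [Real.norm_eq_abs, abs_of_pos (Real.exp_pos _), ← Real.exp_add]
  refine Real.exp_le_exp.2 ?_
  have h := intervalIntegral.norm_integral_le_of_norm_le_const (a := t) (b := m.T)
    (f := fun s => lossRate m γ s (u s ω)) (C := K) (fun s hs => by
      rw [uIoc_of_le ht.2.le] at hs
      exact hK s ⟨ht.1.trans hs.1.le, hs.2⟩ ω)
  rw [abs_of_nonneg (sub_nonneg.2 ht.2.le)] at h
  linarith [le_abs_self (∫ s in t..m.T, lossRate m γ s (u s ω)), h,
    Real.norm_eq_abs (∫ s in t..m.T, lossRate m γ s (u s ω))]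

theorem valueJ_expTarget (hW : IsCorrelatedBM P ℱ m.T m.R W) (hu : IsAdmissible ℱ m.T u)
    (β γ : ℝ) (lam : ℝ → ℝ) (ρ : Measure ℝ → ℝ) {t : ℝ} (ht : t ∈ Ico 0 m.T) (x : ℝ) :
    valueJ P ℱ m W (expTarget β γ) lam (fun _ => 0) ρ t x u =
      1 / β * (1 - ∫ ω, Real.exp (-γ * gain P ℱ m W u t x ω) ∂P) := by
  unfold valueJ expTarget
  rw [integral_const_mul, integral_sub (integrable_const _) (integrable_exp_neg_gain hW hu γ ht x)]
  simp

/-- If the loss rate of `u` dominates a deterministic rate, so does the expected exponential loss. -/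
theorem exp_integral_le_of_lossRate_le (hW : IsCorrelatedBM P ℱ m.T m.R W)
    (hu : IsAdmissible ℱ m.T u) (γ : ℝ) {t : ℝ} (ht : t ∈ Ico 0 m.T) (x : ℝ) {a : ℝ → ℝ}
    (ha : IntervalIntegrable a volume t m.T)
    (h : ∀ s ∈ Ioc t m.T, ∀ ω, a s ≤ lossRate m γ s (u s ω)) :
    Real.exp (∫ s in t..m.T, a s) ≤ ∫ ω, Real.exp (-γ * gain P ℱ m W u t x ω) ∂P := by
  obtain ⟨hi, h1⟩ := integral_exp_gain hW hu γ ht x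
  calc Real.exp (∫ s in t..m.T, a s) = ∫ ω, Real.exp (-γ * gain P ℱ m W u t x ω -
        ∫ s in t..m.T, lossRate m γ s (u s ω)) * Real.exp (∫ s in t..m.T, a s) ∂P := by
        rw [integral_mul_const, h1, one_mul]
    _ ≤ _ := by
        refine integral_mono (hi.mul_const _) (integrable_exp_neg_gain hW hu γ ht x) fun ω => ?_
        simp only [← Real.exp_add]
        refine Real.exp_le_exp.2 ?_
        have : ∫ s in t..m.T, a s ≤ ∫ s in t..m.T, lossRate m γ s (u s ω) := by
          refine intervalIntegral.integral_mono_on_of_le_Ioo ht.2.le ha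
            (intervalIntegrable_lossRate hu γ ht.1 ht.2.le le_rfl ω) fun s hs => ?_
          exact h s (Ioo_subset_Ioc_self hs) ω
        linarith

/-- For a deterministic control the exponent `∫ lossRate` comes out of the expectation. -/
theorem integral_exp_gain_of_deterministic (hW : IsCorrelatedBM P ℱ m.T m.R W)
    {v : ℝ → Fin d → ℝ} (hv : IsAdmissible ℱ m.T (detControl Ω v)) (γ : ℝ) {t : ℝ}
    (ht : t ∈ Ico 0 m.T) (x : ℝ) :
    ∫ ω, Real.exp (-γ * gain P ℱ m W (detControl Ω v) t x ω) ∂P =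
      Real.exp (∫ s in t..m.T, lossRate m γ s (v s)) := by
  have h1 := (integral_exp_gain hW hv γ ht x).2
  simp only [detControl, sub_eq_add_neg, Real.exp_add] at h1
  rw [integral_mul_const, Real.exp_neg] at h1
  have := Real.exp_pos (∫ s in t..m.T, lossRate m γ s (v s))
  field_simp at h1
  simpa only [neg_mul] using h1

end Utility

/-! ### The linear system and the minimizer of the loss rate -/

section System

variable {d : ℕ} (m : BSMarket d)

theorem BSMarket.posDef_cov {s : ℝ} (hs : s ∈ Icc 0 m.T) : (m.σ s * m.R s * m.σ s).PosDef := by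
  have h := (m.R_posDef s hs).conjTranspose_mul_mul_same
    (Matrix.mulVec_injective_of_isUnit (m.σ_posDef s hs).isUnit)
  rwa [(m.σ_posDef s hs).isHermitian.eq] at h

theorem BSMarket.cov_comm {s : ℝ} (hs : s ∈ Icc 0 m.T) (i k : Fin d) :
    (m.σ s * m.R s * m.σ s) i k = (m.σ s * m.R s * m.σ s) k i := by
  simpa using ((m.posDef_cov hs).isHermitian.apply i k).symm

variable {m} {γ s : ℝ}

/-- The system is the first-order condition `γ c (σ R σ) w = μ - r` with `c = e^{r (T - s)}`. -/
theorem solvesSystem_iff (hγ : 0 < γ) (hs : s ∈ Icc 0 m.T) (w : Fin d → ℝ) :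
    SolvesSystem m γ s w ↔ ∀ k, γ * Real.exp (m.r * (m.T - s)) *
      ((m.σ s * m.R s * m.σ s) *ᵥ w) k = m.μ s k - m.r := by
  refine forall_congr' fun k => ?_
  have hA : 0 < (m.σ s * m.R s * m.σ s) k k := (m.posDef_cov hs).diag_pos
  have hc := Real.exp_pos (m.r * (m.T - s))
  have e2 : Real.exp (2 * m.r * (m.T - s)) = Real.exp (m.r * (m.T - s)) ^ 2 := by
    rw [← Real.exp_nat_mul]; congr 1; push_cast; ring
  have e3 : ((m.σ s * m.R s * m.σ s) *ᵥ w) k = (m.σ s * m.R s * m.σ s) k k * w k +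
      ∑ i ∈ Finset.univ.erase k, w i * (m.σ s * m.R s * m.σ s) i k := by
    rw [Matrix.mulVec, dotProduct, ← Finset.add_sum_erase _ _ (Finset.mem_univ k)]
    congr 1
    exact Finset.sum_congr rfl fun i _ => by rw [m.cov_comm hs k i, mul_comm]
  rw [e2, ← Finset.sum_mul, e3, eq_div_iff (by positivity)]
  set c := Real.exp (m.r * (m.T - s))
  constructor
  · intro h
    refine mul_right_cancel₀ hc.ne' ?_
    linear_combination h
  · intro h
    linear_combination c * h

/-- The solution `(γ c)⁻¹ (σ R σ)⁻¹ (μ - r)` of the system, with `c = e^{r (T - s)}`. -/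
noncomputable def systemSolution {d : ℕ} (m : BSMarket d) (γ s : ℝ) : Fin d → ℝ :=
  (γ * Real.exp (m.r * (m.T - s)))⁻¹ • ((m.σ s * m.R s * m.σ s)⁻¹ *ᵥ fun k => m.μ s k - m.r)

theorem solvesSystem_systemSolution (hγ : 0 < γ) (hs : s ∈ Icc 0 m.T) :
    SolvesSystem m γ s (systemSolution m γ s) := by
  rw [solvesSystem_iff hγ hs]
  intro k
  have hc := Real.exp_pos (m.r * (m.T - s))
  rw [systemSolution, Matrix.mulVec_smul, Matrix.mulVec_mulVec, Matrix.mul_nonsing_inv _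
    ((Matrix.isUnit_iff_isUnit_det _).1 (m.posDef_cov hs).isUnit), Matrix.one_mulVec, Pi.smul_apply,
    smul_eq_mul]
  field_simp

/-- Second-order expansion of the (quadratic) loss rate. -/
theorem lossRate_add (hs : s ∈ Icc 0 m.T) (w z : Fin d → ℝ) :
    lossRate m γ s (w + z) = lossRate m γ s w +
      γ * Real.exp (m.r * (m.T - s)) * (z ⬝ᵥ fun k => γ * Real.exp (m.r * (m.T - s)) *
        ((m.σ s * m.R s * m.σ s) *ᵥ w) k - (m.μ s k - m.r)) +
      γ ^ 2 / 2 * Real.exp (m.r * (m.T - s)) ^ 2 * (z ⬝ᵥ ((m.σ s * m.R s * m.σ s) *ᵥ z)) := by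
  have h1 : w ⬝ᵥ ((m.σ s * m.R s * m.σ s) *ᵥ z) = z ⬝ᵥ ((m.σ s * m.R s * m.σ s) *ᵥ w) := by
    have hA : (m.σ s * m.R s * m.σ s)ᵀ = m.σ s * m.R s * m.σ s := by
      ext i k; exact m.cov_comm hs k i
    rw [Matrix.dotProduct_mulVec, dotProduct_comm, ← Matrix.mulVec_transpose, hA]
  have h2 : (z ⬝ᵥ fun k => γ * Real.exp (m.r * (m.T - s)) *
        ((m.σ s * m.R s * m.σ s) *ᵥ w) k - (m.μ s k - m.r)) =
      γ * Real.exp (m.r * (m.T - s)) * (z ⬝ᵥ ((m.σ s * m.R s * m.σ s) *ᵥ w)) -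
        ∑ i, z i * (m.μ s i - m.r) := by
    simp only [dotProduct, mul_sub, Finset.sum_sub_distrib, Finset.mul_sum]
    congr 1
    · exact Finset.sum_congr rfl fun i _ => by ring
  rw [h2]
  simp only [lossRate, Matrix.mulVec_add, dotProduct_add, add_dotProduct, h1, Pi.add_apply, add_mul,
    Finset.sum_add_distrib]
  ring

theorem lossRate_of_solvesSystem (hγ : 0 < γ) (hs : s ∈ Icc 0 m.T) {v : Fin d → ℝ}
    (hv : SolvesSystem m γ s v) (w : Fin d → ℝ) :
    lossRate m γ s w = lossRate m γ s v + γ ^ 2 / 2 * Real.exp (m.r * (m.T - s)) ^ 2 *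
      ((w - v) ⬝ᵥ ((m.σ s * m.R s * m.σ s) *ᵥ (w - v))) := by
  have h := lossRate_add (γ := γ) hs v (w - v)
  rw [solvesSystem_iff hγ hs] at hv
  simpa [hv, dotProduct] using h

theorem lossRate_le_of_solvesSystem (hγ : 0 < γ) (hs : s ∈ Icc 0 m.T) {v : Fin d → ℝ}
    (hv : SolvesSystem m γ s v) (w : Fin d → ℝ) : lossRate m γ s v ≤ lossRate m γ s w := by
  rw [lossRate_of_solvesSystem hγ hs hv w]
  have := quadForm_nonneg (m.posDef_cov hs) (w - v)
  have : 0 ≤ γ ^ 2 / 2 * Real.exp (m.r * (m.T - s)) ^ 2 *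
      ((w - v) ⬝ᵥ ((m.σ s * m.R s * m.σ s) *ᵥ (w - v))) := by positivity
  linarith

theorem eq_of_solvesSystem_of_lossRate_le (hγ : 0 < γ) (hs : s ∈ Icc 0 m.T) {v w : Fin d → ℝ}
    (hv : SolvesSystem m γ s v) (hw : lossRate m γ s w ≤ lossRate m γ s v) : w = v := by
  by_contra hne
  rw [lossRate_of_solvesSystem hγ hs hv w] at hw
  have h0 : w - v ≠ 0 := sub_ne_zero.2 hne
  have := (m.posDef_cov hs).dotProduct_mulVec_pos h0
  rw [star_trivial] at this
  have hc := Real.exp_pos (m.r * (m.T - s))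
  have : 0 < γ ^ 2 / 2 * Real.exp (m.r * (m.T - s)) ^ 2 *
      ((w - v) ⬝ᵥ ((m.σ s * m.R s * m.σ s) *ᵥ (w - v))) := by positivity
  linarith

theorem existsUnique_solvesSystem (hγ : 0 < γ) (hs : s ∈ Icc 0 m.T) :
    ∃! w : Fin d → ℝ, SolvesSystem m γ s w :=
  ⟨_, solvesSystem_systemSolution hγ hs, fun _ hw =>
    eq_of_solvesSystem_of_lossRate_le hγ hs (solvesSystem_systemSolution hγ hs)
      (lossRate_le_of_solvesSystem hγ hs hw _)⟩

/-- A minimizer over the cube `[-M, M]^d` in the interior of the cube satisfies the first-order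
condition. -/
theorem solvesSystem_of_minimizer (hγ : 0 < γ) (hs : s ∈ Icc 0 m.T) {M : ℝ} {v : Fin d → ℝ}
    (hv : ∀ k, |v k| < M)
    (hmin : ∀ w : Fin d → ℝ, (∀ k, |w k| ≤ M) → lossRate m γ s v ≤ lossRate m γ s w) :
    SolvesSystem m γ s v := by
  rw [solvesSystem_iff hγ hs]
  intro k
  have hc := Real.exp_pos (m.r * (m.T - s))
  set g := γ * Real.exp (m.r * (m.T - s)) * ((m.σ s * m.R s * m.σ s) *ᵥ v) k - (m.μ s k - m.r)
    with hg
  set A := (m.σ s * m.R s * m.σ s) k k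
  have hexp : ∀ ε : ℝ, lossRate m γ s (v + Pi.single k ε) = lossRate m γ s v +
      γ * Real.exp (m.r * (m.T - s)) * (ε * g) +
      γ ^ 2 / 2 * Real.exp (m.r * (m.T - s)) ^ 2 * (ε * (A * ε)) := fun ε => by
    rw [lossRate_add hs, single_dotProduct, single_dotProduct, Matrix.mulVec_single]
    simp [A, hg]
  have hloc : IsLocalMin (fun ε : ℝ => lossRate m γ s v +
      γ * Real.exp (m.r * (m.T - s)) * (ε * g) +
      γ ^ 2 / 2 * Real.exp (m.r * (m.T - s)) ^ 2 * (ε * (A * ε))) 0 := by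
    have hev : ∀ᶠ ε : ℝ in 𝓝 0, |v k + ε| < M := by
      have : Tendsto (fun ε : ℝ => |v k + ε|) (𝓝 0) (𝓝 |v k + 0|) :=
        Continuous.tendsto (by fun_prop) 0
      rw [add_zero] at this
      exact this.eventually_lt_const (hv k)
    filter_upwards [hev] with ε hε
    rw [← hexp ε]
    simp only [zero_mul, mul_zero, add_zero]
    refine hmin _ fun i => ?_
    by_cases hi : i = k
    · subst hi; simpa using hε.le
    · simpa [hi] using (hv i).le
  have hd : HasDerivAt (fun ε : ℝ => lossRate m γ s v +
      γ * Real.exp (m.r * (m.T - s)) * (ε * g) +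
      γ ^ 2 / 2 * Real.exp (m.r * (m.T - s)) ^ 2 * (ε * (A * ε)))
      (γ * Real.exp (m.r * (m.T - s)) * g) 0 := by
    have h1 := (((hasDerivAt_id (0 : ℝ)).mul_const g).const_mul
      (γ * Real.exp (m.r * (m.T - s)))).const_add (lossRate m γ s v)
    have h2 := (((hasDerivAt_id (0 : ℝ)).mul ((hasDerivAt_id (0 : ℝ)).const_mul A)).const_mul
      (γ ^ 2 / 2 * Real.exp (m.r * (m.T - s)) ^ 2))
    exact (h1.add h2).congr_deriv (by simp)
  have h0 := hloc.hasDerivAt_eq_zero hd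
  have : g = 0 := by
    rcases mul_eq_zero.1 h0 with h | h
    · exact absurd h (by positivity)
    · exact h
  linarith

theorem continuousOn_systemSolution (m : BSMarket d) (hγ : 0 < γ) :
    ContinuousOn (fun s => systemSolution m γ s) (Icc 0 m.T) := by
  have hA := m.continuousOn_cov
  have hinv : ContinuousOn (fun s => (m.σ s * m.R s * m.σ s)⁻¹) (Icc 0 m.T) := by
    have hdet : Continuous fun B : Matrix (Fin d) (Fin d) ℝ => B.det := by fun_prop
    have hadj : Continuous fun B : Matrix (Fin d) (Fin d) ℝ => B.adjugate := by fun_prop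
    simp only [Matrix.inv_def, Ring.inverse_eq_inv']
    exact ((hdet.comp_continuousOn hA).inv₀ fun s hs => (m.posDef_cov hs).det_pos.ne').smul
      (hadj.comp_continuousOn hA)
  have hb : ContinuousOn (fun s k => m.μ s k - m.r) (Icc 0 m.T) :=
    continuousOn_pi.2 fun k => ((continuous_apply k).comp_continuousOn m.μ_cont).sub
      continuousOn_const
  intro s hs
  have hc : ContinuousWithinAt (fun v => (γ * Real.exp (m.r * (m.T - v)))⁻¹) (Icc 0 m.T) s :=
    ContinuousWithinAt.inv₀ (Continuous.continuousWithinAt (by fun_prop))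
      (by have := Real.exp_pos (m.r * (m.T - s)); positivity)
  have h : Continuous fun p : ℝ × Matrix (Fin d) (Fin d) ℝ × (Fin d → ℝ) => p.1 • (p.2.1 *ᵥ p.2.2) :=
    by fun_prop
  have hp := hc.tendsto.prodMk_nhds ((hinv s hs).tendsto.prodMk_nhds (hb s hs).tendsto)
  have key := (h.tendsto _).comp hp
  simpa only [ContinuousWithinAt, systemSolution, Function.comp_def] using key

end System

/-! ### Equilibrium controls -/

section Equilibrium

set_option linter.unusedSectionVars false

variable {Ω : Type*} {mΩ : MeasurableSpace Ω} {P : Measure Ω} [IsProbabilityMeasure P]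
  {ℱ : Filtration ℝ mΩ} {d : ℕ} {m : BSMarket d} {W : ℝ → Ω → Fin d → ℝ}

theorem IsControl.norm_le {T M : ℝ} (hM : 0 ≤ M) {u : ℝ → Ω → Fin d → ℝ} (hu : IsControl ℱ T M u)
    {t : ℝ} (ht : t ∈ Icc 0 T) (ω : Ω) : ‖u t ω‖ ≤ M :=
  (pi_norm_le_iff_of_nonneg hM).2 fun i => hu.bdd ω t ht i

theorem IsControl.isAdmissible {T M : ℝ} (hM : 0 ≤ M) {u : ℝ → Ω → Fin d → ℝ}
    (hu : IsControl ℱ T M u) : IsAdmissible ℱ T u :=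
  ⟨hu.adapted, ⟨M, fun _ ht ω => hu.norm_le hM ht ω⟩,
    ∅, countable_empty, fun t ht _ ω => hu.leftCont ω t ht⟩

/-- A deviation is in general not left-continuous at the two switching times. -/
theorem IsControl.isAdmissible_deviate {T M : ℝ} (hM : 0 ≤ M) {v u : ℝ → Ω → Fin d → ℝ}
    (hv : IsControl ℱ T M v) (hu : IsControl ℱ T M u) (t h : ℝ) :
    IsAdmissible ℱ T (deviate v u t h) := by
  refine ⟨fun s hs => ?_, ⟨M, fun s hs ω => ?_⟩, {t, t + h}, (countable_singleton _).insert _,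
    fun s hs hsD ω => ?_⟩
  · unfold deviate
    split_ifs
    exacts [hu.adapted s hs, hv.adapted s hs]
  · unfold deviate
    split_ifs
    exacts [hu.norm_le hM hs ω, hv.norm_le hM hs ω]
  · simp only [mem_insert_iff, mem_singleton_iff, not_or] at hsD
    by_cases hc : t ≤ s ∧ s < t + h
    · refine (hu.leftCont ω s hs).congr_of_eventuallyEq ?_ (by simp [deviate, hc])
      have h1 : ∀ᶠ p in 𝓝 s, t < p := lt_mem_nhds (lt_of_le_of_ne hc.1 (Ne.symm hsD.1))
      have h2 : ∀ᶠ p in 𝓝 s, p < t + h := gt_mem_nhds hc.2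
      filter_upwards [nhdsWithin_le_nhds h1, nhdsWithin_le_nhds h2] with p hp1 hp2
      simp [deviate, hp1.le, hp2]
    · refine (hv.leftCont ω s hs).congr_of_eventuallyEq ?_ (by simp only [deviate, if_neg hc])
      rcases lt_or_ge s t with h1 | h1
      · filter_upwards [nhdsWithin_le_nhds (gt_mem_nhds h1)] with p hp
        simp only [deviate, if_neg fun H : t ≤ p ∧ p < t + h => absurd hp (not_lt.2 H.1)]
      · have h2 : t + h < s := lt_of_le_of_ne (not_lt.1 fun H => hc ⟨h1, H⟩) (Ne.symm hsD.2)
        filter_upwards [nhdsWithin_le_nhds (lt_mem_nhds h2)] with p hp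
        simp only [deviate, if_neg fun H : t ≤ p ∧ p < t + h => lt_asymm hp H.2]

theorem valueJ_sub_valueJ (hW : IsCorrelatedBM P ℱ m.T m.R W) {u u' : ℝ → Ω → Fin d → ℝ}
    (hu : IsAdmissible ℱ m.T u) (hu' : IsAdmissible ℱ m.T u')
    (β γ : ℝ) (lam : ℝ → ℝ) (ρ : Measure ℝ → ℝ) {t : ℝ} (ht : t ∈ Ico 0 m.T) (x : ℝ) :
    valueJ P ℱ m W (expTarget β γ) lam (fun _ => 0) ρ t x u -
      valueJ P ℱ m W (expTarget β γ) lam (fun _ => 0) ρ t x u' =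
    1 / β * (∫ ω, Real.exp (-γ * gain P ℱ m W u' t x ω) ∂P -
      ∫ ω, Real.exp (-γ * gain P ℱ m W u t x ω) ∂P) := by
  rw [valueJ_expTarget hW hu β γ lam ρ ht x, valueJ_expTarget hW hu' β γ lam ρ ht x]
  ring

/-- A control that minimizes the loss rate at each time is an equilibrium: it beats every deviation,
not only to first order. -/
theorem isNashEquilibrium_of_solvesSystem (hW : IsCorrelatedBM P ℱ m.T m.R W) {M β γ : ℝ}
    (hM : 0 < M) (hβ : 0 < β) (hγ : 0 < γ) (lam : ℝ → ℝ) (ρ : Measure ℝ → ℝ) {v : ℝ → Fin d → ℝ}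
    (hv : IsControl ℱ m.T M (detControl Ω v)) (hsol : ∀ t ∈ Ioc 0 m.T, SolvesSystem m γ t (v t)) :
    IsNashEquilibrium P ℱ m M W (expTarget β γ) lam (fun _ => 0) ρ (detControl Ω v) := by
  obtain ⟨ω₀⟩ := nonempty_of_isProbabilityMeasure P
  refine ⟨hv, fun t ht x u hu => ?_⟩
  refine le_liminf_of_le (by isBoundedDefault) ?_
  filter_upwards [self_mem_nhdsWithin] with h hh
  have hva := hv.isAdmissible hM.le
  have hda := hv.isAdmissible_deviate hM.le hu t h
  rw [valueJ_sub_valueJ hW hva hda β γ lam ρ ht x,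
    integral_exp_gain_of_deterministic hW hva γ ht x]
  have key := exp_integral_le_of_lossRate_le hW hda γ ht x
    (intervalIntegrable_lossRate hva γ ht.1 ht.2.le le_rfl ω₀) fun s hs ω =>
    lossRate_le_of_solvesSystem hγ ⟨ht.1.trans hs.1.le, hs.2⟩
      (hsol s ⟨ht.1.trans_lt hs.1, hs.2⟩) _
  have hh : (0 : ℝ) < h := hh
  have h1 := sub_nonneg.2 key
  have : 0 ≤ 1 / β * (∫ ω, Real.exp (-γ * gain P ℱ m W (deviate (detControl Ω v) u t h) t x ω) ∂P -
      Real.exp (∫ s in t..m.T, lossRate m γ s (v s))) / h :=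
    div_nonneg (mul_nonneg (by positivity) h1) hh.le
  exact_mod_cast this

theorem isControl_const {T M : ℝ} {w : Fin d → ℝ} (hw : ∀ k, |w k| ≤ M) :
    IsControl ℱ T M (detControl Ω fun _ => w) :=
  ⟨fun _ _ => measurable_const, fun _ _ _ => continuousWithinAt_const,
    fun _ _ _ => ⟨w, tendsto_const_nhds⟩, fun _ _ _ k => hw k⟩

/-- Deviating to a constant position on `[t, t + h)` changes the exponent of the expected loss by the
integral of the difference of the loss rates. -/
theorem integral_lossRate_deviate {v : ℝ → Fin d → ℝ} {γ t h : ℝ} (w : Fin d → ℝ) (hh : 0 ≤ h)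
    (hhT : t + h ≤ m.T) (hvi : IntervalIntegrable (fun s => lossRate m γ s (v s)) volume t m.T)
    (hwi : IntervalIntegrable (fun s => lossRate m γ s w) volume t m.T) :
    ∫ s in t..m.T, lossRate m γ s (if t ≤ s ∧ s < t + h then w else v s) =
      (∫ s in t..m.T, lossRate m γ s (v s)) +
        ∫ s in t..(t + h), (lossRate m γ s w - lossRate m γ s (v s)) := by
  have hth : t ≤ t + h := by linarith
  -- the integrands differ at `t + h`, where the deviation has ended already
  have hne : ∀ᵐ s : ℝ, s ≠ t + h := by simp [ae_iff]
  have s1 : uIcc t (t + h) ⊆ uIcc t m.T := by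
    rw [uIcc_of_le hth, uIcc_of_le (hth.trans hhT)]; exact Icc_subset_Icc_right hhT
  have s2 : uIcc (t + h) m.T ⊆ uIcc t m.T := by
    rw [uIcc_of_le hhT, uIcc_of_le (hth.trans hhT)]; exact Icc_subset_Icc_left hth
  have e1 : ∀ᵐ s : ℝ, s ∈ uIoc t (t + h) → lossRate m γ s w =
      lossRate m γ s (if t ≤ s ∧ s < t + h then w else v s) := by
    filter_upwards [hne] with s hs hs'
    rw [uIoc_of_le hth] at hs'
    rw [if_pos ⟨hs'.1.le, lt_of_le_of_ne hs'.2 hs⟩]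
  have e2 : ∀ s ∈ uIoc (t + h) m.T, lossRate m γ s (v s) =
      lossRate m γ s (if t ≤ s ∧ s < t + h then w else v s) := fun s hs => by
    rw [uIoc_of_le hhT] at hs
    rw [if_neg fun H => lt_asymm H.2 hs.1]
  have i1 := (hwi.mono_set s1).congr_ae ((ae_restrict_iff' measurableSet_uIoc).2 e1)
  have i2 := (hvi.mono_set s2).congr e2
  rw [← intervalIntegral.integral_add_adjacent_intervals i1 i2,
    ← intervalIntegral.integral_add_adjacent_intervals (hvi.mono_set s1) (hvi.mono_set s2),
    intervalIntegral.integral_sub (hwi.mono_set s1) (hvi.mono_set s1),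
    ← intervalIntegral.integral_congr_ae e1,
    ← intervalIntegral.integral_congr_ae (ae_of_all _ e2)]
  ring

/-- The first-order condition for an equilibrium: for a deviation to a constant `w` the lower limit
in the definition is a limit, equal to a positive multiple of the right limit `ℓ` of the difference
of the loss rates. -/
theorem lossRate_rightLim_le (hW : IsCorrelatedBM P ℱ m.T m.R W) {M β γ : ℝ}
    (hM : 0 < M) (hβ : 0 < β) {lam : ℝ → ℝ} {ρ : Measure ℝ → ℝ} {v : ℝ → Fin d → ℝ}
    (hv : IsNashEquilibrium P ℱ m M W (expTarget β γ) lam (fun _ => 0) ρ (detControl Ω v))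
    {t : ℝ} (ht : t ∈ Ico 0 m.T) {w : Fin d → ℝ} (hw : ∀ k, |w k| ≤ M) {ℓ : ℝ}
    (hℓ : Tendsto (fun s => lossRate m γ s w - lossRate m γ s (v s)) (𝓝[>] t) (𝓝 ℓ)) : 0 ≤ ℓ := by
  obtain ⟨ω₀⟩ := nonempty_of_isProbabilityMeasure P
  have hwc : IsControl ℱ m.T M (detControl Ω fun _ => w) := isControl_const hw
  have hva := hv.1.isAdmissible hM.le
  have hvi : IntervalIntegrable (fun s => lossRate m γ s (v s)) volume t m.T :=
    intervalIntegrable_lossRate hva γ ht.1 ht.2.le le_rfl ω₀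
  have hwi : IntervalIntegrable (fun s => lossRate m γ s w) volume t m.T :=
    intervalIntegrable_lossRate (hwc.isAdmissible hM.le) γ ht.1 ht.2.le le_rfl ω₀
  set A := ∫ s in t..m.T, lossRate m γ s (v s) with hA
  set F : ℝ → ℝ := fun s => lossRate m γ s w - lossRate m γ s (v s) with hF
  have hFi : IntervalIntegrable F volume t m.T := hwi.sub hvi
  have hmeas : StronglyMeasurableAtFilter F (𝓝[>] t) volume :=
    ⟨Ioc t m.T, Ioc_mem_nhdsGT ht.2, ((intervalIntegrable_iff_integrableOn_Ioc_of_le ht.2.le).1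
      hFi).aestronglyMeasurable⟩
  have hd : HasDerivWithinAt (fun p => ∫ s in t..p, F s) ℓ (Ici t) t :=
    intervalIntegral.integral_hasDerivWithinAt_of_tendsto_ae_right IntervalIntegrable.refl
      hmeas (hℓ.mono_left inf_le_left)
  have hd2 : HasDerivWithinAt (fun p => Real.exp (A + ∫ s in t..p, F s)) (Real.exp A * ℓ) (Ioi t) t := by
    have := ((hd.const_add A).exp).Ioi_of_Ici
    simpa using this
  have hs := (hasDerivWithinAt_iff_tendsto_slope' self_notMem_Ioi).1 hd2
  have hshift : Tendsto (fun h : ℝ => t + h) (𝓝[>] 0) (𝓝[>] t) := by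
    refine tendsto_nhdsWithin_iff.2 ⟨?_, ?_⟩
    · have : Tendsto (fun h : ℝ => t + h) (𝓝 0) (𝓝 (t + 0)) := Continuous.tendsto (by fun_prop) 0
      rw [add_zero] at this
      exact this.mono_left nhdsWithin_le_nhds
    · filter_upwards [self_mem_nhdsWithin] with h hh
      exact lt_add_of_pos_right t hh
  have hlim := (hs.comp hshift).const_mul (1 / β)
  have hev : (fun h => 1 / β * ((slope (fun p => Real.exp (A + ∫ s in t..p, F s)) t) ∘
      fun h => t + h) h) =ᶠ[𝓝[>] 0] fun h =>
      (valueJ P ℱ m W (expTarget β γ) lam (fun _ => 0) ρ t 0 (detControl Ω v) -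
        valueJ P ℱ m W (expTarget β γ) lam (fun _ => 0) ρ t 0
          (deviate (detControl Ω v) (detControl Ω fun _ => w) t h)) / h := by
    filter_upwards [self_mem_nhdsWithin, Ioc_mem_nhdsGT (sub_pos.2 ht.2)] with h hh hhT
    have hda := hv.1.isAdmissible_deviate hM.le hwc t h
    rw [valueJ_sub_valueJ hW hva hda β γ lam ρ ht 0,
      integral_exp_gain_of_deterministic hW hva γ ht 0]
    change IsAdmissible ℱ m.T (detControl Ω fun s => if t ≤ s ∧ s < t + h then w else v s) at hda
    change _ = 1 / β * (∫ ω, Real.exp (-γ * gain P ℱ m W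
      (detControl Ω fun s => if t ≤ s ∧ s < t + h then w else v s) t 0 ω) ∂P - _) / h
    rw [integral_exp_gain_of_deterministic hW hda γ ht 0,
      integral_lossRate_deviate w hhT.1.le (by linarith [hhT.2]) hvi hwi]
    simp only [Function.comp_apply, slope_def_field, intervalIntegral.integral_same, add_zero,
      add_sub_cancel_left, ← hA, hF]
    ring
  have hE := ((continuous_coe_real_ereal.tendsto _).comp (hlim.congr' hev)).liminf_eq
  have h0 := hv.2 t ht 0 _ hwc
  have h1 : (0 : EReal) ≤ ((1 / β * (Real.exp A * ℓ) : ℝ) : EReal) := by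
    rw [← hE]; exact h0
  have h2 : 0 ≤ 1 / β * (Real.exp A * ℓ) := by exact_mod_cast h1
  have h3 : 0 < 1 / β * Real.exp A := by positivity
  rw [← mul_assoc] at h2
  exact nonneg_of_mul_nonneg_right h2 h3

/-- At each positive time an equilibrium control minimizes the loss rate over the cube. -/
theorem lossRate_le_of_isNashEquilibrium (hW : IsCorrelatedBM P ℱ m.T m.R W) {M β γ : ℝ}
    (hM : 0 < M) (hβ : 0 < β) {lam : ℝ → ℝ} {ρ : Measure ℝ → ℝ} {v : ℝ → Fin d → ℝ}
    (hv : IsNashEquilibrium P ℱ m M W (expTarget β γ) lam (fun _ => 0) ρ (detControl Ω v))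
    {t : ℝ} (ht : t ∈ Ioc 0 m.T) {w : Fin d → ℝ} (hw : ∀ k, |w k| ≤ M) :
    lossRate m γ t (v t) ≤ lossRate m γ t w := by
  obtain ⟨ω₀⟩ := nonempty_of_isProbabilityMeasure P
  by_contra! hlt
  -- by left continuity the inequality fails uniformly on an interval to the left of `t`
  have hc : ContinuousWithinAt (fun s => lossRate m γ s w - lossRate m γ s (v s)) (Iic t) t :=
    (continuousWithinAt_lossRate (m.μ_cont.leftCont_Icc ht) (m.σ_cont.leftCont_Icc ht)
      (m.R_cont.leftCont_Icc ht) continuousWithinAt_const).sub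
    (continuousWithinAt_lossRate (m.μ_cont.leftCont_Icc ht) (m.σ_cont.leftCont_Icc ht)
      (m.R_cont.leftCont_Icc ht) (hv.1.leftCont ω₀ t ht))
  obtain ⟨q, hq1, hq2⟩ := exists_between (sub_neg.2 hlt)
  have hev : ∀ᶠ s in 𝓝[≤] t, lossRate m γ s w - lossRate m γ s (v s) < q :=
    hc.tendsto.eventually_lt_const hq1
  obtain ⟨p, hp, hpI⟩ := (mem_nhdsLE_iff_exists_Ioc_subset' ht.1).1 hev
  obtain ⟨s, hs1, hs2⟩ := exists_between (max_lt hp ht.1)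
  have hps : p < s := (le_max_left _ _).trans_lt hs1
  have hsT : s ∈ Ico 0 m.T := ⟨((le_max_right _ _).trans_lt hs1).le, hs2.trans_le ht.2⟩
  obtain ⟨l, hl⟩ := hv.1.rightLim ω₀ s hsT
  have hright : ∀ {E : Type} [TopologicalSpace E] {f : ℝ → E}, ContinuousOn f (Icc 0 m.T) →
      ContinuousWithinAt f (Ioi s) s := fun hf =>
    ((hf s ⟨hsT.1, hsT.2.le⟩).mono_of_mem_nhdsWithin
      (mem_of_superset (Ioc_mem_nhdsGT hsT.2) fun p hp => ⟨hsT.1.trans hp.1.le, hp.2⟩))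
  -- at `s` the control is replaced by its right limit
  have hl' : ContinuousWithinAt (Function.update v s l) (Ioi s) s := by
    rw [ContinuousWithinAt, Function.update_self]
    refine hl.congr' ?_
    filter_upwards [self_mem_nhdsWithin] with y hy
    rw [Function.update_of_ne (ne_of_gt (mem_Ioi.1 hy))]
    rfl
  have hlim := ((continuousWithinAt_lossRate (γ := γ) (hright m.μ_cont) (hright m.σ_cont)
      (hright m.R_cont) (continuousWithinAt_const (b := w))).sub
    (continuousWithinAt_lossRate (γ := γ) (hright m.μ_cont) (hright m.σ_cont)
      (hright m.R_cont) hl')).tendsto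
  have hlim2 : Tendsto (fun p => lossRate m γ p w - lossRate m γ p (v p)) (𝓝[>] s)
      (𝓝 (lossRate m γ s w - lossRate m γ s (Function.update v s l s))) := by
    refine hlim.congr' ?_
    filter_upwards [self_mem_nhdsWithin] with y hy
    rw [Pi.sub_apply, Function.update_of_ne (ne_of_gt (mem_Ioi.1 hy))]
  have h0 := lossRate_rightLim_le hW hM hβ hv hsT hw hlim2
  have hle : lossRate m γ s w - lossRate m γ s (Function.update v s l s) ≤ q := by
    refine le_of_tendsto hlim2 ?_
    filter_upwards [Ioc_mem_nhdsGT hs2] with y hy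
    exact (hpI ⟨hps.trans hy.1, hy.2⟩ : _ < q).le
  linarith

end Equilibrium

theorem theorem6p4 {Ω : Type*} {mΩ : MeasurableSpace Ω} (P : Measure Ω) [IsProbabilityMeasure P]
    (ℱ : Filtration ℝ mΩ) {d : ℕ} (m : BSMarket d) (W : ℝ → Ω → Fin d → ℝ)
    (hW : IsCorrelatedBM P ℱ m.T m.R W) (M β γ : ℝ) (hM : 0 < M) (hβ : 0 < β) (hγ : 0 < γ)
    (lam : ℝ → ℝ) (ρ : Measure ℝ → ℝ) :
    -- the system has exactly one solution at each time
    (∀ t ∈ Ioc 0 m.T, ∃! w : Fin d → ℝ, SolvesSystem m γ t w) ∧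
    -- a control that solves the system at each time is optimal
    (∀ v : ℝ → Fin d → ℝ, IsControl ℱ m.T M (detControl Ω v) →
      (∀ t ∈ Ioc 0 m.T, SolvesSystem m γ t (v t)) →
      IsNashEquilibrium P ℱ m M W (expTarget β γ) lam (fun _ => 0) ρ (detControl Ω v)) ∧
    -- an optimal control solves the system wherever the bound `M` is not attained
    (∀ v : ℝ → Fin d → ℝ,
      IsNashEquilibrium P ℱ m M W (expTarget β γ) lam (fun _ => 0) ρ (detControl Ω v) →
      ∀ t ∈ Ioc 0 m.T, (∀ k, |v t k| < M) → SolvesSystem m γ t (v t)) ∧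
    -- if the solutions of the system obey the bound `M`, then an optimal control exists, and each
    -- optimal control is given by the system
    ((∀ t ∈ Ioc 0 m.T, ∀ w : Fin d → ℝ, SolvesSystem m γ t w → ∀ k, |w k| ≤ M) →
      (∃ v : ℝ → Fin d → ℝ,
        IsNashEquilibrium P ℱ m M W (expTarget β γ) lam (fun _ => 0) ρ (detControl Ω v)) ∧
      ∀ v : ℝ → Fin d → ℝ,
        IsNashEquilibrium P ℱ m M W (expTarget β γ) lam (fun _ => 0) ρ (detControl Ω v) →
        ∀ t ∈ Ioc 0 m.T, SolvesSystem m γ t (v t)) := by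
  have hIcc : ∀ t ∈ Ioc 0 m.T, t ∈ Icc 0 m.T := fun t ht => Ioc_subset_Icc_self ht
  refine ⟨fun t ht => existsUnique_solvesSystem hγ (hIcc t ht),
    fun v hv hsol => isNashEquilibrium_of_solvesSystem hW hM hβ hγ lam ρ hv hsol,
    fun v hv t ht hvt => solvesSystem_of_minimizer hγ (hIcc t ht) hvt fun w hw =>
      lossRate_le_of_isNashEquilibrium hW hM hβ hv ht hw, fun hbd => ⟨?_, fun v hv t ht => ?_⟩⟩
  · have hcont := continuousOn_systemSolution m hγ
    have hsol : ∀ t ∈ Ioc 0 m.T, SolvesSystem m γ t (systemSolution m γ t) := fun t ht =>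
      solvesSystem_systemSolution hγ (hIcc t ht)
    refine ⟨fun t => systemSolution m γ t, isNashEquilibrium_of_solvesSystem hW hM hβ hγ lam ρ
      ⟨fun _ _ => measurable_const, fun _ t ht => hcont.leftCont_Icc ht, fun _ t ht =>
        ⟨systemSolution m γ t, ?_⟩, fun _ t ht k => ?_⟩ hsol⟩
    · exact (hcont t ⟨ht.1, ht.2.le⟩).tendsto.mono_left (nhdsWithin_le_of_mem
        (mem_of_superset (Ioc_mem_nhdsGT ht.2) fun p hp => ⟨ht.1.trans hp.1.le, hp.2⟩))
    -- the bound at time `0` follows by continuity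
    · have hck : ContinuousOn (fun s => |systemSolution m γ s k|) (Icc 0 m.T) :=
        ((continuous_apply k).comp_continuousOn hcont).abs
      have hcl : closure (Ioc 0 m.T) = Icc 0 m.T := closure_Ioc m.T_pos.ne
      rw [← hcl] at hck ht
      exact le_on_closure (fun s hs => hbd s hs _ (hsol s hs) k) hck continuousOn_const ht
  · obtain ⟨w, hw, -⟩ := existsUnique_solvesSystem hγ (hIcc t ht)
    rwa [eq_of_solvesSystem_of_lossRate_le hγ (hIcc t ht) hw
      (lossRate_le_of_isNashEquilibrium hW hM hβ hv ht (hbd t ht w hw))]
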